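/- Let $\gamma\in\mathbb R\setminus\{0\}$ and $\mu>0$, and for $x>0$, $t>0$ put $$g^\gamma_\mu(x,t)=|\gamma|\,\frac{x^{\gamma\mu-1}}{t^{\gamma\mu}\Gamma(\mu)}\,e^{-x^\gamma/t^\gamma},\qquad \tilde g^\gamma_\mu(x,t)=g^\gamma_\mu(x,t^{1/\gamma}).$$ For $0<\nu<1$ let $h_\nu(\cdot,t)$ be the density of the $\nu$-stable subordinator $\tau_t$ with $E e^{-\lambda\tau_t}=e^{-t\lambda^\nu}$, i.e. $$h_\nu(x,t)=\frac1{2\pi}\int_{\mathbb R}e^{-i\xi x}e^{-t\Psi_\nu(\xi)}\,d\xi,\qquad \Psi_\nu(\xi)=|\xi|^\nu e^{-i\frac{\pi\nu}{2}\mathrm{sgn}\,\xi},$$ let $l_\nu(x,t)=\int_t^\infty\partial_x h_\nu(s,x)\,ds$ be the density of the inverse process $L_t$ (for which $\Pr(L_t<x)=\Pr(\tau_x>t)$), and set $$\tilde u^{\gamma,\mu}_\nu(x,t)=\int_0^\infty\tilde g^\gamma_\mu(x,s)\,l_\nu(s,t)\,ds\quad(0<\nu<1),\qquad \tilde u^{\gamma,\mu}_1=\tilde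 g^\gamma_\mu\quad(\text{as } L_t=t \text{ for } \nu=1).$$ Let $$\mathcal G_{\gamma,\mu}f=\frac1{\gamma^2}\Big(\frac{\partial}{\partial x}x^{2-\gamma}\frac{\partial f}{\partial x}-(\gamma\mu-1)\frac{\partial}{\partial x}\big(x^{1-\gamma}f\big)\Big),$$ and let $D^\nu_t$ be the Riemann–Liouville derivative $D^\nu_tf(t)=\frac1{\Gamma(1-\nu)}\frac{d}{dt}\int_0^t(t-s)^{-\nu}f(s)\,ds$ for $0<\nu<1$, and $D^1_t=d/dt$. **(1)** For every $\nu\in(0,1]$ the function $\tilde u^{\gamma,\mu}_\nu$ is well defined on $x>0$, $t>0$ (the integral converges absolutely), is twice continuously differentiable in $x$, its Riemann–Liouville derivative in $t$ exists, and $$D^\nu_t\,\tilde u^{\gamma,\mu}_\nu(x,t)=\mathcal G_{\gamma,\mu}\,\tilde u^{\gamma,\mu}_\nu(x,t),\qquad x>0,\ t>0.$$ **(2)** Let $\nu=1/(2n+1)$, $n\in\mathbb N\cup\{0\}$, and let $$\mathcal Q_{\frac{1-\nu}2}(x,t)=K_{\frac{1-\nu}2}\big(2\sqrt{(x/t)^{1/\nu}}\big),\qquad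 K_p(z)=\int_0^\infty e^{-z\cosh u}\cosh(pu)\,du,$$ $$v_\nu(s,t)=\int_0^\infty\!\!\cdots\!\int_0^\infty\mathcal Q_{\frac{1-\nu}2}(s,s_1)\cdots\mathcal Q_{\frac{1-\nu}2}(s_{n-1},t^\nu/\nu)\,ds_1\cdots ds_{n-1},$$ where for $n=1$ there is no integration, $v_\nu(s,t)=\mathcal Q_{\frac{1-\nu}2}(s,t^\nu/\nu)$, and for $n=0$ (i.e. $\nu=1$) the empty composition $v_1(s,t)\,ds$ is the unit point mass at $s=t$. Then $$\tilde u^{\gamma,\mu}_\nu(x,t)=|\gamma|\,\frac{x^{\gamma\mu-1}}{\Gamma(\mu)}\,\frac{\nu^{\frac{1-3\nu}{4\nu}}}{(\pi^2t^{3\nu})^{\frac{1-\nu}{4\nu}}}\int_0^\infty s^{\frac1{4\nu}-\frac14-\mu}\,e^{-x^\gamma/s}\,v_\nu(s,t)\,ds,\qquad x>0,\ t>0,$$ with absolutely convergent integrals. The same formula holds at $x=0$, with $\tilde u^{\gamma,\mu}_\nu(0,t)$ defined by the same formulas as above taken at $x=0$, whenever $\gamma>0$, $\gamma\mu\ge1$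 and ($n=0$ or $\mu<1$). **(3)** For every $\nu\in(0,1]$, $x>0$ and $t>0$, $$\tilde u^{\gamma,\mu}_\nu(x,t)=\frac{|\gamma|}{x}\,H^{2,0}_{2,2}\left[\frac{x^\gamma}{t^\nu}\,\Bigg|\,\begin{array}{cc}(1,\nu);&(\mu,0)\\(1,1);&(\mu,1)\end{array}\right],$$ where the Fox function is the Mellin–Barnes integral $$H^{2,0}_{2,2}[z]=\frac1{2\pi i}\int_{\theta-i\infty}^{\theta+i\infty}\frac{\Gamma(1+\eta)\,\Gamma(\mu+\eta)}{\Gamma(1+\nu\eta)\,\Gamma(\mu)}\,z^{-\eta}\,d\eta ,$$ which converges absolutely and has the same value for every real $\theta>-\min(1,\mu)$. -/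

import Mathlib

open MeasureTheory Set Filter Topology

noncomputable section

/-- The generalized Gamma density `g^γ_μ(x,t)`, for `x > 0`, `t > 0`, `γ ≠ 0`, `μ > 0`. -/
def genGamma (γ μ x t : ℝ) : ℝ :=
  |γ| * (x ^ (γ * μ - 1) / (t ^ (γ * μ) * Real.Gamma μ)) * Real.exp (-(x ^ γ / t ^ γ))

/-- The time-changed density `g̃^γ_μ(x,t) = g^γ_μ(x, t^{1/γ})`. -/
def genGammaTilde (γ μ x t : ℝ) : ℝ := genGamma γ μ x (t ^ (1 / γ))

/-- The characteristic exponent of the `ν`-stable subordinator `τ` with Laplace transform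
`E exp(-λ τ_t) = exp(-t λ^ν)`, so that `E exp(i ξ τ_t) = exp(-t Ψ_ν(ξ))`, where
`Ψ_ν(ξ) = |ξ|^ν exp(-i (πν/2) ξ/|ξ|)`. -/
def stableExponent (ν ξ : ℝ) : ℂ :=
  ((|ξ| ^ ν : ℝ) : ℂ) * Complex.exp (-(Complex.I * (Real.pi * ν / 2 : ℝ) * (Real.sign ξ : ℝ)))

/-- The density `h_ν(x,t)` at the point `x` of the `ν`-stable subordinator (`0 < ν < 1`) at time
`t > 0`: the inverse Fourier transform of its characteristic function
(which is absolutely integrable). -/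
def stableDensity (ν x t : ℝ) : ℝ :=
  (1 / (2 * Real.pi)) *
    (∫ ξ : ℝ, Complex.exp (-(Complex.I * (ξ : ℂ) * (x : ℂ))) *
      Complex.exp (-((t : ℂ) * stableExponent ν ξ))).re

/-- The density `l_ν(x,t)` at `x > 0` of the inverse stable process `L_t` (`0 < ν < 1`), for which
`Pr(L_t < x) = Pr(τ_x > t)`; that is, `l_ν(x,t) = ∫_t^∞ ∂_x h_ν(s,x) ds`. -/
def invStableDensity (ν x t : ℝ) : ℝ :=
  ∫ s in Ioi t, deriv (fun y : ℝ => stableDensity ν s y) x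

/-- `ũ^{γ,μ}_ν(x,t) = (g̃^γ_μ ∘ l_ν)(x,t) = ∫_0^∞ g̃^γ_μ(x,s) l_ν(s,t) ds`. For `ν = 1` the
inverse process is `L_t = t`, its law is the Dirac mass at `t`, and the integral is `g̃^γ_μ(x,t)`. -/
def uTilde (γ μ ν x t : ℝ) : ℝ :=
  if ν = 1 then genGammaTilde γ μ x t
  else ∫ s in Ioi (0 : ℝ), genGammaTilde γ μ x s * invStableDensity ν s t

/-- The operator
`𝒢_{γ,μ} f = γ⁻² (∂_x x^{2-γ} ∂_x f - (γ μ - 1) ∂_x (x^{1-γ} f))`. -/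
def genBesselOp (γ μ : ℝ) (f : ℝ → ℝ) (x : ℝ) : ℝ :=
  (1 / γ ^ 2) * (deriv (fun y : ℝ => y ^ (2 - γ) * deriv f y) x -
    (γ * μ - 1) * deriv (fun y : ℝ => y ^ (1 - γ) * f y) x)

/-- The Riemann-Liouville fractional derivative of order `ν ∈ (0,1]` of `f` at `t > 0` exists and
equals `d`. For `ν < 1` it is `Γ(1-ν)⁻¹ d/dt ∫_0^t (t-s)^{-ν} f(s) ds`, with a convergent
integral; for `ν = 1` it is the ordinary derivative. -/
def HasRLDerivAt (ν : ℝ) (f : ℝ → ℝ) (d t : ℝ) : Prop :=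
  if ν = 1 then HasDerivAt f d t
  else
    (∀ᶠ r in 𝓝 t, IntervalIntegrable (fun s : ℝ => (r - s) ^ (-ν) * f s) volume 0 r) ∧
    HasDerivAt
      (fun r : ℝ => (1 / Real.Gamma (1 - ν)) * ∫ s in (0 : ℝ)..r, (r - s) ^ (-ν) * f s) d t

/-- The modified Bessel function of the second kind, `K_p(z)` for `z > 0`. -/
def besselK (p z : ℝ) : ℝ :=
  ∫ u in Ioi (0 : ℝ), Real.exp (-(z * Real.cosh u)) * Real.cosh (p * u)

/-- `𝒬_{(1-ν)/2}(x,t) = K_{(1-ν)/2}(2 √((x/t)^{1/ν}))`. -/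
def besselQ (ν x t : ℝ) : ℝ :=
  besselK ((1 - ν) / 2) (2 * Real.sqrt ((x / t) ^ (1 / ν)))

/-- The `n`-fold composition `𝒬^{∘ n}(s,T)`, for `n ≥ 1`:
`∫_0^∞ ⋯ ∫_0^∞ 𝒬(s,s_1) ⋯ 𝒬(s_{n-1},T) ds_1 ⋯ ds_{n-1}` (the value at `n = 0` is not used). -/
def besselQIter (ν : ℝ) : ℕ → ℝ → ℝ → ℝ
  | 0, _, _ => 0
  | 1, s, T => besselQ ν s T
  | n + 2, s, T => ∫ r in Ioi (0 : ℝ), besselQ ν s r * besselQIter ν (n + 1) r T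

/-- `∫_0^∞ φ(s) 𝒬^{∘ n}(s,T) ds`; the `0`-fold composition is the identity kernel, that is, the
Dirac mass at `T`. -/
def besselQIntegral (ν : ℝ) (n : ℕ) (T : ℝ) (φ : ℝ → ℝ) : ℝ :=
  if n = 0 then ∫ s, φ s ∂(Measure.dirac T)
  else ∫ s in Ioi (0 : ℝ), φ s * besselQIter ν n s T

/-- The Mellin-Barnes kernel of the Fox function `H^{m,n}_{p,q}` with upper parameters
`a i = (a_i, α_i)` and lower parameters `b j = (b_j, β_j)`. -/
def foxKernel {p q : ℕ} (m n : ℕ) (a : Fin p → ℝ × ℝ) (b : Fin q → ℝ × ℝ) (η : ℂ) : ℂ :=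
  ((∏ j : Fin q, if (j : ℕ) < m then Complex.Gamma ((b j).1 + η * (b j).2) else 1) *
    (∏ i : Fin p, if (i : ℕ) < n then Complex.Gamma (1 - (a i).1 - η * (a i).2) else 1)) /
  ((∏ j : Fin q, if (j : ℕ) < m then 1 else Complex.Gamma (1 - (b j).1 - η * (b j).2)) *
    (∏ i : Fin p, if (i : ℕ) < n then 1 else Complex.Gamma ((a i).1 + η * (a i).2)))

/-- The real `θ` lies in the fundamental strip: the Gamma factors in the numerator of the
kernel have arguments of positive real part on the line `Re η = θ`. -/
def InFoxStrip {p q : ℕ} (m n : ℕ) (a : Fin p → ℝ × ℝ) (b : Fin q → ℝ × ℝ) (θ : ℝ) : Prop :=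
  (∀ j : Fin q, (j : ℕ) < m → 0 < (b j).1 + θ * (b j).2) ∧
  (∀ i : Fin p, (i : ℕ) < n → 0 < 1 - (a i).1 - θ * (a i).2)

/-- `H^{m,n}_{p,q}[z | a ; b] = w`: the fundamental strip is nonempty, and on each vertical line
`Re η = θ` in it the Mellin-Barnes integral `(2πi)⁻¹ ∫ kernel(η) z^{-η} dη` converges absolutely
and has the value `w`. -/
def IsFoxH {p q : ℕ} (m n : ℕ) (a : Fin p → ℝ × ℝ) (b : Fin q → ℝ × ℝ) (z : ℝ) (w : ℂ) : Prop :=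
  (∃ θ : ℝ, InFoxStrip m n a b θ) ∧
  ∀ θ : ℝ, InFoxStrip m n a b θ →
    Integrable (fun y : ℝ =>
      foxKernel m n a b ((θ : ℂ) + y * Complex.I) * (z : ℂ) ^ (-((θ : ℂ) + y * Complex.I))) ∧
    w = (1 / (2 * Real.pi : ℝ) : ℂ) * ∫ y : ℝ,
      foxKernel m n a b ((θ : ℂ) + y * Complex.I) * (z : ℂ) ^ (-((θ : ℂ) + y * Complex.I))

end

/-! Everything takes place on the Mellin side. The central fact is `hasMellin_invStableDensity`: for
`Re p > 0` the density `l_ν(·,t)` has Mellin transform `Γ(p) / Γ(1-ν(1-p)) · t^(-ν(1-p))`. To prove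
it, the Fourier contour of `h_ν` is rotated to a ray on which both exponentials decay. Then `l_ν` is
the imaginary part of an absolutely convergent integral whose Mellin transform is a product of two
Euler integrals. Taking the imaginary part produces `sin(πν(1-p))`, and the reflection formula turns
this sine into `1/Γ`. This covers `0 < Re p < 1`; decay of `l_ν` faster than any power and analytic
continuation give the rest.

Fox function: `g̃(x,s)` is a multiple of `w^μ e^(-w)` at `w = x^γ/s`. Mellin inversion of `Γ` and
Fubini express `ũ` through the Mellin transform of `l_ν`, on every line `Re η = θ > -min(1,μ)`
(`uTilde_eq_mbInt`).

Equation: put `ρ = x^γ/t^ν` and `δ = ρ d/dρ`, which multiplies the kernel by `-η`. On functions `x⁻¹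
A(ρ)` the operator `𝒢` is `x^(-γ-1) (δ-1)(δ-μ)`, so the kernel receives the factor `(1+η)(μ+η)`; by
the functional equation of `Γ` this is the unit shift `η → η+1` in its numerator. In `t`, the
fractional integral of `t^(νη)` is a Beta integral, and it performs the same shift in the
denominator. Writing `ũ` on `Re η = 1` for the fractional side and on `Re η = 0` for `𝒢` therefore
gives the same integral.

Bessel form: the Mellin transform of `𝒬` is a product of two Gamma values, and composition
multiplies transforms with a unit shift (`hasMellin_integral_comp_div`). The `n`-fold composition
yields `2n` Gamma values in arithmetic progression. Gauss' formula with `2n+1` factors identifies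
their product with the transform of `l_ν` up to constants (`prod_besselMellin`,
`besselConstant_eq`). Integrals against `w^μ e^(-w)` depend only on the transform
(`integral_gamma_kernel_congr`). -/

/-! ### The Gamma function on vertical lines. -/

theorem integrableOn_rpow_mul_exp_neg_mul_Ioi {a c : ℝ} (ha : 0 < a) (hc : 0 < c) :
    IntegrableOn (fun t : ℝ => t ^ (a - 1) * Real.exp (-(c * t))) (Ioi 0) := by
  have := integrableOn_rpow_mul_exp_neg_mul_rpow (p := 1) (s := a - 1) (b := c) (by linarith)
    one_pos hc
  simpa only [Real.rpow_one, neg_mul] using this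

theorem norm_cpow_mul_cexp_neg_mul {s r : ℂ} {t : ℝ} (ht : 0 < t) :
    ‖(t : ℂ) ^ (s - 1) * Complex.exp (-(r * t))‖ =
      t ^ (s.re - 1) * Real.exp (-(r.re * t)) := by
  rw [norm_mul, Complex.norm_cpow_eq_rpow_re_of_pos ht, Complex.norm_exp]
  simp

theorem integrableOn_cpow_mul_cexp_neg_mul_Ioi {s r : ℂ} (hs : 0 < s.re) (hr : 0 < r.re) :
    IntegrableOn (fun t : ℝ => (t : ℂ) ^ (s - 1) * Complex.exp (-(r * t))) (Ioi 0) := by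
  refine Integrable.mono' (integrableOn_rpow_mul_exp_neg_mul_Ioi hs hr) ?_ ?_
  · exact (by fun_prop : Measurable fun t : ℝ =>
      (t : ℂ) ^ (s - 1) * Complex.exp (-(r * t))).aestronglyMeasurable
  · filter_upwards [ae_restrict_mem measurableSet_Ioi] with t ht
    exact (norm_cpow_mul_cexp_neg_mul ht).le

/-- Euler's integral with a complex rate. -/
theorem integral_cpow_mul_cexp_neg_mul_Ioi {s r : ℂ} (hs : 0 < s.re) (hr : 0 < r.re) :
    ∫ t : ℝ in Ioi 0, (t : ℂ) ^ (s - 1) * Complex.exp (-(r * t)) = r ^ (-s) * Complex.Gamma s := by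
  have hopen : IsOpen {z : ℂ | 0 < z.re} := isOpen_lt continuous_const Complex.continuous_re
  have hd : ∀ r : ℂ, 0 < r.re → DifferentiableAt ℂ (fun r : ℂ =>
      ∫ t : ℝ in Ioi 0, (t : ℂ) ^ (s - 1) * Complex.exp (-(r * t))) r := by
    intro r hr
    have hr2 : 0 < r.re / 2 := by linarith
    refine (hasDerivAt_integral_of_dominated_loc_of_deriv_le (μ := volume.restrict (Ioi (0 : ℝ)))
      (F := fun z (t : ℝ) => (t : ℂ) ^ (s - 1) * Complex.exp (-(z * t)))
      (F' := fun z (t : ℝ) => (t : ℂ) ^ (s - 1) * (Complex.exp (-(z * t)) * (-(1 * (t : ℂ)))))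
      (s := {z : ℂ | r.re / 2 < z.re})
      (bound := fun t : ℝ => t ^ (s.re + 1 - 1) * Real.exp (-(r.re / 2 * t)))
      ((isOpen_lt continuous_const Complex.continuous_re).mem_nhds
        (by simp only [mem_ofPred_eq]; linarith)) ?_
      (integrableOn_cpow_mul_cexp_neg_mul_Ioi hs hr) ?_ ?_
      (integrableOn_rpow_mul_exp_neg_mul_Ioi (by linarith) hr2) ?_).2.differentiableAt
    · exact Eventually.of_forall fun z => (by fun_prop : Measurable fun t : ℝ =>
        (t : ℂ) ^ (s - 1) * Complex.exp (-(z * t))).aestronglyMeasurable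
    · exact (by fun_prop : Measurable fun t : ℝ =>
        (t : ℂ) ^ (s - 1) * (Complex.exp (-(r * t)) * (-(1 * (t : ℂ))))).aestronglyMeasurable
    · filter_upwards [ae_restrict_mem measurableSet_Ioi] with t ht z hz
      have ht' : 0 < t := ht
      have hz' : r.re / 2 < z.re := hz
      rw [← mul_assoc, norm_mul, norm_cpow_mul_cexp_neg_mul ht]
      have : ‖-(1 * (t : ℂ))‖ = t := by simp [abs_of_pos ht']
      rw [this, show s.re + 1 - 1 = s.re - 1 + 1 by ring, Real.rpow_add_one ht'.ne',
        mul_right_comm]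
      gcongr
    · refine Eventually.of_forall fun t z _ => ?_
      exact ((((hasDerivAt_id z).mul_const (t : ℂ)).neg).cexp).const_mul _
  have h1 : AnalyticOnNhd ℂ (fun r : ℂ =>
      ∫ t : ℝ in Ioi 0, (t : ℂ) ^ (s - 1) * Complex.exp (-(r * t))) {z : ℂ | 0 < z.re} :=
    DifferentiableOn.analyticOnNhd (fun z hz => (hd z hz).differentiableWithinAt) hopen
  have h2 : AnalyticOnNhd ℂ (fun r : ℂ => r ^ (-s) * Complex.Gamma s) {z : ℂ | 0 < z.re} := by
    refine DifferentiableOn.analyticOnNhd (fun z hz => ?_) hopen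
    exact ((differentiableAt_id.cpow_const (Or.inl hz)).mul_const _).differentiableWithinAt
  -- Identity theorem: both sides are holomorphic in `r` on the right half plane and agree for real
  -- `r > 0`, which accumulate at `1`.
  refine h1.eqOn_of_preconnected_of_frequently_eq h2 (convex_halfSpace_re_gt 0).isPreconnected
    (z₀ := 1) (by simp) ?_ hr
  have hfr : ∃ᶠ x : ℝ in 𝓝[≠] (1 : ℝ), 0 < x :=
    (eventually_nhdsWithin_of_eventually_nhds (lt_mem_nhds one_pos)).frequently
  have hten : Tendsto (fun x : ℝ => (x : ℂ)) (𝓝[≠] (1 : ℝ)) (𝓝[≠] (1 : ℂ)) := by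
    refine tendsto_nhdsWithin_iff.2 ⟨?_, ?_⟩
    · exact (Complex.continuous_ofReal.tendsto' 1 1 (by simp)).mono_left nhdsWithin_le_nhds
    · filter_upwards [self_mem_nhdsWithin] with x hx
      simpa using hx
  refine hten.frequently (hfr.mono fun x hx => ?_)
  rw [Complex.integral_cpow_mul_exp_neg_mul_Ioi hs hx, one_div, Complex.inv_cpow, Complex.cpow_neg]
  rw [Complex.arg_ofReal_of_nonneg hx.le]
  exact Real.pi_pos.ne

/-- Exponential decay of the Gamma function along vertical lines. -/
theorem exists_norm_Gamma_le {σ : ℝ} (hσ : 0 < σ) :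
    ∃ C : ℝ, 0 ≤ C ∧ ∀ y : ℝ, ‖Complex.Gamma (σ + y * Complex.I)‖ ≤ C * Real.exp (-|y|) := by
  have hcos : 0 < Real.cos 1 := Real.cos_one_pos
  refine ⟨∫ t in Ioi (0 : ℝ), t ^ (σ - 1) * Real.exp (-(Real.cos 1 * t)),
    setIntegral_nonneg measurableSet_Ioi fun t ht => ?_, fun y => ?_⟩
  · have : 0 < t := ht
    positivity
  -- Euler's integral with rate `e^(iψ)`: the factor `r^(-s)` has modulus `e^(yψ)`, while the
  -- modulus of the integrand depends only on `cos ψ`. Taking `ψ = ±1` according to the sign of `y`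
  -- gives the decay; `1 < π/2` keeps `cos 1` positive.
  have key : ∀ ψ : ℝ, Real.cos ψ = Real.cos 1 → |ψ| ≤ 1 →
      Real.exp (y * ψ) * ‖Complex.Gamma (σ + y * Complex.I)‖ ≤
        ∫ t in Ioi (0 : ℝ), t ^ (σ - 1) * Real.exp (-(Real.cos 1 * t)) := by
    intro ψ hψ hψ1
    have hre : (Complex.exp (ψ * Complex.I)).re = Real.cos 1 := by
      rw [Complex.exp_ofReal_mul_I_re, hψ]
    have hs : 0 < ((σ : ℂ) + y * Complex.I).re := by simpa using hσ
    have h := integral_cpow_mul_cexp_neg_mul_Ioi (s := σ + y * Complex.I)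
      (r := Complex.exp (ψ * Complex.I)) hs (by rw [hre]; exact hcos)
    have hn : ‖Complex.exp (ψ * Complex.I) ^ (-((σ : ℂ) + y * Complex.I))‖ =
        Real.exp (y * ψ) := by
      rw [Complex.cpow_def_of_ne_zero (Complex.exp_ne_zero _), Complex.log_exp, Complex.norm_exp]
      · simp
        ring
      · have := (abs_le.1 hψ1).1
        have := Real.pi_gt_three
        simp
        linarith
      · have := (abs_le.1 hψ1).2
        have := Real.pi_gt_three
        simp
        linarith
    rw [← hn, ← norm_mul, ← h]
    refine (norm_integral_le_integral_norm _).trans (le_of_eq ?_)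
    refine setIntegral_congr_fun measurableSet_Ioi fun t ht => ?_
    simp only [norm_cpow_mul_cexp_neg_mul ht, hre]
    simp
  rcases le_total 0 y with hy | hy
  · have := key 1 rfl (by simp)
    rw [mul_one] at this
    rwa [abs_of_nonneg hy, Real.exp_neg, ← div_eq_mul_inv, le_div_iff₀' (Real.exp_pos _)]
  · have := key (-1) (by simp) (by simp)
    rw [mul_neg_one] at this
    rwa [abs_of_nonpos hy, neg_neg, ← neg_neg y, Real.exp_neg (-y), ← div_eq_mul_inv,
      le_div_iff₀' (Real.exp_pos _), neg_neg]

theorem continuous_Gamma_vertical {σ : ℝ} (hσ : 0 < σ) :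
    Continuous fun y : ℝ => Complex.Gamma (σ + y * Complex.I) := by
  refine continuous_iff_continuousAt.2 fun y => ?_
  refine ContinuousAt.comp (f := fun y : ℝ => (σ : ℂ) + y * Complex.I) ?_ (by fun_prop)
  refine (Complex.differentiableAt_Gamma _ fun m h => ?_).continuousAt
  have := congrArg Complex.re h
  simp at this
  have : (0 : ℝ) ≤ m := Nat.cast_nonneg m
  linarith

theorem integrable_exp_neg_mul_abs {c : ℝ} (hc : 0 < c) :
    Integrable fun y : ℝ => Real.exp (-(c * |y|)) := by
  rw [← integrableOn_univ, ← Iic_union_Ioi (a := (0 : ℝ)), integrableOn_union]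
  constructor
  · refine (integrableOn_exp_mul_Iic hc 0).congr_fun (fun y hy => ?_) measurableSet_Iic
    simp [abs_of_nonpos (mem_Iic.1 hy)]
  · refine (exp_neg_integrableOn_Ioi 0 hc).congr_fun (fun y hy => ?_) measurableSet_Ioi
    simp [abs_of_pos (mem_Ioi.1 hy)]

theorem integrable_Gamma_vertical {σ : ℝ} (hσ : 0 < σ) :
    Integrable fun y : ℝ => Complex.Gamma (σ + y * Complex.I) := by
  obtain ⟨C, -, hC⟩ := exists_norm_Gamma_le hσ
  refine ((integrable_exp_neg_mul_abs one_pos).const_mul C).mono'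
    (continuous_Gamma_vertical hσ).aestronglyMeasurable (Eventually.of_forall fun y => ?_)
  simpa using hC y

/-- Mellin inversion for the Gamma function. -/
theorem integral_cpow_neg_mul_Gamma {σ x : ℝ} (hσ : 0 < σ) (hx : 0 < x) :
    ∫ y : ℝ, (x : ℂ) ^ (-((σ : ℂ) + y * Complex.I)) * Complex.Gamma (σ + y * Complex.I) =
      2 * Real.pi * Complex.exp (-x) := by
  have hm : ∀ y : ℝ, mellin (fun t : ℝ => Complex.exp (-t)) (σ + y * Complex.I) =
      Complex.Gamma (σ + y * Complex.I) := by
    intro y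
    rw [Complex.Gamma_eq_integral (by simpa using hσ), Complex.GammaIntegral_eq_mellin]
    simp
  have h := mellinInv_mellin_eq σ (fun t : ℝ => Complex.exp (-t)) hx ?_ ?_ (by fun_prop)
  · simp only [mellinInv, hm, smul_eq_mul, one_div, Complex.real_smul] at h
    rw [← h]
    push_cast
    rw [← mul_assoc, mul_inv_cancel₀ (by simp), one_mul]
  · have := integrableOn_cpow_mul_cexp_neg_mul_Ioi (s := σ) (r := 1) (by simpa using hσ) (by simp)
    simpa [MellinConvergent] using this
  · simp only [Complex.VerticalIntegrable, hm]
    exact integrable_Gamma_vertical hσ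

/-! ### Gauss' multiplication formula. -/

/-- Scaling `w + j/N + m` by `N` gives `N w + i` with `i = N m + j`, and every `i < N k` has exactly
one such form. -/
theorem prod_prod_add_div_mul_pow {N : ℕ} (hN : 0 < N) (w : ℂ) (k : ℕ) :
    (∏ j ∈ Finset.range N, ∏ m ∈ Finset.range k, (w + j / N + m)) * (N : ℂ) ^ (N * k) =
      ∏ i ∈ Finset.range (N * k), (N * w + i) := by
  have hN' : (N : ℂ) ≠ 0 := by exact_mod_cast hN.ne'
  induction k with
  | zero => simp
  | succ k ih =>
    rw [Nat.mul_succ, Finset.prod_range_add, ← ih, pow_add]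
    simp only [Finset.prod_range_succ, Finset.prod_mul_distrib]
    rw [mul_mul_mul_comm]
    congr 1
    have hc : (N : ℂ) ^ N = ∏ _j ∈ Finset.range N, (N : ℂ) := by simp
    rw [hc, ← Finset.prod_mul_distrib]
    refine Finset.prod_congr rfl fun j _ => ?_
    push_cast
    field_simp
    ring

theorem tendsto_cpow_div_cpow_pow {N : ℕ} (hN : 0 < N) (w : ℂ) :
    Tendsto (fun n : ℕ => ((n : ℂ) ^ w / ((N * (n + 1) - 1 : ℕ) : ℂ) ^ w) ^ N) atTop
      (𝓝 (((N : ℂ)⁻¹ ^ w) ^ N)) := by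
  have hN' : (0 : ℝ) < N := by exact_mod_cast hN
  have h1 : Tendsto (fun n : ℕ => (n : ℝ) / ((N * (n + 1) - 1 : ℕ) : ℝ)) atTop (𝓝 (N : ℝ)⁻¹) := by
    have : Tendsto (fun n : ℕ => (N : ℝ) + ((N : ℝ) - 1) * (n : ℝ)⁻¹) atTop (𝓝 N) := by
      simpa using (tendsto_inv_atTop_nhds_zero_nat (𝕜 := ℝ)).const_mul ((N : ℝ) - 1) |>.const_add
        (N : ℝ)
    refine (this.inv₀ hN'.ne').congr' ?_
    filter_upwards [eventually_gt_atTop 0] with n hn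
    have hn' : (0 : ℝ) < n := by exact_mod_cast hn
    rw [Nat.cast_sub (Nat.one_le_iff_ne_zero.2 (by positivity))]
    push_cast
    rw [← inv_div]
    congr 1
    field_simp
    ring
  have h2 : Tendsto (fun n : ℕ => (((n : ℝ) / ((N * (n + 1) - 1 : ℕ) : ℝ) : ℝ) : ℂ) ^ w) atTop
      (𝓝 ((((N : ℝ)⁻¹ : ℝ) : ℂ) ^ w)) :=
    ((Complex.continuousAt_ofReal_cpow_const (N : ℝ)⁻¹ w (Or.inr (inv_pos.2 hN').ne')).tendsto).comp
      h1
  refine ((h2.pow N).congr fun n => ?_).trans (by simp)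
  rw [Complex.ofReal_div, Complex.div_cpow_ofReal_nonneg (Nat.cast_nonneg _) (Nat.cast_nonneg _)]
  simp

/-- The index `N(n+1) - 1` is forced: `GammaSeq` at index `M` has `M + 1` factors in its
denominator, and the product over `j` has `N(n+1)`. The last factor on the right does not involve
`w`, so its limit can be found from a single value of `w`. -/
theorem prod_GammaSeq_add_div {N : ℕ} (hN : 0 < N) (w : ℂ) {n : ℕ} (hn : 0 < n) :
    ∏ j ∈ Finset.range N, Complex.GammaSeq (w + j / N) n =
      Complex.GammaSeq (N * w) (N * (n + 1) - 1) *
        ((n : ℂ) ^ w / ((N * (n + 1) - 1 : ℕ) : ℂ) ^ w) ^ N *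
        ((∏ j ∈ Finset.range N, (n : ℂ) ^ ((j : ℂ) / N) * n.factorial) * (N : ℂ) ^ (N * (n + 1)) /
          (N * (n + 1) - 1).factorial) := by
  have hN' : (N : ℂ) ≠ 0 := by exact_mod_cast hN.ne'
  have hn' : (n : ℂ) ≠ 0 := by exact_mod_cast hn.ne'
  have hM1 : N * (n + 1) - 1 + 1 = N * (n + 1) := Nat.sub_add_cancel (by nlinarith)
  have hM0 : N * (n + 1) - 1 ≠ 0 := by
    have : 2 ≤ N * (n + 1) := by nlinarith
    omega
  have hM : ((N * (n + 1) - 1 : ℕ) : ℂ) ≠ 0 := by exact_mod_cast hM0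
  have hMf : ((N * (n + 1) - 1).factorial : ℂ) ≠ 0 := by exact_mod_cast Nat.factorial_ne_zero _
  have hMw : ((N * (n + 1) - 1 : ℕ) : ℂ) ^ w ≠ 0 := by
    rw [Complex.cpow_def_of_ne_zero hM]
    exact Complex.exp_ne_zero _
  have hNN : (N : ℂ) ^ (N * (n + 1)) ≠ 0 := pow_ne_zero _ hN'
  simp only [Complex.GammaSeq]
  rw [hM1, ← prod_prod_add_div_mul_pow hN, Complex.cpow_nat_mul, Finset.prod_div_distrib]
  simp only [Complex.cpow_add _ _ hn', mul_assoc]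
  rw [Finset.prod_mul_distrib, Finset.prod_const, Finset.card_range]
  generalize (∏ j ∈ Finset.range N, ∏ m ∈ Finset.range (n + 1), (w + j / N + m)) = D
  generalize ((N * (n + 1) - 1 : ℕ) : ℂ) ^ w = Z at *
  generalize (∏ j ∈ Finset.range N, (n : ℂ) ^ ((j : ℂ) / N) * n.factorial) = E
  have : Z ^ N ≠ 0 := pow_ne_zero _ hMw
  rw [div_pow]
  -- If a denominator vanishes, both sides are `0` by the convention for division by zero.
  by_cases hD : D = 0
  · simp [hD]
  field_simp

/-- Gauss' multiplication formula, with the constant expressed by Gamma values. -/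
theorem prod_Gamma_add_div {N : ℕ} (hN : 0 < N) (w : ℂ) :
    ∏ j ∈ Finset.range N, Complex.Gamma (w + j / N) =
      Complex.Gamma (N * w) * ((N : ℂ)⁻¹ ^ w) ^ N *
        (N * ∏ j ∈ Finset.range N, Complex.Gamma (1 / N + j / N)) := by
  have hN' : (N : ℂ) ≠ 0 := by exact_mod_cast hN.ne'
  have hM : Tendsto (fun n : ℕ => N * (n + 1) - 1) atTop atTop := by
    refine tendsto_atTop_mono (fun n => ?_) tendsto_id
    have : n + 1 ≤ N * (n + 1) := Nat.le_mul_of_pos_left _ hN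
    simp only [id]
    omega
  have hprod : ∀ w : ℂ, Tendsto (fun n => ∏ j ∈ Finset.range N, Complex.GammaSeq (w + j / N) n)
      atTop (𝓝 (∏ j ∈ Finset.range N, Complex.Gamma (w + j / N))) := fun w =>
    tendsto_finsetProd _ fun j _ => Complex.GammaSeq_tendsto_Gamma _
  have hquot : ∀ w : ℂ, Tendsto (fun n : ℕ => Complex.GammaSeq (N * w) (N * (n + 1) - 1) *
      ((n : ℂ) ^ w / ((N * (n + 1) - 1 : ℕ) : ℂ) ^ w) ^ N) atTop
      (𝓝 (Complex.Gamma (N * w) * ((N : ℂ)⁻¹ ^ w) ^ N)) := fun w =>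
    ((Complex.GammaSeq_tendsto_Gamma _).comp hM).mul (tendsto_cpow_div_cpow_pow hN w)
  -- At `w = 1/N` the Gamma value is `Γ(1) = 1`; dividing by this known limit isolates the limit of
  -- the factor free of `w`.
  have hone : Complex.Gamma (N * (1 / N)) * ((N : ℂ)⁻¹ ^ (1 / N : ℂ)) ^ N = (N : ℂ)⁻¹ := by
    rw [mul_one_div_cancel hN', Complex.Gamma_one, one_mul, one_div,
      Complex.cpow_nat_inv_pow _ hN.ne']
  have hA : Tendsto (fun n : ℕ => (∏ j ∈ Finset.range N, (n : ℂ) ^ ((j : ℂ) / N) * n.factorial) *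
      (N : ℂ) ^ (N * (n + 1)) / (N * (n + 1) - 1).factorial) atTop
      (𝓝 (N * ∏ j ∈ Finset.range N, Complex.Gamma (1 / N + j / N))) := by
    have h := (hprod (1 / N)).div (hquot (1 / N)) (by rw [hone]; exact inv_ne_zero hN')
    rw [hone, div_inv_eq_mul, mul_comm _ (N : ℂ)] at h
    have hne := (hquot (1 / N)).eventually_ne (by rw [hone]; exact inv_ne_zero hN')
    refine h.congr' ?_
    filter_upwards [eventually_gt_atTop 0, hne] with n hn hn0
    simp only [Pi.div_apply]
    rw [prod_GammaSeq_add_div hN _ hn, mul_div_cancel_left₀ _ hn0]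
  refine tendsto_nhds_unique (hprod w) (((hquot w).mul hA).congr' ?_)
  filter_upwards [eventually_gt_atTop 0] with n hn
  rw [prod_GammaSeq_add_div hN _ hn]

/-- The product of `1 - ζ^k` over the nontrivial powers of a primitive `(n+1)`-th root of unity is
`n + 1`, and the modulus of each factor is twice a sine. -/
theorem prod_range_sin_pi_mul_div (n : ℕ) :
    ∏ k ∈ Finset.range n, (2 * Real.sin (Real.pi * ((k + 1) / (n + 1)))) = n + 1 := by
  have h := (Complex.isPrimitiveRoot_exp (n + 1) n.succ_ne_zero).prod_one_sub_pow_eq_order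
  have h2 := congrArg norm h
  rw [norm_prod] at h2
  have h3 : ‖((n : ℂ) + 1)‖ = n + 1 := by
    exact_mod_cast Complex.norm_natCast (n + 1)
  rw [h3] at h2
  refine Eq.trans (Finset.prod_congr rfl fun k hk => ?_) h2
  have hk' : (k : ℝ) + 1 < n + 1 := by
    have := Finset.mem_range.1 hk
    exact_mod_cast Nat.succ_lt_succ this
  have hs : 0 < Real.sin (Real.pi * ((k + 1) / (n + 1))) := by
    apply Real.sin_pos_of_pos_of_lt_pi
    · positivity
    · have : ((k : ℝ) + 1) / (n + 1) < 1 := by rw [div_lt_one (by positivity)]; exact hk'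
      nlinarith [Real.pi_pos]
  rw [← Complex.exp_nat_mul, norm_sub_rev]
  have : ((k + 1 : ℕ) : ℂ) * (2 * Real.pi * Complex.I / ((n + 1 : ℕ) : ℂ)) =
      Complex.I * ((2 * (Real.pi * ((k + 1) / (n + 1))) : ℝ) : ℂ) := by
    push_cast
    ring
  rw [this, Complex.norm_exp_I_mul_ofReal_sub_one, mul_div_cancel_left₀ _ two_ne_zero,
    Real.norm_eq_abs, abs_of_pos (by positivity)]

/-- Pair each factor with its mirror image; the reflection formula leaves a product of sines. -/
theorem prod_range_Gamma_div_sq (n : ℕ) :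
    (∏ k ∈ Finset.range n, Real.Gamma ((k + 1) / (n + 1))) ^ 2 = (2 * Real.pi) ^ n / (n + 1) := by
  have hr : ∏ k ∈ Finset.range n, Real.Gamma ((k + 1) / (n + 1)) =
      ∏ k ∈ Finset.range n, Real.Gamma (1 - (k + 1) / (n + 1)) := by
    rw [← Finset.prod_range_reflect]
    refine Finset.prod_congr rfl fun k hk => ?_
    have hk' := Finset.mem_range.1 hk
    congr 1
    rw [Nat.cast_sub (by omega), Nat.cast_sub (by omega)]
    push_cast
    field_simp
    ring
  rw [sq]
  nth_rewrite 2 [hr]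
  rw [← Finset.prod_mul_distrib]
  simp_rw [Real.Gamma_mul_Gamma_one_sub]
  have hc : (2 * Real.pi) ^ n = ∏ _k ∈ Finset.range n, (2 * Real.pi) := by simp
  refine Eq.trans ?_ (congrArg ((2 * Real.pi) ^ n / ·) (prod_range_sin_pi_mul_div n))
  simp only [hc]
  rw [← Finset.prod_div_distrib]
  refine Finset.prod_congr rfl fun k _ => ?_
  rw [mul_div_mul_left _ _ two_ne_zero]

/-- Gauss' multiplication formula for an odd number of factors. -/
theorem prod_Gamma_add_div_odd (n : ℕ) (w : ℂ) :
    ∏ j ∈ Finset.range (2 * n + 1), Complex.Gamma (w + j / (2 * n + 1 : ℝ)) =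
      Complex.Gamma ((2 * n + 1 : ℝ) * w) * ((2 * n + 1 : ℝ) : ℂ) ^ (-((2 * n + 1 : ℝ) * w)) *
        (((2 * Real.pi) ^ n * Real.sqrt (2 * n + 1) : ℝ) : ℂ) := by
  have h := prod_Gamma_add_div (N := 2 * n + 1) (by omega) w
  have hP : ∏ k ∈ Finset.range (2 * n), Real.Gamma ((k + 1) / (2 * n + 1)) =
      (2 * Real.pi) ^ n / Real.sqrt (2 * n + 1) := by
    refine (sq_eq_sq₀ (Finset.prod_nonneg fun k _ => ?_) (by positivity)).1 ?_
    · exact (Real.Gamma_pos_of_pos (by positivity)).le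
    · have := prod_range_Gamma_div_sq (2 * n)
      push_cast at this
      rw [this, div_pow, Real.sq_sqrt (by positivity), ← pow_mul, mul_comm n 2]
  have hP' : ∏ j ∈ Finset.range (2 * n + 1),
      Complex.Gamma (1 / (2 * n + 1 : ℕ) + j / (2 * n + 1 : ℕ)) =
      (((2 * Real.pi) ^ n / Real.sqrt (2 * n + 1) : ℝ) : ℂ) := by
    rw [← hP, Finset.prod_range_succ]
    push_cast
    have h1 : (1 : ℂ) / (2 * n + 1) + (2 * n) / (2 * n + 1) = 1 := by
      have : (2 * (n : ℂ) + 1) ≠ 0 := by exact_mod_cast (2 * n).succ_ne_zero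
      field_simp
      ring
    rw [h1, Complex.Gamma_one, mul_one]
    refine Finset.prod_congr rfl fun k _ => ?_
    rw [← Complex.Gamma_ofReal]
    push_cast
    ring_nf
  rw [hP'] at h
  have hs : (Real.sqrt (2 * n + 1)) ^ 2 = 2 * n + 1 := Real.sq_sqrt (by positivity)
  have hs0 : Real.sqrt (2 * n + 1) ≠ 0 := by positivity
  have e1 : (((2 * n + 1 : ℕ) : ℂ)⁻¹ ^ w) ^ (2 * n + 1) =
      ((2 * n + 1 : ℝ) : ℂ) ^ (-((2 * n + 1 : ℝ) * w)) := by
    rw [← Complex.cpow_nat_mul, Complex.inv_cpow, ← Complex.cpow_neg]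
    · push_cast
      rfl
    · rw [Complex.natCast_arg]
      exact Real.pi_pos.ne
  rw [e1] at h
  have e2 : (((2 * n + 1 : ℕ) : ℂ) * (((2 * Real.pi) ^ n / Real.sqrt (2 * n + 1) : ℝ) : ℂ)) =
      (((2 * Real.pi) ^ n * Real.sqrt (2 * n + 1) : ℝ) : ℂ) := by
    rw [← Complex.ofReal_natCast, ← Complex.ofReal_mul]
    congr 1
    push_cast
    nth_rewrite 1 [← hs]
    field_simp
  rw [e2] at h
  rw [← Complex.ofReal_natCast] at h
  simpa using h

/-! ### Mellin transforms of compositions and the Mellin-Barnes formula. -/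

/-- The power weight can be divided out. Parametric integrals such as `invStableDensity` get their
measurability in this way. -/
theorem MellinConvergent.aestronglyMeasurable {f : ℝ → ℂ} {s : ℂ} (hf : MellinConvergent f s) :
    AEStronglyMeasurable f (volume.restrict (Ioi 0)) := by
  have h : AEStronglyMeasurable (fun t : ℝ => (t : ℂ) ^ (-(s - 1)) * ((t : ℂ) ^ (s - 1) • f t))
      (volume.restrict (Ioi 0)) :=
    (by fun_prop : Measurable fun t : ℝ => (t : ℂ) ^ (-(s - 1))).aestronglyMeasurable.mul
      (Integrable.aestronglyMeasurable hf)
  refine h.congr ?_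
  filter_upwards [ae_restrict_mem measurableSet_Ioi] with t ht
  have : (t : ℂ) ≠ 0 := by exact_mod_cast (ne_of_gt (mem_Ioi.1 ht))
  rw [smul_eq_mul, ← mul_assoc, ← Complex.cpow_add _ _ this]
  simp

theorem ae_restrict_Ioi_pos : ∀ᵐ t : ℝ ∂(volume.restrict (Ioi 0)), 0 < t :=
  ae_restrict_mem measurableSet_Ioi

/-- The Mellin transform turns the composition with a homogeneous kernel into a product. -/
theorem hasMellin_integral_comp_div {q f : ℝ → ℂ} {p : ℂ} (hqm : Measurable q)
    (hq : MellinConvergent q p) (hf : MellinConvergent f (p + 1)) :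
    HasMellin (fun s : ℝ => ∫ r in Ioi (0 : ℝ), q (s / r) * f r) p
      (mellin q p * mellin f (p + 1)) := by
  have hfm := hf.aestronglyMeasurable
  have hsec : ∀ r : ℝ, 0 < r → HasMellin (fun s => q (s / r)) p ((r : ℂ) ^ p * mellin q p) := by
    intro r hr
    have hr' : 0 < r⁻¹ := inv_pos.2 hr
    refine ⟨?_, ?_⟩
    · simpa only [div_eq_inv_mul] using (MellinConvergent.comp_mul_left hr').2 hq
    · simp only [div_eq_inv_mul]
      rw [mellin_comp_mul_left _ _ hr', Complex.ofReal_inv, Complex.inv_cpow, Complex.cpow_neg,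
        inv_inv, smul_eq_mul]
      rw [Complex.arg_ofReal_of_nonneg hr.le]
      exact Real.pi_pos.ne
  -- The substitution `s → r s` for absolute values. The Jacobian `r` raises the exponent by one,
  -- which is why `f` enters at `p + 1`, and Fubini reduces to a product of two absolutely
  -- convergent Mellin integrals.
  have hnorm : ∀ r : ℝ, 0 < r → ∫ s in Ioi (0 : ℝ), ‖(s : ℂ) ^ (p - 1) * (q (s / r) * f r)‖ =
      ‖(r : ℂ) ^ (p + 1 - 1) • f r‖ * ∫ s in Ioi (0 : ℝ), ‖(s : ℂ) ^ (p - 1) * q s‖ := by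
    intro r hr
    have h1 := integral_comp_mul_right_Ioi (fun s : ℝ => ‖(s : ℂ) ^ (p - 1) * q s‖) 0
      (inv_pos.2 hr)
    rw [zero_mul, inv_inv, smul_eq_mul] at h1
    have h2 : ‖(r : ℂ) ^ (p + 1 - 1) • f r‖ = ‖(r : ℂ) ^ (p - 1)‖ * ‖f r‖ * r := by
      have : (r : ℂ) ≠ 0 := by exact_mod_cast hr.ne'
      rw [show p + 1 - 1 = p - 1 + 1 by ring, Complex.cpow_add _ _ this, Complex.cpow_one,
        norm_smul, norm_mul, Complex.norm_real, Real.norm_eq_abs, abs_of_pos hr]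
      ring
    rw [h2, mul_assoc, ← h1, ← integral_const_mul]
    refine setIntegral_congr_fun measurableSet_Ioi fun s hs => ?_
    have hs' : 0 < s := hs
    have h3 : (s : ℂ) ^ (p - 1) = (r : ℂ) ^ (p - 1) * ((s * r⁻¹ : ℝ) : ℂ) ^ (p - 1) := by
      rw [← Complex.mul_cpow_ofReal_nonneg hr.le (by positivity), ← Complex.ofReal_mul]
      congr 2
      field_simp
    simp only [h3, norm_mul, div_eq_mul_inv]
    ring
  have hint : Integrable (Function.uncurry fun s r : ℝ => (s : ℂ) ^ (p - 1) * (q (s / r) * f r))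
      ((volume.restrict (Ioi (0 : ℝ))).prod (volume.restrict (Ioi (0 : ℝ)))) := by
    have hmeas : AEStronglyMeasurable
        (Function.uncurry fun s r : ℝ => (s : ℂ) ^ (p - 1) * (q (s / r) * f r))
        ((volume.restrict (Ioi (0 : ℝ))).prod (volume.restrict (Ioi (0 : ℝ)))) := by
      refine AEStronglyMeasurable.mul ?_ (AEStronglyMeasurable.mul ?_ ?_)
      · exact (by fun_prop : Measurable fun z : ℝ × ℝ => (z.1 : ℂ) ^ (p - 1)).aestronglyMeasurable
      · exact (hqm.comp (measurable_fst.div measurable_snd)).aestronglyMeasurable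
      · exact hfm.comp_snd
    refine (integrable_prod_iff' hmeas).2 ⟨?_, ?_⟩
    · filter_upwards [ae_restrict_Ioi_pos] with r hr
      have := ((hsec r hr).1.mul_const (f r))
      simpa only [Function.uncurry, smul_eq_mul, mul_assoc] using this
    · refine (hf.norm.mul_const (∫ s in Ioi (0 : ℝ), ‖(s : ℂ) ^ (p - 1) * q s‖)).congr ?_
      filter_upwards [ae_restrict_Ioi_pos] with r hr
      exact (hnorm r hr).symm
  refine ⟨?_, ?_⟩
  · have := hint.integral_prod_left
    simp only [MellinConvergent, smul_eq_mul, ← integral_const_mul]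
    exact this
  · simp only [mellin, smul_eq_mul, ← integral_const_mul]
    rw [integral_integral_swap hint]
    refine setIntegral_congr_fun measurableSet_Ioi fun r hr => ?_
    have := (hsec r hr).2
    simp only [mellin, smul_eq_mul] at this
    simp only [← mul_assoc, integral_mul_const, this]
    rw [add_sub_cancel_right]
    ring

/-- The Mellin-Barnes form of the transform with kernel `w^μ e^{-w}`. -/
theorem integral_gamma_kernel_eq {k : ℝ → ℂ} {θ μ z : ℝ} (hk : MellinConvergent k (θ + 1 : ℝ))
    (hθ : 0 < μ + θ) (hz : 0 < z) :
    IntegrableOn (fun s : ℝ => (((z / s) ^ μ * Real.exp (-(z / s)) : ℝ) : ℂ) * k s) (Ioi 0) ∧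
    2 * Real.pi * ∫ s in Ioi (0 : ℝ), (((z / s) ^ μ * Real.exp (-(z / s)) : ℝ) : ℂ) * k s =
      ∫ y : ℝ, Complex.Gamma (μ + (θ + y * Complex.I)) * (z : ℂ) ^ (-((θ : ℂ) + y * Complex.I)) *
        mellin k (θ + y * Complex.I + 1) := by
  have hG : ∀ y : ℝ, Complex.Gamma (μ + (θ + y * Complex.I)) =
      Complex.Gamma ((μ + θ : ℝ) + y * Complex.I) := fun y => by push_cast; ring_nf
  have hsplit : ∀ s y : ℝ, 0 < s → ((z / s : ℝ) : ℂ) ^ (-((θ : ℂ) + y * Complex.I)) =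
      (z : ℂ) ^ (-((θ : ℂ) + y * Complex.I)) * (s : ℂ) ^ ((θ : ℂ) + y * Complex.I) := by
    intro s y hs
    rw [Complex.ofReal_div, Complex.div_cpow_ofReal_nonneg hz.le hs.le, Complex.cpow_neg (s : ℂ),
      div_inv_eq_mul]
  -- On a vertical line the modulus of the complex power does not depend on `y`, so the absolute
  -- value separates into a function of `y` and a function of `s`.
  have hint : Integrable (Function.uncurry fun (y s : ℝ) =>
      Complex.Gamma ((μ + θ : ℝ) + y * Complex.I) *
        (((z / s : ℝ) : ℂ) ^ (-((θ : ℂ) + y * Complex.I)) * k s))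
      (volume.prod (volume.restrict (Ioi (0 : ℝ)))) := by
    have hb := (integrable_Gamma_vertical hθ).norm.mul_prod (hk.norm.const_mul (z ^ (-θ)))
    refine hb.mono' ?_ ?_
    · refine AEStronglyMeasurable.mul ?_ (AEStronglyMeasurable.mul ?_ ?_)
      · exact ((continuous_Gamma_vertical hθ).comp continuous_fst).aestronglyMeasurable
      · exact (by fun_prop : Measurable fun w : ℝ × ℝ =>
          ((z / w.2 : ℝ) : ℂ) ^ (-((θ : ℂ) + w.1 * Complex.I))).aestronglyMeasurable
      · exact hk.aestronglyMeasurable.comp_snd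
    · have : ∀ᵐ w : ℝ × ℝ ∂(volume.prod (volume.restrict (Ioi (0 : ℝ)))), 0 < w.2 :=
        Measure.quasiMeasurePreserving_snd.ae ae_restrict_Ioi_pos
      filter_upwards [this] with w hw
      rw [Function.uncurry, norm_mul, norm_mul, hsplit _ _ hw, norm_mul, norm_smul,
        Complex.norm_cpow_eq_rpow_re_of_pos hz, Complex.norm_cpow_eq_rpow_re_of_pos hw,
        Complex.norm_cpow_eq_rpow_re_of_pos hw]
      simp [mul_assoc]
  -- Mellin inversion of `Γ` on the line of real part `μ + θ`; the factor `(z/s)^μ` absorbs the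
  -- difference to the line `θ`.
  have hinner : ∀ s : ℝ, 0 < s → ∫ y : ℝ, Complex.Gamma ((μ + θ : ℝ) + y * Complex.I) *
        (((z / s : ℝ) : ℂ) ^ (-((θ : ℂ) + y * Complex.I)) * k s) =
      2 * Real.pi * ((((z / s) ^ μ * Real.exp (-(z / s)) : ℝ) : ℂ) * k s) := by
    intro s hs
    have hzs : 0 < z / s := div_pos hz hs
    have hzs' : ((z / s : ℝ) : ℂ) ≠ 0 := by exact_mod_cast hzs.ne'
    have h := integral_cpow_neg_mul_Gamma hθ hzs
    have hμ : (((z / s) ^ μ * Real.exp (-(z / s)) : ℝ) : ℂ) =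
        ((z / s : ℝ) : ℂ) ^ (μ : ℂ) * Complex.exp (-((z / s : ℝ) : ℂ)) := by
      rw [Complex.ofReal_mul, Complex.ofReal_cpow hzs.le, Complex.ofReal_exp, Complex.ofReal_neg]
    rw [hμ, show 2 * (Real.pi : ℂ) * (((z / s : ℝ) : ℂ) ^ (μ : ℂ) *
      Complex.exp (-((z / s : ℝ) : ℂ)) * k s) = ((z / s : ℝ) : ℂ) ^ (μ : ℂ) * k s *
      (2 * Real.pi * Complex.exp (-((z / s : ℝ) : ℂ))) by ring, ← h, ← integral_const_mul]
    refine integral_congr_ae (Eventually.of_forall fun y => ?_)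
    have : ((z / s : ℝ) : ℂ) ^ (-((θ : ℂ) + y * Complex.I)) = ((z / s : ℝ) : ℂ) ^ (μ : ℂ) *
        ((z / s : ℝ) : ℂ) ^ (-(((μ + θ : ℝ) : ℂ) + y * Complex.I)) := by
      rw [← Complex.cpow_add _ _ hzs']
      congr 1
      push_cast
      ring
    simp only [this]
    ring
  have hpi : (2 * (Real.pi : ℂ)) ≠ 0 := by exact_mod_cast Real.two_pi_pos.ne'
  refine ⟨?_, ?_⟩
  · have := (hint.integral_prod_right).const_mul (2 * (Real.pi : ℂ))⁻¹
    refine this.congr ?_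
    filter_upwards [ae_restrict_Ioi_pos] with s hs
    simp only [Function.uncurry]
    rw [hinner s hs, inv_mul_cancel_left₀ hpi]
  · rw [← integral_const_mul, ← setIntegral_congr_fun measurableSet_Ioi hinner,
      ← integral_integral_swap hint]
    refine integral_congr_ae (Eventually.of_forall fun y => ?_)
    simp only [mellin, ← integral_const_mul, hG]
    refine setIntegral_congr_fun measurableSet_Ioi fun s hs => ?_
    simp only [hsplit s y hs, add_sub_cancel_right, smul_eq_mul]
    ring

theorem HasMellin.congr {f g : ℝ → ℂ} {s m : ℂ} (h : HasMellin f s m)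
    (hfg : ∀ t : ℝ, 0 < t → f t = g t) : HasMellin g s m := by
  have e : EqOn (fun t : ℝ => (t : ℂ) ^ (s - 1) • f t) (fun t : ℝ => (t : ℂ) ^ (s - 1) • g t)
      (Ioi 0) := fun t ht => by simp only [hfg t ht]
  exact ⟨h.1.congr_fun e measurableSet_Ioi,
    (setIntegral_congr_fun measurableSet_Ioi e).symm.trans h.2⟩

theorem hasMellin_cexp_neg {p : ℂ} (hp : 0 < p.re) :
    HasMellin (fun t : ℝ => Complex.exp (-t)) p (Complex.Gamma p) := by
  refine ⟨?_, ?_⟩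
  · have := integrableOn_cpow_mul_cexp_neg_mul_Ioi (s := p) (r := 1) hp (by simp)
    simpa [MellinConvergent] using this
  · rw [Complex.Gamma_eq_integral hp, Complex.GammaIntegral_eq_mellin]
    simp

theorem HasMellin.cpow_mul {f : ℝ → ℂ} {s a m : ℂ} (h : HasMellin f (s + a) m) :
    HasMellin (fun t : ℝ => (t : ℂ) ^ a * f t) s m :=
  ⟨MellinConvergent.cpow_smul.2 h.1, (mellin_cpow_smul f s a).trans h.2⟩

theorem HasMellin.const_mul {f : ℝ → ℂ} {s m : ℂ} (h : HasMellin f s m) (c : ℂ) :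
    HasMellin (fun t : ℝ => c * f t) s (c * m) :=
  ⟨h.1.const_smul c, by rw [← h.2]; exact mellin_const_smul f s c⟩

/-! ### Bessel kernels and their compositions. -/

/-- The integral is the composition of the kernel `e^(-y/v)` with `v^(a-1) e^(-v)`, and each of the
two has a Gamma value as transform. -/
theorem hasMellin_bessel_kernel {a : ℝ} {w : ℂ} (h1 : 0 < w.re) (h2 : 0 < w.re + a) :
    HasMellin (fun y : ℝ => ((∫ v in Ioi (0 : ℝ), v ^ (a - 1) * Real.exp (-(v + y / v)) : ℝ) : ℂ))
      w (Complex.Gamma w * Complex.Gamma (w + a)) := by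
  have hf : HasMellin (fun v : ℝ => (v : ℂ) ^ ((a : ℂ) - 1) * Complex.exp (-v)) (w + 1)
      (Complex.Gamma (w + a)) := by
    refine HasMellin.cpow_mul ?_
    rw [show w + 1 + ((a : ℂ) - 1) = w + a by ring]
    exact hasMellin_cexp_neg (by simpa using h2)
  have hq := hasMellin_cexp_neg h1
  have h := hasMellin_integral_comp_div (q := fun t : ℝ => Complex.exp (-t)) (by fun_prop) hq.1 hf.1
  rw [hq.2, hf.2] at h
  refine h.congr fun y _ => ?_
  rw [← integral_complex_ofReal]
  refine setIntegral_congr_fun measurableSet_Ioi fun v hv => ?_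
  have hv' : (0 : ℝ) ≤ v := (mem_Ioi.1 hv).le
  push_cast [Complex.ofReal_cpow hv']
  rw [neg_add, Complex.exp_add]
  ring

theorem integrableOn_bessel_kernel {a y : ℝ} (ha : 0 < a) (hy : 0 ≤ y) :
    IntegrableOn (fun v : ℝ => v ^ (a - 1) * Real.exp (-(v + y / v))) (Ioi 0) := by
  refine (integrableOn_rpow_mul_exp_neg_mul_Ioi ha one_pos).mono'
    (by fun_prop : Measurable fun v : ℝ =>
      v ^ (a - 1) * Real.exp (-(v + y / v))).aestronglyMeasurable ?_
  filter_upwards [ae_restrict_Ioi_pos] with v hv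
  rw [Real.norm_eq_abs, abs_of_nonneg (by positivity), one_mul]
  gcongr
  have : 0 ≤ y / v := by positivity
  linarith

theorem integral_Ioi_eq_integral_comp_exp (g : ℝ → ℝ) :
    ∫ v in Ioi (0 : ℝ), g v = ∫ u : ℝ, Real.exp u * g (Real.exp u) := by
  have h := integral_image_eq_integral_abs_deriv_smul (s := univ) (f := Real.exp)
    (f' := Real.exp) MeasurableSet.univ (fun x _ => (Real.hasDerivAt_exp x).hasDerivWithinAt)
    Real.exp_injective.injOn g
  simpa [image_univ, Real.range_exp] using h

theorem integrableOn_Ioi_iff_integrable_comp_exp (g : ℝ → ℝ) :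
    IntegrableOn g (Ioi 0) ↔ Integrable fun u : ℝ => Real.exp u * g (Real.exp u) := by
  have h := integrableOn_image_iff_integrableOn_abs_deriv_smul (s := univ) (f := Real.exp)
    (f' := Real.exp) MeasurableSet.univ (fun x _ => (Real.hasDerivAt_exp x).hasDerivWithinAt)
    Real.exp_injective.injOn g
  simpa [image_univ, Real.range_exp] using h

/-- Substitute `v = √y e^u`, so that `v + y/v = 2 √y cosh u`. Folding the line onto the half line
turns `e^(au)` into `2 cosh(au)`. -/
theorem besselK_two_mul_sqrt {a y : ℝ} (ha : 0 < a) (hy : 0 < y) :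
    besselK a (2 * Real.sqrt y) =
      1 / 2 * y ^ (-(a / 2)) * ∫ v in Ioi (0 : ℝ), v ^ (a - 1) * Real.exp (-(v + y / v)) := by
  set c := Real.sqrt y with hc
  have hc0 : 0 < c := Real.sqrt_pos.2 hy
  have hcy : c * c = y := Real.mul_self_sqrt hy.le
  set φ : ℝ → ℝ := fun u => Real.exp (a * u) * Real.exp (-(2 * c * Real.cosh u)) with hφ
  have hpt : ∀ u : ℝ, Real.exp u * (c * ((c * Real.exp u) ^ (a - 1) *
      Real.exp (-(c * Real.exp u + y / (c * Real.exp u))))) = c ^ a * φ u := by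
    intro u
    have e1 : y / (c * Real.exp u) = c * Real.exp (-u) := by
      rw [Real.exp_neg, ← hcy]
      field_simp
    rw [e1, Real.mul_rpow hc0.le (Real.exp_pos u).le, ← Real.exp_mul]
    simp only [hφ, Real.cosh_eq]
    have e2 : Real.exp (a * u) = Real.exp u * Real.exp (u * (a - 1)) := by
      rw [← Real.exp_add]
      ring_nf
    have e3 : c ^ a = c * c ^ (a - 1) := by
      rw [← Real.rpow_one_add' hc0.le (by linarith)]
      ring_nf
    simp only [e2, e3]
    ring_nf
  have hscale : ∫ v in Ioi (0 : ℝ), v ^ (a - 1) * Real.exp (-(v + y / v)) = c ^ a * ∫ u, φ u := by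
    have h := integral_comp_mul_left_Ioi
      (fun v : ℝ => v ^ (a - 1) * Real.exp (-(v + y / v))) 0 hc0
    rw [mul_zero, smul_eq_mul, eq_inv_mul_iff_mul_eq₀ hc0.ne', ← integral_const_mul,
      integral_Ioi_eq_integral_comp_exp] at h
    simp only [hpt] at h
    rw [← h, integral_const_mul]
  have hint : Integrable φ := by
    have h := (integrableOn_Ioi_comp_mul_left_iff
      (fun v : ℝ => v ^ (a - 1) * Real.exp (-(v + y / v))) 0 hc0).2
      (by rw [mul_zero]; exact integrableOn_bessel_kernel ha hy.le)
    have h' := (integrableOn_Ioi_iff_integrable_comp_exp _).1 (h.const_mul c)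
    simp only [hpt] at h'
    have := h'.const_mul (c ^ a)⁻¹
    simpa [← mul_assoc, inv_mul_cancel₀ (Real.rpow_pos_of_pos hc0 a).ne'] using this
  have hsplit : ∫ u, φ u = 2 * besselK a (2 * c) := by
    rw [← intervalIntegral.integral_Iic_add_Ioi (b := 0) hint.integrableOn hint.integrableOn,
      (by simp :
        ∫ u in Iic 0, φ u = ∫ u in Ioi 0, φ (-u)), besselK,
      ← integral_const_mul, ← integral_add]
    · refine setIntegral_congr_fun measurableSet_Ioi fun u _ => ?_
      simp only [hφ, Real.cosh_neg, Real.cosh_eq (a * u), mul_neg]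
      ring
    · exact (hint.comp_neg).integrableOn
    · exact hint.integrableOn
  rw [hscale, hsplit]
  have e : y ^ (-(a / 2)) * c ^ a = 1 := by
    rw [hc, Real.sqrt_eq_rpow, ← Real.rpow_mul hy.le, ← Real.rpow_add hy]
    ring_nf
    simp
  linear_combination (-(besselK a (2 * c))) * e

/-- Dropping `e^(-y/v)` from the integrand leaves Euler's integral for `Γ(a)`. -/
theorem abs_besselK_two_mul_sqrt_le {a y : ℝ} (ha : 0 < a) (hy : 0 < y) :
    |besselK a (2 * Real.sqrt y)| ≤ 1 / 2 * Real.Gamma a * y ^ (-(a / 2)) := by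
  rw [besselK_two_mul_sqrt ha hy]
  have h0 : 0 ≤ ∫ v in Ioi (0 : ℝ), v ^ (a - 1) * Real.exp (-(v + y / v)) :=
    setIntegral_nonneg measurableSet_Ioi fun v hv => by
      have : 0 < v := hv
      positivity
  have h1 : ∫ v in Ioi (0 : ℝ), v ^ (a - 1) * Real.exp (-(v + y / v)) ≤ Real.Gamma a := by
    rw [Real.Gamma_eq_integral ha]
    refine setIntegral_mono_on (integrableOn_bessel_kernel ha hy.le)
      (Real.GammaIntegral_convergent ha) measurableSet_Ioi fun v hv => ?_
    have hv' : 0 < v := hv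
    rw [mul_comm]
    gcongr
    have : 0 ≤ y / v := by positivity
    linarith
  rw [abs_of_nonneg (by positivity), mul_right_comm]
  gcongr

theorem measurable_besselK (a : ℝ) : Measurable (besselK a) := by
  have : StronglyMeasurable (Function.uncurry fun z u : ℝ =>
      Real.exp (-(z * Real.cosh u)) * Real.cosh (a * u)) := by
    apply Continuous.stronglyMeasurable
    unfold Function.uncurry
    fun_prop
  exact (this.integral_prod_right (ν := volume.restrict (Ioi (0 : ℝ)))).measurable

/-- The profile `x ↦ K_{(1-ν)/2}(2 √(x^{1/ν}))` of the kernel `besselQ`. -/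
noncomputable def besselProfile (ν x : ℝ) : ℝ :=
  besselK ((1 - ν) / 2) (2 * Real.sqrt (x ^ (1 / ν)))

theorem measurable_besselProfile (ν : ℝ) : Measurable (besselProfile ν) :=
  (measurable_besselK _).comp (by fun_prop)

/-- The Mellin transform of `besselProfile`. -/
noncomputable def besselMellin (ν : ℝ) (p : ℂ) : ℂ :=
  (ν / 2 : ℝ) * (Complex.Gamma (ν * p - (1 - ν) / 4) * Complex.Gamma (ν * p + (1 - ν) / 4))

/-- With `a = (1-ν)/2`, the prefactor `y^(-a/2)` shifts the argument by `(1-ν)/4` and makes the two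
Gamma factors symmetric; `y = x^(1/ν)` rescales `p` to `νp`. -/
theorem hasMellin_besselProfile {ν : ℝ} (h0 : 0 < ν) (h1 : ν < 1) {p : ℂ}
    (hp : (1 - ν) / 4 < ν * p.re) :
    HasMellin (fun x => (besselProfile ν x : ℂ)) p (besselMellin ν p) := by
  have ha : 0 < (1 - ν) / 2 := by linarith
  have hK : HasMellin (fun y : ℝ => ((besselK ((1 - ν) / 2) (2 * Real.sqrt y) : ℝ) : ℂ))
      (ν * p) (1 / 2 * (Complex.Gamma (ν * p - (1 - ν) / 4) *
        Complex.Gamma (ν * p + (1 - ν) / 4))) := by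
    have h := hasMellin_bessel_kernel (a := (1 - ν) / 2) (w := ν * p + ((-((1 - ν) / 4) : ℝ) : ℂ))
      (by simp; linarith) (by simp; linarith)
    have h' := ((h.cpow_mul).const_mul (1 / 2)).congr
      (g := fun y : ℝ => ((besselK ((1 - ν) / 2) (2 * Real.sqrt y) : ℝ) : ℂ)) (fun y hy => by
        rw [besselK_two_mul_sqrt ha hy]
        rw [Complex.ofReal_mul, Complex.ofReal_mul, Complex.ofReal_cpow hy.le,
          show -((1 - ν) / 2 / 2) = -((1 - ν) / 4) by ring, ← mul_assoc]
        norm_num)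
    convert h' using 3
    · push_cast
      ring_nf
    · push_cast
      ring_nf
  have hν : (1 / ν) ≠ 0 := (one_div_pos.2 h0).ne'
  have e : p / ((1 / ν : ℝ) : ℂ) = ν * p := by
    push_cast
    rw [div_div_eq_mul_div, div_one, mul_comm]
  refine ⟨(MellinConvergent.comp_rpow hν).2 (by rw [e]; exact hK.1), ?_⟩
  refine (mellin_comp_rpow (fun y : ℝ => ((besselK ((1 - ν) / 2) (2 * Real.sqrt y) : ℝ) : ℂ)) p
    (1 / ν)).trans ?_
  rw [e, hK.2, abs_of_pos (one_div_pos.2 h0), besselMellin, Complex.real_smul]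
  push_cast
  rw [one_div, inv_inv]
  ring

/-- Each further composition contributes the transform of the profile at `p` and evaluates the
remaining ones at `p + 1`; the shifts accumulate to `p + k`. -/
theorem hasMellin_besselQIter {ν T : ℝ} (h0 : 0 < ν) (h1 : ν < 1) (hT : 0 < T) (m : ℕ) {p : ℂ}
    (hp : (1 - ν) / 4 < ν * p.re) :
    HasMellin (fun s => (besselQIter ν (m + 1) s T : ℂ)) p
      ((∏ k ∈ Finset.range (m + 1), besselMellin ν (p + k)) * (T : ℂ) ^ (p + m)) := by
  induction m generalizing p with
  | zero =>
    have h := hasMellin_besselProfile h0 h1 hp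
    have hT' : 0 < T⁻¹ := inv_pos.2 hT
    have e : (fun s => (besselQIter ν (0 + 1) s T : ℂ)) =
        fun s => (fun x => (besselProfile ν x : ℂ)) (T⁻¹ * s) := by
      funext s
      simp only [besselQIter, besselQ, besselProfile, div_eq_inv_mul]
    rw [e]
    refine ⟨(MellinConvergent.comp_mul_left hT').2 h.1, ?_⟩
    rw [mellin_comp_mul_left (fun x => (besselProfile ν x : ℂ)) _ hT', h.2, Complex.ofReal_inv, Complex.inv_cpow, Complex.cpow_neg,
      inv_inv, smul_eq_mul]
    · simp [mul_comm]
    · rw [Complex.arg_ofReal_of_nonneg hT.le]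
      exact Real.pi_pos.ne
  | succ m ih =>
    have h2 := ih (p := p + 1) (by simp; nlinarith)
    have h3 := hasMellin_besselProfile h0 h1 hp
    have h := hasMellin_integral_comp_div (q := fun x => (besselProfile ν x : ℂ))
      (Complex.measurable_ofReal.comp (measurable_besselProfile ν)) h3.1 h2.1
    rw [h2.2, h3.2] at h
    convert h using 1
    · funext s
      simp only [besselQIter]
      rw [← integral_complex_ofReal]
      refine integral_congr_ae (Eventually.of_forall fun r => ?_)
      simp [besselQ, besselProfile]
    · rw [Finset.prod_range_succ' _ (m + 1)]
      push_cast
      simp only [add_zero, add_assoc, add_comm (1 : ℂ)]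
      ring

theorem integrableOn_besselQ_mul_besselQIter {ν T s : ℝ} (h0 : 0 < ν) (h1 : ν < 1) (hT : 0 < T)
    (hs : 0 < s) (m : ℕ) :
    IntegrableOn (fun r : ℝ => besselQ ν s r * besselQIter ν (m + 1) r T) (Ioi (0 : ℝ)) := by
  have ha : 0 < (1 - ν) / 2 := by linarith
  -- The bound on `K` makes `besselQ ν s r` at most a constant times `r^((1-ν)/(4ν))`. This exponent
  -- is `p - 1`, so the transform at this `p` converges with exactly the required weight.
  have h := hasMellin_besselQIter h0 h1 hT m (p := ((1 - ν) / (4 * ν) + 1 : ℝ)) (by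
    rw [Complex.ofReal_re]
    have : ν * ((1 - ν) / (4 * ν) + 1) = (1 - ν) / 4 + ν := by field_simp
    linarith)
  refine (h.1.norm.const_mul (1 / 2 * Real.Gamma ((1 - ν) / 2) *
    s ^ (-((1 - ν) / (4 * ν))))).mono' ?_ ?_
  · refine AEStronglyMeasurable.mul ?_ ?_
    · exact ((measurable_besselProfile ν).comp
        (measurable_const.div measurable_id)).aestronglyMeasurable
    · simpa using h.1.aestronglyMeasurable.re
  · filter_upwards [ae_restrict_Ioi_pos] with r hr
    rw [norm_mul, norm_smul, Complex.norm_real, ← mul_assoc,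
      Complex.norm_cpow_eq_rpow_re_of_pos hr]
    gcongr
    have hsr : 0 < (s / r) ^ (1 / ν) := by positivity
    refine (abs_besselK_two_mul_sqrt_le ha hsr).trans (le_of_eq ?_)
    rw [← Real.rpow_mul (by positivity), Real.div_rpow hs.le hr.le, mul_assoc]
    have e1 : 1 / ν * -((1 - ν) / 2 / 2) = -((1 - ν) / (4 * ν)) := by
      field_simp
      ring
    have e2 : (((1 - ν) / (4 * ν) + 1 : ℝ) - 1 : ℂ).re = (1 - ν) / (4 * ν) := by
      rw [← Complex.ofReal_one, ← Complex.ofReal_sub, Complex.ofReal_re]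
      ring
    rw [e1, e2, Real.rpow_neg hr.le, div_inv_eq_mul]
    ring

/-! ### Contour representation of the stable and inverse stable densities. -/

/-- The integrand `exp(-(A r + B r^ν))` of the contour representations of stable densities. -/
noncomputable def stablePhase (ν : ℝ) (A B : ℂ) (r : ℝ) : ℂ :=
  Complex.exp (-(A * r + B * ((r ^ ν : ℝ) : ℂ)))

theorem norm_stablePhase (ν : ℝ) (A B : ℂ) (r : ℝ) :
    ‖stablePhase ν A B r‖ = Real.exp (-(A.re * r + B.re * r ^ ν)) := by
  rw [stablePhase, Complex.norm_exp]
  simp only [Complex.neg_re, Complex.add_re, Complex.re_mul_ofReal]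

theorem norm_stablePhase_le {ν c : ℝ} {A B : ℂ} {r : ℝ} (hr : 0 < r) (hA : 0 ≤ A.re)
    (hB : c ≤ B.re) : ‖stablePhase ν A B r‖ ≤ Real.exp (-c * r ^ ν) := by
  rw [norm_stablePhase]
  apply Real.exp_le_exp.2
  have h1 : 0 ≤ A.re * r := by positivity
  have h2 : c * r ^ ν ≤ B.re * r ^ ν := by gcongr
  linarith

@[fun_prop]
theorem measurable_stablePhase (ν : ℝ) (A B : ℂ) : Measurable (stablePhase ν A B) := by
  unfold stablePhase
  fun_prop

theorem integrableOn_rpow_mul_stablePhase {ν s : ℝ} {A B : ℂ} (hν : 0 < ν) (hs : -1 < s)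
    (hA : 0 ≤ A.re) (hB : 0 < B.re) :
    IntegrableOn (fun r : ℝ => ((r ^ s : ℝ) : ℂ) * stablePhase ν A B r) (Ioi 0) := by
  refine (integrableOn_rpow_mul_exp_neg_mul_rpow hs hν hB).mono'
    (by fun_prop : Measurable fun r : ℝ =>
      ((r ^ s : ℝ) : ℂ) * stablePhase ν A B r).aestronglyMeasurable ?_
  filter_upwards [ae_restrict_Ioi_pos] with r hr
  rw [norm_mul, Complex.norm_real, Real.norm_eq_abs, abs_of_nonneg (by positivity)]
  gcongr
  exact norm_stablePhase_le hr hA le_rfl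

theorem integrableOn_stablePhase {ν : ℝ} {A B : ℂ} (hν : 0 < ν) (hA : 0 ≤ A.re) (hB : 0 < B.re) :
    IntegrableOn (stablePhase ν A B) (Ioi 0) := by
  simpa using integrableOn_rpow_mul_stablePhase (s := 0) hν (by norm_num) hA hB

theorem hasDerivAt_mul_stablePhase {ν : ℝ} (A B : ℂ) {r : ℝ} (hr : 0 < r) :
    HasDerivAt (fun r : ℝ => (r : ℂ) * stablePhase ν A B r)
      (stablePhase ν A B r * (1 - A * r - ν * B * ((r ^ ν : ℝ) : ℂ))) r := by
  have h1 : HasDerivAt (fun r : ℝ => (r : ℂ)) 1 r := Complex.ofRealCLM.hasDerivAt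
  have h2 : HasDerivAt (fun r : ℝ => ((r ^ ν : ℝ) : ℂ)) ((ν * r ^ (ν - 1) : ℝ) : ℂ) r :=
    (Real.hasDerivAt_rpow_const (Or.inl hr.ne')).ofReal_comp
  have h3 := h1.mul ((((h1.const_mul A).add (h2.const_mul B)).neg).cexp)
  refine h3.congr_deriv ?_
  have e : r ^ ν = r * r ^ (ν - 1) := by
    rw [Real.rpow_sub_one hr.ne']
    field_simp
  rw [e]
  simp only [stablePhase, Pi.add_apply, Pi.neg_apply]
  rw [e]
  push_cast
  ring

/-- The integrand is the derivative of `r e^(-(A r + B r^ν))`, which vanishes at both ends. This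
plays the part of Cauchy's theorem when the contour is rotated. -/
theorem integral_stablePhase_mul_eq_zero {ν : ℝ} {A B : ℂ} (hν : 0 < ν) (hA : 0 ≤ A.re)
    (hB : 0 < B.re) :
    ∫ r in Ioi (0 : ℝ), stablePhase ν A B r * (1 - A * r - ν * B * ((r ^ ν : ℝ) : ℂ)) = 0 := by
  have i0 := integrableOn_stablePhase hν hA hB
  have i1 := integrableOn_rpow_mul_stablePhase (s := 1) hν (by norm_num) hA hB
  have i2 := integrableOn_rpow_mul_stablePhase (s := ν) hν (by linarith) hA hB
  simp only [Real.rpow_one] at i1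
  have hint : IntegrableOn (fun r : ℝ =>
      stablePhase ν A B r * (1 - A * r - ν * B * ((r ^ ν : ℝ) : ℂ))) (Ioi 0) := by
    refine ((i0.sub (i1.const_mul A)).sub (i2.const_mul (ν * B))).congr_fun (fun r _ => ?_)
      measurableSet_Ioi
    simp only [Pi.sub_apply]
    ring
  have h := integral_Ioi_of_hasDerivAt_of_tendsto (a := 0) ?_
    (fun r hr => hasDerivAt_mul_stablePhase (ν := ν) A B hr) hint
    (tendsto_zero_of_hasDerivAt_of_integrableOn_Ioi
      (fun r hr => hasDerivAt_mul_stablePhase (ν := ν) A B hr) hint i1)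
  · simpa using h
  · refine ContinuousAt.continuousWithinAt ?_
    have : ContinuousAt (fun r : ℝ => r ^ ν) 0 :=
      Real.continuousAt_rpow_const 0 ν (Or.inr hν.le)
    unfold stablePhase
    fun_prop

/-- The direction `e^{iβ}` of the rotated contour. -/
noncomputable def rayDir (β : ℝ) : ℂ := Complex.exp (β * Complex.I)

/-- The value `e^{-iν(π-β)}` of the stable exponent on the rotated contour. -/
noncomputable def rayExp (ν β : ℝ) : ℂ := Complex.exp ((-(ν * (Real.pi - β)) : ℝ) * Complex.I)

theorem rayDir_re (β : ℝ) : (rayDir β).re = Real.cos β := Complex.exp_ofReal_mul_I_re β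

theorem rayExp_re (ν β : ℝ) : (rayExp ν β).re = Real.cos (ν * (Real.pi - β)) := by
  rw [rayExp, Complex.exp_ofReal_mul_I_re, Real.cos_neg]

theorem norm_rayDir (β : ℝ) : ‖rayDir β‖ = 1 := Complex.norm_exp_ofReal_mul_I β

theorem norm_rayExp (ν β : ℝ) : ‖rayExp ν β‖ = 1 := Complex.norm_exp_ofReal_mul_I _

theorem hasDerivAt_rayDir (β : ℝ) : HasDerivAt rayDir (rayDir β * Complex.I) β := by
  have h := (((hasDerivAt_id β).ofReal_comp).mul_const Complex.I).cexp
  refine (h.congr_deriv ?_ : HasDerivAt (fun β : ℝ => Complex.exp (β * Complex.I)) _ β)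
  simp [rayDir]

theorem hasDerivAt_rayExp (ν β : ℝ) :
    HasDerivAt (rayExp ν) (rayExp ν β * (ν * Complex.I)) β := by
  have h := ((((((hasDerivAt_id β).const_sub Real.pi).const_mul ν).neg).ofReal_comp).mul_const
    Complex.I).cexp
  refine (h.congr_deriv ?_ : HasDerivAt
    (fun β : ℝ => Complex.exp ((-(ν * (Real.pi - β)) : ℝ) * Complex.I)) _ β)
  simp [rayExp]

theorem continuous_rayDir : Continuous rayDir :=
  continuous_iff_continuousAt.2 fun β => (hasDerivAt_rayDir β).continuousAt

theorem continuous_rayExp (ν : ℝ) : Continuous (rayExp ν) :=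
  continuous_iff_continuousAt.2 fun β => (hasDerivAt_rayExp ν β).continuousAt

/-- The contour integral along the ray of direction `e^{iβ}`. -/
noncomputable def rayIntegral (ν x t β : ℝ) : ℂ :=
  ∫ r in Ioi (0 : ℝ), rayDir β * stablePhase ν (x * rayDir β) (t * rayExp ν β) r

section Rotation

variable {ν x t β₀ : ℝ}

theorem cos_le_rayExp_re (hν : 0 < ν) (h0 : ν * (Real.pi - β₀) < Real.pi / 2) {β : ℝ}
    (hβ : β ∈ Icc β₀ (Real.pi / 2)) : Real.cos (ν * (Real.pi - β₀)) ≤ (rayExp ν β).re := by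
  rw [rayExp_re]
  have := Real.pi_pos
  apply Real.cos_le_cos_of_nonneg_of_le_pi
  · have : 0 ≤ Real.pi - β := by linarith [hβ.2]
    positivity
  · linarith
  · gcongr
    exact hβ.1

/-- Differentiating in the angle gives `i e^(iβ)` times a total `r`-derivative, whose integral is
zero. The dominating function uses only `e^(-t c r^ν)`, because `cos β` has no positive lower bound
as `β` approaches `π/2`. -/
theorem hasDerivAt_rayIntegral (hν : 0 < ν) (hx : 0 < x) (ht : 0 < t) (hβ0 : 0 ≤ β₀)
    (h0 : ν * (Real.pi - β₀) < Real.pi / 2) (h1 : β₀ ≤ Real.pi / 2) {β : ℝ}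
    (hβ : β ∈ Ioo β₀ (Real.pi / 2)) : HasDerivAt (rayIntegral ν x t) 0 β := by
  have hpi := Real.pi_pos
  set c := Real.cos (ν * (Real.pi - β₀)) with hc
  have hc0 : 0 < c := by
    apply Real.cos_pos_of_mem_Ioo
    have : 0 ≤ ν * (Real.pi - β₀) := by
      have : 0 ≤ Real.pi - β₀ := by linarith
      positivity
    constructor <;> linarith
  have htc : 0 < t * c := by positivity
  have hA : ∀ β ∈ Ioo β₀ (Real.pi / 2), 0 ≤ ((x : ℂ) * rayDir β).re := by
    intro β hβ
    rw [Complex.re_ofReal_mul, rayDir_re]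
    have : 0 ≤ Real.cos β := Real.cos_nonneg_of_mem_Icc ⟨by linarith [hβ.1], hβ.2.le⟩
    positivity
  have hB : ∀ β ∈ Ioo β₀ (Real.pi / 2), t * c ≤ ((t : ℂ) * rayExp ν β).re := by
    intro β hβ
    rw [Complex.re_ofReal_mul]
    exact mul_le_mul_of_nonneg_left (cos_le_rayExp_re hν h0 ⟨hβ.1.le, hβ.2.le⟩) ht.le
  have hbi : IntegrableOn (fun r : ℝ => Real.exp (-(t * c) * r ^ ν) *
      (1 + x * r + ν * t * r ^ ν)) (Ioi 0) := by
    have i0 := integrableOn_rpow_mul_exp_neg_mul_rpow (s := 0) (by norm_num) hν htc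
    have i1 := integrableOn_rpow_mul_exp_neg_mul_rpow (s := 1) (by norm_num) hν htc
    have i2 := integrableOn_rpow_mul_exp_neg_mul_rpow (s := ν) (by linarith) hν htc
    refine ((i0.add (i1.const_mul x)).add (i2.const_mul (ν * t))).congr_fun (fun r _ => ?_)
      measurableSet_Ioi
    simp only [Pi.add_apply, Real.rpow_zero, Real.rpow_one]
    ring
  have h := (hasDerivAt_integral_of_dominated_loc_of_deriv_le
    (μ := volume.restrict (Ioi (0 : ℝ)))
    (F := fun β r => rayDir β * stablePhase ν (x * rayDir β) (t * rayExp ν β) r)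
    (F' := fun β r => (rayDir β * Complex.I) * (stablePhase ν (x * rayDir β) (t * rayExp ν β) r *
      (1 - x * rayDir β * r - ν * (t * rayExp ν β) * ((r ^ ν : ℝ) : ℂ))))
    (x₀ := β) (Ioo_mem_nhds hβ.1 hβ.2) ?_ ?_ ?_ ?_ hbi ?_).2
  · refine h.congr_deriv ?_
    rw [integral_const_mul, integral_stablePhase_mul_eq_zero hν (hA β hβ)
      (htc.trans_le (hB β hβ)), mul_zero]
  · exact Eventually.of_forall fun β => (by fun_prop : Measurable fun r : ℝ =>
      rayDir β * stablePhase ν (x * rayDir β) (t * rayExp ν β) r).aestronglyMeasurable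
  · exact (integrableOn_stablePhase hν (hA β hβ) (htc.trans_le (hB β hβ))).const_mul _
  · exact (by fun_prop : Measurable fun r : ℝ => (rayDir β * Complex.I) *
      (stablePhase ν (x * rayDir β) (t * rayExp ν β) r * (1 - x * rayDir β * r -
        ν * (t * rayExp ν β) * ((r ^ ν : ℝ) : ℂ)))).aestronglyMeasurable
  · filter_upwards [ae_restrict_Ioi_pos] with r hr β hβ
    rw [norm_mul, norm_mul, norm_mul, norm_rayDir, Complex.norm_I, one_mul, one_mul]
    gcongr
    · exact norm_stablePhase_le hr (hA β hβ) (hB β hβ)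
    · refine (norm_sub_le _ _).trans (add_le_add ((norm_sub_le _ _).trans (le_of_eq ?_))
        (le_of_eq ?_))
      · simp [norm_rayDir, abs_of_pos hx, abs_of_pos hr]
      · simp only [norm_mul, Complex.norm_real, norm_rayExp, Real.norm_eq_abs, abs_of_pos hν,
          abs_of_pos ht, abs_of_pos (Real.rpow_pos_of_pos hr ν), mul_one]
  · refine Eventually.of_forall fun r β _ => ?_
    have h1 := hasDerivAt_rayDir β
    have h2 := hasDerivAt_rayExp ν β
    have h3 := h1.mul (((((h1.const_mul (x : ℂ)).mul_const (r : ℂ)).add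
      ((h2.const_mul (t : ℂ)).mul_const ((r ^ ν : ℝ) : ℂ))).neg).cexp)
    refine h3.congr_deriv ?_
    simp only [stablePhase, Pi.add_apply, Pi.neg_apply]
    ring

theorem continuousWithinAt_rayIntegral (hν : 0 < ν) (hx : 0 < x) (ht : 0 < t) (hβ0 : 0 ≤ β₀)
    (h0 : ν * (Real.pi - β₀) < Real.pi / 2) (h1 : β₀ < Real.pi / 2) :
    ContinuousWithinAt (rayIntegral ν x t) (Ioo β₀ (Real.pi / 2)) (Real.pi / 2) := by
  have hpi := Real.pi_pos
  set c := Real.cos (ν * (Real.pi - β₀)) with hc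
  have hc0 : 0 < c := by
    apply Real.cos_pos_of_mem_Ioo
    have : 0 ≤ ν * (Real.pi - β₀) := by
      have : 0 ≤ Real.pi - β₀ := by linarith
      positivity
    constructor <;> linarith
  have htc : 0 < t * c := by positivity
  refine continuousWithinAt_of_dominated (bound := fun r => r ^ (0 : ℝ) *
    Real.exp (-(t * c) * r ^ ν)) ?_ ?_
    (integrableOn_rpow_mul_exp_neg_mul_rpow (by norm_num) hν htc) ?_
  · exact Eventually.of_forall fun β => (by fun_prop : Measurable fun r : ℝ =>
      rayDir β * stablePhase ν (x * rayDir β) (t * rayExp ν β) r).aestronglyMeasurable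
  · filter_upwards [self_mem_nhdsWithin] with β hβ
    filter_upwards [ae_restrict_Ioi_pos] with r hr
    rw [norm_mul, norm_rayDir, one_mul, Real.rpow_zero, one_mul]
    refine norm_stablePhase_le hr ?_ ?_
    · rw [Complex.re_ofReal_mul, rayDir_re]
      have : 0 ≤ Real.cos β := Real.cos_nonneg_of_mem_Icc ⟨by linarith [hβ.1], hβ.2.le⟩
      positivity
    · rw [Complex.re_ofReal_mul]
      exact mul_le_mul_of_nonneg_left (cos_le_rayExp_re hν h0 ⟨hβ.1.le, hβ.2.le⟩) ht.le
  · refine Eventually.of_forall fun r => Continuous.continuousWithinAt ?_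
    have := continuous_rayDir
    have := continuous_rayExp ν
    unfold stablePhase
    fun_prop

/-- The contour may be rotated from the imaginary axis into the right half plane. -/
theorem rayIntegral_eq (hν : 0 < ν) (hx : 0 < x) (ht : 0 < t) (hβ0 : 0 ≤ β₀)
    (h0 : ν * (Real.pi - β₀) < Real.pi / 2) {β : ℝ} (hβ : β ∈ Ioo β₀ (Real.pi / 2)) :
    rayIntegral ν x t (Real.pi / 2) = rayIntegral ν x t β := by
  have h1 : β₀ < Real.pi / 2 := hβ.1.trans hβ.2
  have hd := fun y hy => hasDerivAt_rayIntegral (x := x) (t := t) hν hx ht hβ0 h0 h1.le (β := y) hy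
  have hconst : ∀ y ∈ Ioo β₀ (Real.pi / 2), rayIntegral ν x t y = rayIntegral ν x t β := by
    intro y hy
    refine isOpen_Ioo.is_const_of_deriv_eq_zero isPreconnected_Ioo
      (fun z hz => (hd z hz).differentiableAt.differentiableWithinAt)
      (fun z hz => (hd z hz).deriv) hy hβ
  have hc := continuousWithinAt_rayIntegral (x := x) (t := t) hν hx ht hβ0 h0 h1
  have hne : (𝓝[Ioo β₀ (Real.pi / 2)] (Real.pi / 2)).NeBot :=
    right_nhdsWithin_Ioo_neBot h1
  refine tendsto_nhds_unique hc.tendsto (tendsto_const_nhds.congr' ?_)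
  filter_upwards [self_mem_nhdsWithin] with y hy
  exact (hconst y hy).symm

end Rotation

theorem integrableOn_Iic_of_comp_neg {f : ℝ → ℂ}
    (h : IntegrableOn (fun x => f (-x)) (Ioi 0)) : IntegrableOn f (Iic 0) := by
  rw [integrableOn_Iic_iff_integrableOn_Iio]
  have h' : IntegrableOn (fun x => f (-x)) (Ioi (-0)) := by rwa [neg_zero]
  simpa only [neg_neg] using h'.comp_neg_Iio

theorem integral_eq_conj_add_of_comp_neg {f g : ℝ → ℂ} (hg : IntegrableOn g (Ioi 0))
    (hpos : ∀ ξ : ℝ, 0 < ξ → f ξ = g ξ) (hneg : ∀ ξ : ℝ, 0 < ξ → f (-ξ) = (starRingEnd ℂ) (g ξ)) :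
    ∫ ξ, f ξ = (starRingEnd ℂ) (∫ ξ in Ioi (0 : ℝ), g ξ) + ∫ ξ in Ioi (0 : ℝ), g ξ := by
  have hfi : IntegrableOn f (Ioi 0) := hg.congr_fun (fun ξ hξ => (hpos ξ hξ).symm)
    measurableSet_Ioi
  have hfni : IntegrableOn (fun ξ => f (-ξ)) (Ioi 0) := by
    have : IntegrableOn (fun ξ => (starRingEnd ℂ) (g ξ)) (Ioi 0) :=
      Integrable.mono hg (Complex.continuous_conj.comp_aestronglyMeasurable
        hg.aestronglyMeasurable) (Eventually.of_forall fun ξ => (RCLike.norm_conj _).le)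
    exact this.congr_fun (fun ξ hξ => (hneg ξ hξ).symm) measurableSet_Ioi
  have hfn : IntegrableOn f (Iic 0) := by
    exact integrableOn_Iic_of_comp_neg hfni
  rw [← intervalIntegral.integral_Iic_add_Ioi (b := 0) hfn hfi,
    setIntegral_congr_fun measurableSet_Ioi hpos]
  congr 1
  rw [← integral_conj, ← setIntegral_congr_fun measurableSet_Ioi hneg,
    integral_comp_neg_Ioi, neg_zero]

/-- The Fourier integrand at `-ξ` is the conjugate of that at `ξ`, so the integral is twice the real
part of its half. That half is the ray of angle `π/2`, whose direction `i` turns the real part into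
an imaginary part. -/
theorem stableDensity_eq_rayIntegral_pi_div_two {ν x t : ℝ} (hν : 0 < ν) (hν1 : ν < 1)
    (ht : 0 < t) :
    stableDensity ν x t = 1 / Real.pi * (rayIntegral ν x t (Real.pi / 2)).im := by
  have hpi := Real.pi_pos
  set f : ℝ → ℂ := fun ξ => Complex.exp (-(Complex.I * (ξ : ℂ) * (x : ℂ))) *
      Complex.exp (-((t : ℂ) * stableExponent ν ξ)) with hf
  have hdir : rayDir (Real.pi / 2) = Complex.I := by
    rw [rayDir]
    push_cast
    exact Complex.exp_pi_div_two_mul_I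
  have hre : 0 < ((t : ℂ) * rayExp ν (Real.pi / 2)).re := by
    rw [Complex.re_ofReal_mul, rayExp_re]
    have : 0 < Real.cos (ν * (Real.pi - Real.pi / 2)) := by
      apply Real.cos_pos_of_mem_Ioo
      constructor <;> nlinarith
    positivity
  set g : ℝ → ℂ := stablePhase ν (x * Complex.I) (t * rayExp ν (Real.pi / 2)) with hg
  have hgi : IntegrableOn g (Ioi 0) := integrableOn_stablePhase hν (by simp) hre
  have hpos : ∀ ξ : ℝ, 0 < ξ → f ξ = g ξ := by
    intro ξ hξ
    simp only [hf, hg, stablePhase, stableExponent, rayExp, Real.sign_of_pos hξ, abs_of_pos hξ]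
    rw [← Complex.exp_add]
    congr 1
    push_cast
    ring_nf
  have hneg : ∀ ξ : ℝ, 0 < ξ → f (-ξ) = (starRingEnd ℂ) (g ξ) := by
    intro ξ hξ
    simp only [hf, hg, stablePhase, stableExponent, rayExp,
      Real.sign_of_neg (neg_neg_of_pos hξ), abs_neg, abs_of_pos hξ]
    rw [← Complex.exp_add, ← Complex.exp_conj]
    congr 1
    simp only [map_neg, map_add, map_mul, Complex.conj_ofReal, Complex.conj_I, ← Complex.exp_conj]
    push_cast
    ring_nf
  have hsum := integral_eq_conj_add_of_comp_neg hgi hpos hneg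
  rw [stableDensity, hsum, rayIntegral, hdir, integral_const_mul]
  simp only [Complex.add_re, Complex.conj_re, Complex.I_mul_im]
  field_simp
  ring

/-- The angle of the contour used for the stable density of index `ν`. -/
noncomputable def stableAngle (ν : ℝ) : ℝ := (1 + ν) * Real.pi / 4

section Contour

variable {ν : ℝ}

/-- The angle is the midpoint of this interval, whose left end serves as `β₀` in the rotation. -/
theorem stableAngle_mem (h1 : ν < 1) :
    stableAngle ν ∈ Ioo (ν * Real.pi / 2) (Real.pi / 2) := by
  have := Real.pi_pos
  rw [stableAngle]
  constructor <;> nlinarith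

/-- Equivalent to `(1-ν)^2 > 0`. -/
theorem stableAngle_base (h1 : ν < 1) :
    ν * (Real.pi - ν * Real.pi / 2) < Real.pi / 2 := by
  have := Real.pi_pos
  have : 0 < Real.pi * (1 - ν) ^ 2 := by
    have : 0 < 1 - ν := by linarith
    positivity
  nlinarith

theorem rayDir_stableAngle_re_pos (h0 : 0 < ν) (h1 : ν < 1) : 0 < (rayDir (stableAngle ν)).re := by
  rw [rayDir_re]
  have hm := stableAngle_mem h1
  have := Real.pi_pos
  have : 0 < ν * Real.pi / 2 := by positivity
  apply Real.cos_pos_of_mem_Ioo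
  constructor <;> linarith [hm.1, hm.2]

theorem rayExp_stableAngle_re_pos (h0 : 0 < ν) (h1 : ν < 1) :
    0 < (rayExp ν (stableAngle ν)).re := by
  have hm := stableAngle_mem h1
  have hpi := Real.pi_pos
  refine lt_of_lt_of_le ?_ (cos_le_rayExp_re h0 (stableAngle_base h1) ⟨hm.1.le, hm.2.le⟩)
  apply Real.cos_pos_of_mem_Ioo
  have h2 := stableAngle_base h1
  have : 0 ≤ ν * (Real.pi - ν * Real.pi / 2) := by
    have : 0 ≤ Real.pi - ν * Real.pi / 2 := by nlinarith
    positivity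
  constructor <;> linarith

theorem ofReal_mul_re_pos {x : ℝ} {a : ℂ} (hx : 0 < x) (ha : 0 < a.re) : 0 < ((x : ℂ) * a).re := by
  rw [Complex.re_ofReal_mul]
  positivity

theorem stableDensity_eq (h0 : 0 < ν) (h1 : ν < 1) {x t : ℝ} (hx : 0 < x) (ht : 0 < t) :
    stableDensity ν x t = 1 / Real.pi * (rayDir (stableAngle ν) * ∫ r in Ioi (0 : ℝ),
      stablePhase ν (x * rayDir (stableAngle ν)) (t * rayExp ν (stableAngle ν)) r).im := by
  rw [stableDensity_eq_rayIntegral_pi_div_two h0 h1 ht,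
    rayIntegral_eq h0 hx ht (by have := Real.pi_pos; positivity) (stableAngle_base h1)
      (stableAngle_mem h1), rayIntegral, integral_const_mul]

theorem hasDerivAt_integral_stablePhase (h0 : 0 < ν) {A b : ℂ} (hA : 0 ≤ A.re) (hb : 0 < b.re)
    {s : ℝ} (hs : 0 < s) :
    HasDerivAt (fun y : ℝ => ∫ r in Ioi (0 : ℝ), stablePhase ν A (y * b) r)
      (-(b * ∫ r in Ioi (0 : ℝ), ((r ^ ν : ℝ) : ℂ) * stablePhase ν A (s * b) r)) s := by
  have hs2 : 0 < s / 2 := by positivity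
  have h := (hasDerivAt_integral_of_dominated_loc_of_deriv_le
    (μ := volume.restrict (Ioi (0 : ℝ)))
    (F := fun (y : ℝ) r => stablePhase ν A (y * b) r)
    (F' := fun (y : ℝ) r => -(b * (((r ^ ν : ℝ) : ℂ) * stablePhase ν A (y * b) r)))
    (x₀ := s) (s := Ioi (s / 2))
    (bound := fun r => ‖b‖ * (r ^ ν * Real.exp (-(s / 2 * b.re) * r ^ ν)))
    (Ioi_mem_nhds (by linarith)) ?_ ?_ ?_ ?_
    ((integrableOn_rpow_mul_exp_neg_mul_rpow (by linarith) h0 (by positivity)).const_mul _) ?_).2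
  · refine h.congr_deriv ?_
    rw [integral_neg, integral_const_mul]
  · exact Eventually.of_forall fun y => (measurable_stablePhase _ _ _).aestronglyMeasurable
  · exact integrableOn_stablePhase h0 hA (ofReal_mul_re_pos hs hb)
  · exact (by fun_prop : Measurable fun r : ℝ =>
      -(b * (((r ^ ν : ℝ) : ℂ) * stablePhase ν A (s * b) r))).aestronglyMeasurable
  · filter_upwards [ae_restrict_Ioi_pos] with r hr y hy
    rw [norm_neg, norm_mul, norm_mul, Complex.norm_real, Real.norm_eq_abs,
      abs_of_nonneg (by positivity)]
    gcongr
    refine norm_stablePhase_le hr hA ?_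
    rw [Complex.re_ofReal_mul]
    have : s / 2 < y := hy
    gcongr
  · refine Eventually.of_forall fun r y _ => ?_
    have h1 : HasDerivAt (fun r : ℝ => (r : ℂ)) 1 y := Complex.ofRealCLM.hasDerivAt
    have h3 := (((((h1.mul_const b).mul_const ((r ^ ν : ℝ) : ℂ)).const_add (A * r)).neg).cexp)
    refine h3.congr_deriv ?_
    simp only [stablePhase, Pi.neg_apply]
    ring

/-- The Laplace type representation of the density of the inverse stable process. -/
theorem invStableDensity_eq (h0 : 0 < ν) (h1 : ν < 1) {s t : ℝ} (hs : 0 < s) (ht : 0 < t) :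
    invStableDensity ν s t = -(1 / Real.pi) * (rayExp ν (stableAngle ν) * ∫ r in Ioi (0 : ℝ),
      ((r ^ (ν - 1) : ℝ) : ℂ) *
        stablePhase ν (t * rayDir (stableAngle ν)) (s * rayExp ν (stableAngle ν)) r).im := by
  have ha := rayDir_stableAngle_re_pos h0 h1
  have hb := rayExp_stableAngle_re_pos h0 h1
  set a := rayDir (stableAngle ν) with hadef
  set b := rayExp ν (stableAngle ν) with hbdef
  have hderiv : ∀ τ ∈ Ioi t, deriv (fun y : ℝ => stableDensity ν τ y) s =
      1 / Real.pi * (a * -(b * ∫ r in Ioi (0 : ℝ), ((r ^ ν : ℝ) : ℂ) *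
        stablePhase ν (τ * a) (s * b) r)).im := by
    intro τ hτ
    have hτ0 : 0 < τ := ht.trans hτ
    have hd := (hasDerivAt_integral_stablePhase h0 (ofReal_mul_re_pos hτ0 ha).le hb hs).const_mul a
    have hd2 := (Complex.imCLM.hasFDerivAt.comp_hasDerivAt s hd).const_mul (1 / Real.pi)
    refine HasDerivAt.deriv (hd2.congr_of_eventuallyEq ?_)
    filter_upwards [lt_mem_nhds hs] with y hy
    exact stableDensity_eq h0 h1 hτ0 hy
  -- Integrating `e^(-a r τ)` over `τ > t` divides by `a r`, which lowers `r^ν` to `r^(ν-1)`.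
  have hinner : ∀ r : ℝ, 0 < r → ∫ τ in Ioi t, ((r ^ ν : ℝ) : ℂ) * stablePhase ν (τ * a) (s * b) r =
      a⁻¹ * (((r ^ (ν - 1) : ℝ) : ℂ) * stablePhase ν (t * a) (s * b) r) := by
    intro r hr
    have ha0 : a ≠ 0 := fun h => by simp [h] at ha
    have hr0 : (r : ℂ) ≠ 0 := by exact_mod_cast hr.ne'
    have hE := integral_exp_mul_complex_Ioi (a := -(a * r)) (by
      rw [Complex.neg_re, Complex.re_mul_ofReal]
      have : 0 < a.re * r := by positivity
      linarith) t
    have hsp : ∀ τ : ℝ, ((r ^ ν : ℝ) : ℂ) * stablePhase ν (τ * a) (s * b) r =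
        ((r ^ ν : ℝ) : ℂ) * Complex.exp (-(s * b * ((r ^ ν : ℝ) : ℂ))) *
          Complex.exp (-(a * r) * τ) := by
      intro τ
      rw [stablePhase, neg_add, Complex.exp_add]
      ring_nf
    simp only [hsp]
    rw [integral_const_mul, hE, stablePhase, neg_add, Complex.exp_add, Real.rpow_sub_one hr.ne']
    push_cast
    field_simp
  -- Absolute integrability in `τ` rests on `Re a > 0`. On the original contour `a = i`, and this
  -- would fail; hence the rotation.
  have hint : Integrable (Function.uncurry fun (τ r : ℝ) =>
      ((r ^ ν : ℝ) : ℂ) * stablePhase ν (τ * a) (s * b) r)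
      ((volume.restrict (Ioi t)).prod (volume.restrict (Ioi (0 : ℝ)))) := by
    have hm : AEStronglyMeasurable (Function.uncurry fun (τ r : ℝ) =>
        ((r ^ ν : ℝ) : ℂ) * stablePhase ν (τ * a) (s * b) r)
        ((volume.restrict (Ioi t)).prod (volume.restrict (Ioi (0 : ℝ)))) := by
      unfold Function.uncurry stablePhase
      exact (by fun_prop : Measurable fun p : ℝ × ℝ => ((p.2 ^ ν : ℝ) : ℂ) *
        Complex.exp (-(p.1 * a * p.2 + s * b * ((p.2 ^ ν : ℝ) : ℂ)))).aestronglyMeasurable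
    have hn : ∀ r : ℝ, 0 < r → ∀ τ : ℝ, ‖((r ^ ν : ℝ) : ℂ) * stablePhase ν (τ * a) (s * b) r‖ =
        r ^ ν * Real.exp (-(s * b.re * r ^ ν)) * Real.exp (-(a.re * r) * τ) := by
      intro r hr τ
      rw [norm_mul, norm_stablePhase, Complex.norm_real, Real.norm_eq_abs,
        abs_of_nonneg (by positivity), Complex.re_ofReal_mul, Complex.re_ofReal_mul, neg_add,
        Real.exp_add]
      ring_nf
    have hneg : ∀ r : ℝ, 0 < r → -(a.re * r) < 0 := fun r hr => by
      have : 0 < a.re * r := by positivity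
      linarith
    refine (integrable_prod_iff' hm).2 ⟨?_, ?_⟩
    · filter_upwards [ae_restrict_Ioi_pos] with r hr
      refine Integrable.mono' ((integrableOn_exp_mul_Ioi (hneg r hr) t).const_mul
        (r ^ ν * Real.exp (-(s * b.re * r ^ ν)))) ?_
        (Eventually.of_forall fun τ => (hn r hr τ).le)
      unfold Function.uncurry stablePhase
      exact (by fun_prop : Measurable fun τ : ℝ => ((r ^ ν : ℝ) : ℂ) *
        Complex.exp (-(τ * a * r + s * b * ((r ^ ν : ℝ) : ℂ)))).aestronglyMeasurable
    · have hi := (integrableOn_rpow_mul_stablePhase (s := ν - 1) h0 (by linarith)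
        (ofReal_mul_re_pos ht ha).le (ofReal_mul_re_pos hs hb)).norm.const_mul (a.re)⁻¹
      refine hi.congr ?_
      filter_upwards [ae_restrict_Ioi_pos] with r hr
      simp only [Function.uncurry, hn r hr]
      rw [integral_const_mul, integral_exp_mul_Ioi (hneg r hr), norm_mul, norm_stablePhase,
        Complex.norm_real, Real.norm_eq_abs, abs_of_nonneg (by positivity), Complex.re_ofReal_mul,
        Complex.re_ofReal_mul, neg_add, Real.exp_add, Real.rpow_sub_one hr.ne']
      field_simp
  rw [invStableDensity, setIntegral_congr_fun measurableSet_Ioi hderiv, integral_const_mul]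
  have hcomm := Complex.imCLM.integral_comp_comm ((hint.integral_prod_left).const_mul (-(a * b)))
  simp only [Function.uncurry] at hcomm
  have e1 : ∫ τ in Ioi t, (a * -(b * ∫ r in Ioi (0 : ℝ), ((r ^ ν : ℝ) : ℂ) *
        stablePhase ν (τ * a) (s * b) r)).im = (∫ τ in Ioi t, -(a * b) * ∫ r in Ioi (0 : ℝ),
        ((r ^ ν : ℝ) : ℂ) * stablePhase ν (τ * a) (s * b) r).im := by
    rw [← Complex.imCLM_apply, ← hcomm]
    refine integral_congr_ae (Eventually.of_forall fun τ => ?_)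
    simp only [Complex.imCLM_apply]
    ring_nf
  rw [e1, integral_const_mul, integral_integral_swap hint,
    setIntegral_congr_fun measurableSet_Ioi hinner, integral_const_mul]
  have ha0 : a ≠ 0 := fun h => by simp [h] at ha
  rw [show ∀ w : ℂ, -(a * b) * (a⁻¹ * w) = -(b * w) by intro w; field_simp, Complex.neg_im]
  ring

end Contour

/-! ### The Mellin transform of the inverse stable density for `0 < Re p < 1`. -/

theorem hasMellin_cexp_neg_mul {b p : ℂ} (hb : 0 < b.re) (hp : 0 < p.re) :
    HasMellin (fun t : ℝ => Complex.exp (-(b * t))) p (b ^ (-p) * Complex.Gamma p) :=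
  ⟨integrableOn_cpow_mul_cexp_neg_mul_Ioi hp hb, integral_cpow_mul_cexp_neg_mul_Ioi hp hb⟩

theorem HasMellin.comp_rpow {f : ℝ → ℂ} {s m : ℂ} {a : ℝ} (ha : a ≠ 0)
    (h : HasMellin f (s / a) m) : HasMellin (fun t => f (t ^ a)) s ((|a|⁻¹ : ℝ) * m) :=
  ⟨(MellinConvergent.comp_rpow ha).2 h.1, by
    rw [mellin_comp_rpow, h.2, Complex.real_smul]⟩

section InverseStable

variable {ν : ℝ}

/-- With `ρ = r^(-ν)` the factor `e^(-s b r^ν)` becomes a function of `s/ρ`, so the integral is a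
composition with a homogeneous kernel and its transform splits into two Euler integrals. Convergence
of the second one requires `Re p < 1`. -/
theorem hasMellin_integral_stablePhase (h0 : 0 < ν) {A b p : ℂ} (hA : 0 < A.re) (hb : 0 < b.re)
    (hp0 : 0 < p.re) (hp1 : p.re < 1) :
    HasMellin (fun s : ℝ => ∫ r in Ioi (0 : ℝ), ((r ^ (ν - 1) : ℝ) : ℂ) * stablePhase ν A (s * b) r)
      p (b ^ (-p) * Complex.Gamma p *
        (A ^ (-(ν * (1 - p))) * Complex.Gamma (ν * (1 - p)))) := by
  have hν : (ν : ℂ) ≠ 0 := by exact_mod_cast h0.ne'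
  have hnν : -(1 / ν) ≠ 0 := neg_ne_zero.2 (one_div_pos.2 h0).ne'
  have hf : HasMellin (fun ρ : ℝ => ((1 / ν : ℝ) : ℂ) * ((ρ : ℂ) ^ (-2 : ℂ) *
      Complex.exp (-(A * ((ρ ^ (-(1 / ν)) : ℝ) : ℂ))))) (p + 1)
      (A ^ (-(ν * (1 - p))) * Complex.Gamma (ν * (1 - p))) := by
    have e : (p + 1 + -2) / ((-(1 / ν) : ℝ) : ℂ) = ν * (1 - p) := by
      push_cast
      field_simp
      ring
    have h := hasMellin_cexp_neg_mul (p := ν * (1 - p)) hA (by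
      rw [Complex.re_ofReal_mul, Complex.sub_re, Complex.one_re]
      have : 0 < 1 - p.re := by linarith
      positivity)
    rw [← e] at h
    have h2 := (HasMellin.cpow_mul (HasMellin.comp_rpow hnν h)).const_mul ((1 / ν : ℝ) : ℂ)
    rw [e] at h2
    convert h2 using 1
    rw [← mul_assoc, abs_neg, abs_of_pos (one_div_pos.2 h0), ← Complex.ofReal_mul,
      mul_inv_cancel₀ (one_div_pos.2 h0).ne', Complex.ofReal_one, one_mul]
  have hq := hasMellin_cexp_neg_mul hb hp0
  have h := hasMellin_integral_comp_div (q := fun t : ℝ => Complex.exp (-(b * t))) (by fun_prop)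
    hq.1 hf.1
  rw [hq.2, hf.2] at h
  refine h.congr fun s _ => ?_
  rw [← integral_comp_rpow_Ioi _ (neg_ne_zero.2 h0.ne')]
  refine setIntegral_congr_fun measurableSet_Ioi fun r hr => ?_
  have hr' : 0 < r := hr
  have e1 : (r ^ (-ν)) ^ (-(1 / ν)) = r := by
    rw [← Real.rpow_mul hr'.le]
    have : -ν * -(1 / ν) = 1 := by field_simp
    rw [this, Real.rpow_one]
  have e2 : (((r ^ (-ν) : ℝ) : ℂ) ^ (-2 : ℂ)) = ((r ^ ν * r ^ ν : ℝ) : ℂ) := by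
    have : (-2 : ℂ) = ((-2 : ℝ) : ℂ) := by push_cast; rfl
    rw [this, ← Complex.ofReal_cpow (by positivity), ← Real.rpow_mul hr'.le,
      ← Real.rpow_add hr']
    ring_nf
  have e3 : s / r ^ (-ν) = s * r ^ ν := by rw [Real.rpow_neg hr'.le, div_inv_eq_mul]
  have e4 : r ^ (-ν - 1) * (r ^ ν * r ^ ν) = r ^ (ν - 1) := by
    rw [← Real.rpow_add hr', ← Real.rpow_add hr']
    ring_nf
  simp only [e1, e2, e3, ← e4, stablePhase, abs_neg, abs_of_pos h0, Complex.real_smul]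
  rw [show -(A * (r : ℂ) + s * b * ((r ^ ν : ℝ) : ℂ)) =
    -(b * ((s * r ^ ν : ℝ) : ℂ)) + -(A * r) by push_cast; ring, Complex.exp_add]
  push_cast
  field_simp

theorem rayExp_cpow {β : ℝ} (h : |ν * (Real.pi - β)| < Real.pi) (w : ℂ) :
    rayExp ν β ^ w = Complex.exp (-(ν * (Real.pi - β)) * Complex.I * w) := by
  have := abs_lt.1 h
  rw [rayExp, Complex.cpow_def_of_ne_zero (Complex.exp_ne_zero _), Complex.log_exp]
  · push_cast
    ring_nf
  · rw [Complex.im_ofReal_mul, Complex.I_im]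
    linarith
  · rw [Complex.im_ofReal_mul, Complex.I_im]
    linarith

theorem rayDir_cpow {β : ℝ} (h : |β| < Real.pi) (w : ℂ) :
    rayDir β ^ w = Complex.exp (β * Complex.I * w) := by
  have := abs_lt.1 h
  rw [rayDir, Complex.cpow_def_of_ne_zero (Complex.exp_ne_zero _), Complex.log_exp]
  · rw [Complex.im_ofReal_mul, Complex.I_im]
    linarith
  · rw [Complex.im_ofReal_mul, Complex.I_im]
    linarith

theorem abs_stableAngle_lt (h0 : 0 < ν) (h1 : ν < 1) : |stableAngle ν| < Real.pi := by
  have := stableAngle_mem h1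
  have := Real.pi_pos
  have : 0 < ν * Real.pi / 2 := by positivity
  rw [abs_lt]
  constructor <;> linarith [(stableAngle_mem h1).1, (stableAngle_mem h1).2]

theorem abs_mul_pi_sub_stableAngle_lt (h0 : 0 < ν) (h1 : ν < 1) :
    |ν * (Real.pi - stableAngle ν)| < Real.pi := by
  have h := stableAngle_mem h1
  have := Real.pi_pos
  have h2 : 0 < ν * Real.pi / 2 := by positivity
  rw [abs_of_nonneg (mul_nonneg h0.le (by linarith [h.2]))]
  nlinarith [h.1]

theorem rayDir_ne_zero (β : ℝ) : rayDir β ≠ 0 := Complex.exp_ne_zero _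

theorem rayExp_ne_zero (β : ℝ) : rayExp ν β ≠ 0 := Complex.exp_ne_zero _

/-- The phases `-ν(π-β)(1-p)` and `-βν(1-p)` add up to `-πν(1-p)`: the angle of the contour drops
out. -/
theorem rayExp_mul_cpow_mul_cpow (h0 : 0 < ν) (h1 : ν < 1) (p : ℂ) :
    rayExp ν (stableAngle ν) * (rayExp ν (stableAngle ν) ^ (-p) *
      rayDir (stableAngle ν) ^ (-(ν * (1 - p)))) =
      Complex.exp (-(Real.pi * (ν * (1 - p)) * Complex.I)) := by
  rw [rayExp_cpow (abs_mul_pi_sub_stableAngle_lt h0 h1), rayDir_cpow (abs_stableAngle_lt h0 h1),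
    rayExp, ← Complex.exp_add, ← Complex.exp_add]
  congr 1
  push_cast
  ring

theorem conj_stablePhase (A B : ℂ) (r : ℝ) :
    (starRingEnd ℂ) (stablePhase ν A B r) =
      stablePhase ν ((starRingEnd ℂ) A) ((starRingEnd ℂ) B) r := by
  simp only [stablePhase, ← Complex.exp_conj, map_neg, map_add, map_mul, Complex.conj_ofReal]

theorem Gamma_mul_sin_mul_Gamma {w : ℂ} (hw0 : 0 < w.re) (hw1 : w.re < 1) :
    Complex.sin (Real.pi * w) * Complex.Gamma w = Real.pi * (Complex.Gamma (1 - w))⁻¹ := by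
  have h := Complex.Gamma_mul_Gamma_one_sub w
  have g1 := Complex.Gamma_ne_zero_of_re_pos hw0
  have g2 : Complex.Gamma (1 - w) ≠ 0 := Complex.Gamma_ne_zero_of_re_pos (by simpa using hw1)
  have hs : Complex.sin (Real.pi * w) ≠ 0 := by
    intro hs
    rw [hs, div_zero] at h
    exact mul_ne_zero g1 g2 h
  rw [eq_div_iff hs] at h
  rw [eq_mul_inv_iff_mul_eq₀ g2]
  linear_combination h

theorem arg_ne_pi_of_re_pos {z : ℂ} (hz : 0 < z.re) : z.arg ≠ Real.pi :=
  (Complex.mem_slitPlane_iff_arg.1 (Or.inl hz)).1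

theorem ofReal_mul_cpow {t : ℝ} (ht : 0 < t) {a : ℂ} (ha : a ≠ 0) (w : ℂ) :
    ((t : ℂ) * a) ^ w = (t : ℂ) ^ w * a ^ w := by
  have ht0 : (t : ℂ) ≠ 0 := by exact_mod_cast ht.ne'
  rw [Complex.cpow_def_of_ne_zero (mul_ne_zero ht0 ha), Complex.cpow_def_of_ne_zero ht0,
    Complex.cpow_def_of_ne_zero ha, Complex.log_ofReal_mul ht ha, ← Complex.exp_add,
    Complex.ofReal_log ht.le]
  ring_nf

theorem conj_ofReal_cpow {t : ℝ} (ht : 0 < t) (w : ℂ) :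
    (starRingEnd ℂ) ((t : ℂ) ^ w) = (t : ℂ) ^ ((starRingEnd ℂ) w) := by
  have := Complex.conj_cpow (t : ℂ) ((starRingEnd ℂ) w) (arg_ne_pi_of_re_pos (by simpa using ht))
  rw [Complex.conj_conj, Complex.conj_ofReal] at this
  exact this.symm

/-- The imaginary part is written as a difference of the contour integral and its conjugate, each
with an explicit transform. The two phases `e^(∓iπν(1-p))` combine to a sine, which the reflection
formula converts into `1/Γ(1-ν(1-p))`. -/
theorem hasMellin_invStableDensity_aux (h0 : 0 < ν) (h1 : ν < 1) {t : ℝ} (ht : 0 < t) {p : ℂ}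
    (hp0 : 0 < p.re) (hp1 : p.re < 1) :
    HasMellin (fun s : ℝ => (invStableDensity ν s t : ℂ)) p
      (Complex.Gamma p * (Complex.Gamma (1 - ν * (1 - p)))⁻¹ * (t : ℂ) ^ (-(ν * (1 - p)))) := by
  have ha := rayDir_stableAngle_re_pos h0 h1
  have hb := rayExp_stableAngle_re_pos h0 h1
  have hexp := rayExp_mul_cpow_mul_cpow h0 h1
  set a := rayDir (stableAngle ν) with hadef
  set b := rayExp ν (stableAngle ν) with hbdef
  have htc : (starRingEnd ℂ) (t : ℂ) = t := Complex.conj_ofReal t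
  have hargA : ((t : ℂ) * a).arg ≠ Real.pi := arg_ne_pi_of_re_pos (ofReal_mul_re_pos ht ha)
  have hargb : b.arg ≠ Real.pi := arg_ne_pi_of_re_pos hb
  have hm1 := (hasMellin_integral_stablePhase h0 (ofReal_mul_re_pos ht ha) hb hp0 hp1).const_mul b
  have hm2 := (hasMellin_integral_stablePhase h0 (A := (starRingEnd ℂ) ((t : ℂ) * a))
    (b := (starRingEnd ℂ) b) (by simpa using ofReal_mul_re_pos ht ha) (by simpa using hb)
    hp0 hp1).const_mul ((starRingEnd ℂ) b)
  have hm := (hasMellin_sub hm1.1 hm2.1)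
  rw [hm1.2, hm2.2] at hm
  have hm' := hm.const_mul (Complex.I / (2 * Real.pi))
  have hpi : (Real.pi : ℂ) ≠ 0 := by exact_mod_cast Real.pi_ne_zero
  have hl := hm'.congr (g := fun s : ℝ => (invStableDensity ν s t : ℂ)) ?_
  · convert hl using 1
    have hν : 0 < (ν * (1 - p)).re ∧ (ν * (1 - p)).re < 1 := by
      rw [Complex.re_ofReal_mul, Complex.sub_re, Complex.one_re]
      constructor
      · have : 0 < 1 - p.re := by linarith
        positivity
      · nlinarith
    have hrefl := Gamma_mul_sin_mul_Gamma hν.1 hν.2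
    -- Only the ray is conjugated, not `p`; hence powers of conjugates are conjugates of powers with
    -- exponent built from the conjugate of `p`.
    have hconjb : ((starRingEnd ℂ) b) ^ (-p) = (starRingEnd ℂ) (b ^ (-(starRingEnd ℂ) p)) := by
      rw [Complex.conj_cpow _ _ hargb, map_neg]
    have hconjA : ((starRingEnd ℂ) ((t : ℂ) * a)) ^ (-(ν * (1 - p))) =
        (starRingEnd ℂ) (((t : ℂ) * a) ^ (-(ν * (1 - (starRingEnd ℂ) p)))) := by
      rw [Complex.conj_cpow _ _ hargA]
      simp
    have e1 := hexp p
    have e2 : (starRingEnd ℂ) b * ((starRingEnd ℂ) (b ^ (-(starRingEnd ℂ) p)) *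
        (starRingEnd ℂ) (a ^ (-(ν * (1 - (starRingEnd ℂ) p))))) =
        Complex.exp (Real.pi * (ν * (1 - p)) * Complex.I) := by
      rw [← map_mul, ← map_mul, hexp, ← Complex.exp_conj]
      simp
    have e3 : (starRingEnd ℂ) ((t : ℂ) ^ (-(ν * (1 - (starRingEnd ℂ) p)))) =
        (t : ℂ) ^ (-(ν * (1 - p))) := by
      rw [conj_ofReal_cpow ht]
      simp
    rw [hconjb, hconjA, ofReal_mul_cpow ht (rayDir_ne_zero _),
      ofReal_mul_cpow ht (rayDir_ne_zero _), map_mul, e3]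
    have hsin : Complex.sin (Real.pi * (ν * (1 - p))) =
        (Complex.exp (-(Real.pi * (ν * (1 - p)) * Complex.I)) -
          Complex.exp (Real.pi * (ν * (1 - p)) * Complex.I)) * Complex.I / 2 := by
      rw [Complex.sin]
      ring_nf
    rw [hsin, ← e1, ← e2] at hrefl
    have h2 : (Complex.Gamma (1 - ν * (1 - p)))⁻¹ = (Real.pi : ℂ)⁻¹ * (Real.pi *
      (Complex.Gamma (1 - ν * (1 - p)))⁻¹) := by rw [inv_mul_cancel_left₀ hpi]
    rw [h2, ← hrefl]
    field_simp
    simp only [← hadef]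
    ring
  · intro s hs
    rw [invStableDensity_eq h0 h1 hs ht, ← hadef, ← hbdef]
    set J := ∫ r in Ioi (0 : ℝ), ((r ^ (ν - 1) : ℝ) : ℂ) * stablePhase ν (t * a) (s * b) r with hJ
    have hJc : ∫ r in Ioi (0 : ℝ), ((r ^ (ν - 1) : ℝ) : ℂ) *
        stablePhase ν ((starRingEnd ℂ) (t * a)) (s * (starRingEnd ℂ) b) r = (starRingEnd ℂ) J := by
      rw [hJ, ← integral_conj]
      refine integral_congr_ae (Eventually.of_forall fun r => ?_)
      simp only [map_mul, conj_stablePhase, Complex.conj_ofReal]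
    rw [hJc, ← map_mul]
    have := Complex.sub_conj (b * J)
    rw [this]
    push_cast
    field_simp
    rw [Complex.I_sq]
    ring

end InverseStable

/-! ### Decay of the inverse stable density and extension to `Re p > 0`. -/

/-- For `‖z‖ ≤ 1` this is the Taylor estimate with `e < 3`. For `‖z‖ ≥ 1` each of the `N` terms is
at most `‖z‖^N`, and `|e^z| ≤ 1` in the left half plane. -/
theorem norm_cexp_sub_sum_le {z : ℂ} (hz : z.re ≤ 0) (N : ℕ) :
    ‖Complex.exp z - ∑ k ∈ Finset.range N, z ^ k / k.factorial‖ ≤ (N + 3) * ‖z‖ ^ N := by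
  rcases le_total ‖z‖ 1 with h | h
  · refine (Complex.norm_exp_sub_sum_le_norm_mul_exp z N).trans ?_
    rw [mul_comm]
    gcongr
    have h1 : Real.exp ‖z‖ ≤ Real.exp 1 := Real.exp_le_exp.2 h
    have h2 := Real.exp_one_lt_d9
    have h3 : (0 : ℝ) ≤ N := Nat.cast_nonneg N
    linarith
  · have hN : 1 ≤ ‖z‖ ^ N := one_le_pow₀ h
    have h1 : ‖Complex.exp z‖ ≤ 1 := by
      rw [Complex.norm_exp]
      exact Real.exp_le_one_iff.2 hz
    have h2 : ‖∑ k ∈ Finset.range N, z ^ k / (k.factorial : ℂ)‖ ≤ N * ‖z‖ ^ N := by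
      refine (norm_sum_le _ _).trans ?_
      have : ∀ k ∈ Finset.range N, ‖z ^ k / (k.factorial : ℂ)‖ ≤ ‖z‖ ^ N := by
        intro k hk
        rw [norm_div, norm_pow, Complex.norm_natCast]
        have hf : (1 : ℝ) ≤ k.factorial := by exact_mod_cast k.factorial_pos
        refine (div_le_self (by positivity) hf).trans ?_
        exact pow_le_pow_right₀ h (Finset.mem_range.1 hk).le
      simpa using Finset.sum_le_sum this
    have h3 := norm_sub_le (Complex.exp z) (∑ k ∈ Finset.range N, z ^ k / (k.factorial : ℂ))
    nlinarith

section InverseStable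

variable {ν : ℝ}

theorem integral_rpow_mul_pow_mul_stablePhase (h0 : 0 < ν) {B : ℂ} (hB : 0 < B.re) (k : ℕ) :
    ∫ r in Ioi (0 : ℝ), ((r ^ (ν - 1) : ℝ) : ℂ) * (r : ℂ) ^ k * stablePhase ν 0 B r =
      1 / ν * (B ^ (-(1 + k / ν : ℂ)) * Complex.Gamma (1 + k / ν)) := by
  have hw : 0 < (1 + k / ν : ℂ).re := by
    have : (1 + k / ν : ℂ) = ((1 + k / ν : ℝ) : ℂ) := by push_cast; rfl
    rw [this, Complex.ofReal_re]
    positivity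
  symm
  rw [← integral_cpow_mul_cexp_neg_mul_Ioi hw hB, ← integral_const_mul,
    ← integral_comp_rpow_Ioi _ h0.ne']
  refine setIntegral_congr_fun measurableSet_Ioi fun r hr => ?_
  have hr' : 0 < r := hr
  have hν : (ν : ℂ) ≠ 0 := by exact_mod_cast h0.ne'
  have e : ((r ^ ν : ℝ) : ℂ) ^ (1 + k / ν - 1 : ℂ) = (r : ℂ) ^ k := by
    have : (1 + k / ν - 1 : ℂ) = ((k / ν : ℝ) : ℂ) := by push_cast; ring
    rw [this, ← Complex.ofReal_cpow (by positivity), ← Real.rpow_mul hr'.le,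
      mul_div_cancel₀ _ h0.ne', Real.rpow_natCast]
    push_cast
    rfl
  simp only [e, stablePhase, abs_of_pos h0, Complex.real_smul, zero_mul, zero_add]
  push_cast
  field_simp

theorem rayExp_mul_rayDir_pow_mul_cpow (h0 : 0 < ν) (h1 : ν < 1) (k : ℕ) :
    rayExp ν (stableAngle ν) * (rayDir (stableAngle ν) ^ k *
      rayExp ν (stableAngle ν) ^ (-(1 + k / ν : ℂ))) = (-1) ^ k := by
  have hν : (ν : ℂ) ≠ 0 := by exact_mod_cast h0.ne'
  rw [rayExp_cpow (abs_mul_pi_sub_stableAngle_lt h0 h1), rayExp, rayDir, ← Complex.exp_nat_mul,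
    ← Complex.exp_add, ← Complex.exp_add, ← Complex.exp_pi_mul_I, ← Complex.exp_nat_mul]
  congr 1
  push_cast
  field_simp
  ring

/-- All phases combine to `(-1)^k`, so every term of the Taylor expansion in `t` of the contour
integral is real and contributes nothing to `l_ν`. -/
theorem im_moment_eq_zero (h0 : 0 < ν) (h1 : ν < 1) {s : ℝ} (hs : 0 < s) (t : ℝ) (k : ℕ) :
    (rayExp ν (stableAngle ν) * ∫ r in Ioi (0 : ℝ), ((r ^ (ν - 1) : ℝ) : ℂ) *
      ((-(t * rayDir (stableAngle ν) * r)) ^ k / k.factorial) *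
      stablePhase ν 0 (s * rayExp ν (stableAngle ν)) r).im = 0 := by
  have hb := rayExp_stableAngle_re_pos h0 h1
  have hm := integral_rpow_mul_pow_mul_stablePhase h0 (ofReal_mul_re_pos hs hb) k
  have hr := rayExp_mul_rayDir_pow_mul_cpow h0 h1 k
  set a := rayDir (stableAngle ν)
  set b := rayExp ν (stableAngle ν)
  have e : ∫ r in Ioi (0 : ℝ), ((r ^ (ν - 1) : ℝ) : ℂ) *
      ((-(t * a * r)) ^ k / k.factorial) * stablePhase ν 0 (s * b) r =
      (-t) ^ k * a ^ k / k.factorial * ∫ r in Ioi (0 : ℝ), ((r ^ (ν - 1) : ℝ) : ℂ) * (r : ℂ) ^ k *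
        stablePhase ν 0 (s * b) r := by
    rw [← integral_const_mul]
    refine integral_congr_ae (Eventually.of_forall fun r => ?_)
    simp only
    rw [show -((t : ℂ) * a * r) = (-t) * a * r by ring, mul_pow, mul_pow]
    ring
  rw [e, hm, ofReal_mul_cpow hs (rayExp_ne_zero _)]
  have e2 : b * ((-t : ℂ) ^ k * a ^ k / k.factorial * (1 / ν * ((s : ℂ) ^ (-(1 + k / ν : ℂ)) *
      b ^ (-(1 + k / ν : ℂ)) * Complex.Gamma (1 + k / ν)))) =
      (((-t) ^ k / k.factorial * (1 / ν) * s ^ (-(1 + k / ν : ℝ)) * Real.Gamma (1 + k / ν) *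
        (-1) ^ k : ℝ) : ℂ) := by
    push_cast [Complex.ofReal_cpow hs.le, ← Complex.Gamma_ofReal]
    rw [← hr]
    ring
  rw [e2, Complex.ofReal_im]

/-- Subtracting `N` Taylor terms of `e^(-t a r)` leaves the imaginary part unchanged. The remainder
is of size `(t r)^N`, and against `e^(-s Re(b) r^ν)` each power of `r` is worth `s^(-1/ν)`. -/
theorem exists_abs_invStableDensity_le_rpow (h0 : 0 < ν) (h1 : ν < 1) {t : ℝ} (ht : 0 < t)
    (N : ℕ) : ∃ C : ℝ, ∀ s : ℝ, 0 < s → |invStableDensity ν s t| ≤ C * s ^ (-(1 + N / ν)) := by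
  have ha := rayDir_stableAngle_re_pos h0 h1
  have hb := rayExp_stableAngle_re_pos h0 h1
  have hna := norm_rayDir (stableAngle ν)
  have hnb := norm_rayExp ν (stableAngle ν)
  have him := fun s (hs : 0 < s) k => im_moment_eq_zero h0 h1 hs t k
  set a := rayDir (stableAngle ν) with hadef
  set b := rayExp ν (stableAngle ν) with hbdef
  refine ⟨1 / Real.pi * ((N + 3) * t ^ N * (b.re ^ (-(1 + N / ν)) * (1 / ν) *
    Real.Gamma (1 + N / ν))), fun s hs => ?_⟩
  have hsb := ofReal_mul_re_pos hs hb
  have hta := ofReal_mul_re_pos ht ha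
  rw [invStableDensity_eq h0 h1 hs ht, ← hadef, ← hbdef]
  set G : ℕ → ℝ → ℂ := fun k r => ((r ^ (ν - 1) : ℝ) : ℂ) *
      ((-(t * a * r)) ^ k / k.factorial) * stablePhase ν 0 (s * b) r with hG
  have hGi : ∀ k, IntegrableOn (G k) (Ioi 0) := by
    intro k
    have hk : (0 : ℝ) ≤ k := Nat.cast_nonneg k
    have h := (integrableOn_rpow_mul_stablePhase (s := ν - 1 + k) (A := 0) h0 (by linarith)
      (by simp) hsb).const_mul ((-(t * a)) ^ k / k.factorial)
    refine IntegrableOn.congr_fun h (fun r hr => ?_) measurableSet_Ioi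
    have hr' : 0 < r := hr
    simp only [hG]
    rw [Real.rpow_add hr', Real.rpow_natCast, show -((t : ℂ) * a * r) = -(t * a) * r by ring,
      mul_pow (-((t : ℂ) * a))]
    push_cast
    ring
  have hJi := integrableOn_rpow_mul_stablePhase (s := ν - 1) h0 (by linarith) hta.le hsb
  have hsplit : (b * ∫ r in Ioi (0 : ℝ), ((r ^ (ν - 1) : ℝ) : ℂ) *
      stablePhase ν (t * a) (s * b) r).im = (b * ∫ r in Ioi (0 : ℝ), (((r ^ (ν - 1) : ℝ) : ℂ) *
        stablePhase ν (t * a) (s * b) r - ∑ k ∈ Finset.range N, G k r)).im := by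
    rw [integral_sub hJi (integrable_finsetSum _ fun k _ => hGi k),
      integral_finsetSum _ fun k _ => hGi k, mul_sub, Finset.mul_sum, Complex.sub_im,
      Complex.im_sum, Finset.sum_eq_zero (fun k _ => him s hs k), sub_zero]
  have hbound : ∀ r ∈ Ioi (0 : ℝ), ‖((r ^ (ν - 1) : ℝ) : ℂ) *
        stablePhase ν (t * a) (s * b) r - ∑ k ∈ Finset.range N, G k r‖ ≤
      (N + 3) * t ^ N * (r ^ (ν - 1 + N) * Real.exp (-(s * b.re) * r ^ ν)) := by
    intro r hr
    have hr' : 0 < r := hr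
    have hfac : ((r ^ (ν - 1) : ℝ) : ℂ) * stablePhase ν (t * a) (s * b) r -
        ∑ k ∈ Finset.range N, G k r = ((r ^ (ν - 1) : ℝ) : ℂ) * stablePhase ν 0 (s * b) r *
        (Complex.exp (-(t * a * r)) - ∑ k ∈ Finset.range N, (-(t * a * r)) ^ k / k.factorial) := by
      simp only [hG]
      rw [mul_sub, Finset.mul_sum]
      congr 1
      · rw [stablePhase, stablePhase, zero_mul, zero_add, neg_add, Complex.exp_add]
        ring
      · exact Finset.sum_congr rfl fun k _ => by ring
    have hR := norm_cexp_sub_sum_le (z := -((t : ℂ) * a * r)) (by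
      rw [Complex.neg_re, Complex.re_mul_ofReal]
      have : 0 < ((t : ℂ) * a).re * r := by positivity
      linarith) N
    have hz : ‖-((t : ℂ) * a * r)‖ = t * r := by
      simp [hna, abs_of_pos ht, abs_of_pos hr']
    rw [hz] at hR
    have hp := norm_stablePhase_le (ν := ν) (A := 0) (B := s * b) (c := s * b.re) hr' (by simp)
      (by rw [Complex.re_ofReal_mul])
    rw [hfac, norm_mul, norm_mul, Complex.norm_real, Real.norm_eq_abs,
      abs_of_nonneg (by positivity)]
    calc r ^ (ν - 1) * ‖stablePhase ν 0 (s * b) r‖ * _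
        ≤ r ^ (ν - 1) * Real.exp (-(s * b.re) * r ^ ν) * ((N + 3) * (t * r) ^ N) := by gcongr
      _ = _ := by rw [Real.rpow_add hr', Real.rpow_natCast, mul_pow]; ring
  have hN : (0 : ℝ) ≤ N := Nat.cast_nonneg N
  have hsbr : 0 < s * b.re := by positivity
  have hint := integrableOn_rpow_mul_exp_neg_mul_rpow (s := ν - 1 + N) (by linarith) h0 hsbr
  rw [hsplit, abs_mul, abs_neg, abs_of_pos (one_div_pos.2 Real.pi_pos), mul_assoc (1 / Real.pi)]
  gcongr
  refine (Complex.abs_im_le_norm _).trans ?_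
  rw [norm_mul, hnb, one_mul]
  refine (norm_integral_le_of_norm_le (hint.const_mul _)
    ((ae_restrict_iff' measurableSet_Ioi).2 (Eventually.of_forall hbound))).trans (le_of_eq ?_)
  rw [integral_const_mul, integral_rpow_mul_exp_neg_mul_rpow h0 (by linarith) hsbr]
  have e1 : (ν - 1 + N + 1) / ν = 1 + N / ν := by field_simp; ring
  have e2 : -(ν - 1 + N + 1) / ν = -(1 + N / ν) := by rw [neg_div, e1]
  rw [e1, e2, Real.mul_rpow hs.le hb.le]
  ring

/-- The factor depending on `s` has modulus at most `1`, and the decay of `e^(-t a r)` suffices. -/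
theorem exists_abs_invStableDensity_le (h0 : 0 < ν) (h1 : ν < 1) {t : ℝ} (ht : 0 < t) :
    ∃ C : ℝ, ∀ s : ℝ, 0 < s → |invStableDensity ν s t| ≤ C := by
  have ha := rayDir_stableAngle_re_pos h0 h1
  have hb := rayExp_stableAngle_re_pos h0 h1
  have hnb := norm_rayExp ν (stableAngle ν)
  set a := rayDir (stableAngle ν) with hadef
  set b := rayExp ν (stableAngle ν) with hbdef
  have hta := ofReal_mul_re_pos ht ha
  refine ⟨1 / Real.pi * ∫ r in Ioi (0 : ℝ), r ^ (ν - 1) * Real.exp (-(((t : ℂ) * a).re * r)),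
    fun s hs => ?_⟩
  rw [invStableDensity_eq h0 h1 hs ht, ← hadef, ← hbdef, abs_mul, abs_neg,
    abs_of_pos (one_div_pos.2 Real.pi_pos)]
  gcongr
  refine (Complex.abs_im_le_norm _).trans ?_
  rw [norm_mul, hnb, one_mul]
  refine norm_integral_le_of_norm_le (integrableOn_rpow_mul_exp_neg_mul_Ioi h0 hta) ?_
  filter_upwards [ae_restrict_Ioi_pos] with r hr
  rw [norm_mul, norm_stablePhase, Complex.norm_real, Real.norm_eq_abs,
    abs_of_nonneg (by positivity)]
  gcongr
  have : 0 < ((s : ℂ) * b).re * r ^ ν := by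
    have := ofReal_mul_re_pos hs hb
    positivity
  linarith

/-- The Mellin transform of the density of the inverse stable process. -/
theorem hasMellin_invStableDensity (h0 : 0 < ν) (h1 : ν < 1) {t : ℝ} (ht : 0 < t) {p : ℂ}
    (hp : 0 < p.re) :
    HasMellin (fun s : ℝ => (invStableDensity ν s t : ℂ)) p
      (Complex.Gamma p * (Complex.Gamma (1 - ν * (1 - p)))⁻¹ * (t : ℂ) ^ (-(ν * (1 - p)))) := by
  set l : ℝ → ℂ := fun s => (invStableDensity ν s t : ℂ) with hl
  have haux : ∀ p : ℂ, 0 < p.re → p.re < 1 → HasMellin l p _ := fun p hp0 hp1 =>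
    hasMellin_invStableDensity_aux h0 h1 ht hp0 hp1
  have hmeas : AEStronglyMeasurable l (volume.restrict (Ioi 0)) :=
    (haux (1 / 2 : ℝ) (by norm_num) (by norm_num)).1.aestronglyMeasurable
  obtain ⟨C, hC⟩ := exists_abs_invStableDensity_le h0 h1 ht
  have hloc : LocallyIntegrableOn l (Ioi 0) := by
    refine (locallyIntegrableOn_iff isOpen_Ioi.isLocallyClosed).2 fun K hK hKc => ?_
    refine Integrable.mono' (integrableOn_const (C := C) hKc.measure_lt_top.ne) (hmeas.mono_set hK) ?_
    refine (ae_restrict_iff' hKc.measurableSet).2 (Eventually.of_forall fun s hs => ?_)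
    simpa [hl] using hC s (hK hs)
  have hbot : l =O[𝓝[>] 0] (fun s : ℝ => s ^ (-(0 : ℝ))) := by
    refine Asymptotics.IsBigO.of_bound C ?_
    filter_upwards [self_mem_nhdsWithin] with s hs
    simpa [hl] using hC s hs
  have htop : ∀ c : ℝ, l =O[atTop] (fun s : ℝ => s ^ (-c)) := by
    intro c
    obtain ⟨N, hN⟩ := exists_nat_ge (ν * c)
    obtain ⟨D, hD⟩ := exists_abs_invStableDensity_le_rpow h0 h1 ht N
    refine Asymptotics.IsBigO.trans (g := fun s : ℝ => s ^ (-(1 + N / ν))) ?_ ?_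
    · refine Asymptotics.IsBigO.of_bound D ?_
      filter_upwards [eventually_gt_atTop 0] with s hs
      rw [Real.norm_of_nonneg (by positivity)]
      simpa [hl] using hD s hs
    · refine Asymptotics.IsBigO.of_bound 1 ?_
      filter_upwards [eventually_ge_atTop 1] with s hs
      rw [Real.norm_of_nonneg (by positivity), Real.norm_of_nonneg (by positivity), one_mul]
      apply Real.rpow_le_rpow_of_exponent_le hs
      have : c ≤ N / ν := by rw [le_div_iff₀ h0]; linarith
      linarith
  have hopen : IsOpen {z : ℂ | 0 < z.re} := isOpen_lt continuous_const Complex.continuous_re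
  refine ⟨mellinConvergent_of_isBigO_rpow hloc (htop (p.re + 1)) (by linarith) hbot hp, ?_⟩
  have hA1 : AnalyticOnNhd ℂ (mellin l) {z : ℂ | 0 < z.re} :=
    DifferentiableOn.analyticOnNhd (fun z hz => (mellin_differentiableAt_of_isBigO_rpow hloc
      (htop (z.re + 1)) (by linarith) hbot hz).differentiableWithinAt) hopen
  have hA2 : AnalyticOnNhd ℂ (fun p : ℂ => Complex.Gamma p *
      (Complex.Gamma (1 - ν * (1 - p)))⁻¹ * (t : ℂ) ^ (-(ν * (1 - p)))) {z : ℂ | 0 < z.re} := by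
    refine DifferentiableOn.analyticOnNhd (fun z hz => ?_) hopen
    have hG : DifferentiableAt ℂ Complex.Gamma z := by
      refine Complex.differentiableAt_Gamma _ fun m h => ?_
      have := congrArg Complex.re h
      have hz' : 0 < z.re := hz
      simp at this
      have : (0 : ℝ) ≤ m := Nat.cast_nonneg m
      linarith
    have hG2 : DifferentiableAt ℂ (fun p : ℂ => (Complex.Gamma (1 - ν * (1 - p)))⁻¹) z :=
      (Complex.differentiable_one_div_Gamma _).comp z
        (f := fun p : ℂ => 1 - (ν : ℂ) * (1 - p)) (by fun_prop)
    have hG3 : DifferentiableAt ℂ (fun p : ℂ => (t : ℂ) ^ (-(ν * (1 - p)))) z :=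
      DifferentiableAt.const_cpow (by fun_prop) (Or.inl (by exact_mod_cast ht.ne'))
    exact ((hG.mul hG2).mul hG3).differentiableWithinAt
  -- Analytic continuation from the strip `0 < Re p < 1`; the right side is analytic because `1/Γ`
  -- is entire.
  refine hA1.eqOn_of_preconnected_of_eventuallyEq hA2 (convex_halfSpace_re_gt 0).isPreconnected
    (z₀ := (1 / 2 : ℝ)) (by norm_num) ?_ hp
  have hU : {z : ℂ | 0 < z.re ∧ z.re < 1} ∈ 𝓝 ((1 / 2 : ℝ) : ℂ) :=
    (hopen.inter (isOpen_lt Complex.continuous_re continuous_const)).mem_nhds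
      ⟨by norm_num, by norm_num⟩
  filter_upwards [hU] with z hz
  exact (haux z hz.1 hz.2).2

end InverseStable

/-! ### The Mellin-Barnes representation of `uTilde` (the Fox function). -/

/-- Stated for every real `x`, since the Bessel formula at `x = 0` uses it as well. -/
theorem genGammaTilde_eq {γ μ s : ℝ} (hγ : γ ≠ 0) (x : ℝ) (hs : 0 < s) :
    genGammaTilde γ μ x s = |γ| * (x ^ (γ * μ - 1) / Real.Gamma μ) *
      (s ^ (-μ) * Real.exp (-(x ^ γ / s))) := by
  have e1 : (s ^ (1 / γ)) ^ (γ * μ) = s ^ μ := by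
    rw [← Real.rpow_mul hs.le]
    congr 1
    field_simp
  have e2 : (s ^ (1 / γ)) ^ γ = s := by
    rw [← Real.rpow_mul hs.le, one_div_mul_cancel hγ, Real.rpow_one]
  rw [genGammaTilde, genGamma, e1, e2, Real.rpow_neg hs.le]
  ring

theorem genGammaTilde_eq_of_pos {γ μ x s : ℝ} (hγ : γ ≠ 0) (hx : 0 < x) (hs : 0 < s) :
    genGammaTilde γ μ x s = |γ| / x * (Real.Gamma μ)⁻¹ *
      ((x ^ γ / s) ^ μ * Real.exp (-(x ^ γ / s))) := by
  rw [genGammaTilde_eq hγ x hs, Real.rpow_sub_one hx.ne', Real.rpow_mul hx.le,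
    Real.div_rpow (by positivity) hs.le, Real.rpow_neg hs.le]
  ring

/-- The Mellin-Barnes kernel `Γ(1+η) Γ(μ+η) / (Γ(1+νη) Γ(μ))`. -/
noncomputable def mbKernel (μ ν : ℝ) (η : ℂ) : ℂ :=
  Complex.Gamma (1 + η) * Complex.Gamma (μ + η) * (Complex.Gamma (1 + ν * η))⁻¹ *
    (Complex.Gamma μ)⁻¹

theorem foxKernel_eq_mbKernel (μ ν : ℝ) (η : ℂ) :
    foxKernel 2 0 ![((1 : ℝ), ν), (μ, (0 : ℝ))] ![((1 : ℝ), (1 : ℝ)), (μ, (1 : ℝ))] η =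
      mbKernel μ ν η := by
  simp [foxKernel, mbKernel, Fin.prod_univ_two, div_eq_mul_inv, mul_comm]
  ring

theorem inFoxStrip_iff (μ ν θ : ℝ) :
    InFoxStrip 2 0 ![((1 : ℝ), ν), (μ, (0 : ℝ))] ![((1 : ℝ), (1 : ℝ)), (μ, (1 : ℝ))] θ ↔
      0 < 1 + θ ∧ 0 < μ + θ := by
  simp [InFoxStrip, Fin.forall_fin_two]

theorem cpow_mul_cpow_eq_div_cpow {z t : ℝ} (hz : 0 < z) (ht : 0 < t) (ν : ℝ) (η : ℂ) :
    (z : ℂ) ^ (-η) * (t : ℂ) ^ (ν * η) = ((z / t ^ ν : ℝ) : ℂ) ^ (-η) := by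
  have e : ((t ^ ν : ℝ) : ℂ) ^ η = (t : ℂ) ^ (ν * η) :=
    (Complex.cpow_mul_ofReal_nonneg ht.le ν η).symm
  rw [Complex.ofReal_div, Complex.div_cpow_ofReal_nonneg hz.le (by positivity),
    Complex.cpow_neg (_ ^ _ : ℝ), div_inv_eq_mul, e]

/-- The inverse Mellin integral along the line `Re η = θ`. -/
noncomputable def mbInt (θ : ℝ) (K : ℝ → ℂ) (ρ : ℝ) : ℂ :=
  (1 / (2 * Real.pi) : ℂ) * ∫ y : ℝ, K y * (ρ : ℂ) ^ (-((θ : ℂ) + y * Complex.I))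

theorem integrableOn_genGammaTilde_mul_invStableDensity {γ μ ν x t : ℝ} (hγ : γ ≠ 0) (hμ : 0 < μ)
    (h0 : 0 < ν) (h1 : ν < 1) (hx : 0 < x) (ht : 0 < t) :
    IntegrableOn (fun s : ℝ => genGammaTilde γ μ x s * invStableDensity ν s t) (Ioi 0) := by
  -- `0 + 1` is `θ + 1` on the line `θ = 0`.
  have hl := hasMellin_invStableDensity h0 h1 ht (p := ((0 : ℝ) + 1 : ℝ)) (by simp)
  have h := ((integral_gamma_kernel_eq (μ := μ) hl.1 (by simpa using hμ)
    (Real.rpow_pos_of_pos hx γ)).1.re).const_mul (|γ| / x * (Real.Gamma μ)⁻¹)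
  refine IntegrableOn.congr_fun h (fun s hs => ?_) measurableSet_Ioi
  simp only [genGammaTilde_eq_of_pos hγ hx hs]
  rw [RCLike.re_to_complex, ← Complex.ofReal_mul, Complex.ofReal_re]
  ring

/-- For `ν < 1` the transform of `l_ν` at `η + 1` supplies `Γ(1+η)/Γ(1+νη)`. For `ν = 1` this
quotient is `1` and the formula is Mellin inversion of `Γ`. Since `θ` is arbitrary, all admissible
lines give the same value without any shift of contour. -/
theorem uTilde_eq_mbInt {γ μ ν x t θ : ℝ} (hγ : γ ≠ 0) (h0 : 0 < ν) (h1 : ν ≤ 1)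
    (hx : 0 < x) (ht : 0 < t) (hθ1 : 0 < 1 + θ) (hθμ : 0 < μ + θ) :
    ((uTilde γ μ ν x t : ℝ) : ℂ) = ((|γ| / x : ℝ) : ℂ) *
      mbInt θ (fun y => mbKernel μ ν (θ + y * Complex.I)) (x ^ γ / t ^ ν) := by
  have hpi : (2 * (Real.pi : ℂ)) ≠ 0 := by exact_mod_cast Real.two_pi_pos.ne'
  have hz : 0 < x ^ γ := Real.rpow_pos_of_pos hx γ
  rcases h1.lt_or_eq with h1 | rfl
  · have hl := fun p hp => hasMellin_invStableDensity h0 h1 ht (p := p) hp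
    have h := (integral_gamma_kernel_eq (θ := θ) (μ := μ) (hl _ (by
      rw [Complex.ofReal_re]; linarith)).1 hθμ hz).2
    have e1 : ((uTilde γ μ ν x t : ℝ) : ℂ) = ((|γ| / x : ℝ) : ℂ) * (Complex.Gamma μ)⁻¹ *
        ∫ s in Ioi (0 : ℝ), (((x ^ γ / s) ^ μ * Real.exp (-(x ^ γ / s)) : ℝ) : ℂ) *
          (invStableDensity ν s t : ℂ) := by
      rw [uTilde, if_neg h1.ne, ← integral_complex_ofReal, ← integral_const_mul]
      refine setIntegral_congr_fun measurableSet_Ioi fun s hs => ?_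
      simp only [genGammaTilde_eq_of_pos hγ hx hs, Complex.Gamma_ofReal]
      push_cast
      ring
    have e2 : ∫ s in Ioi (0 : ℝ), (((x ^ γ / s) ^ μ * Real.exp (-(x ^ γ / s)) : ℝ) : ℂ) *
          (invStableDensity ν s t : ℂ) = (1 / (2 * Real.pi) : ℂ) * (2 * Real.pi *
        ∫ s in Ioi (0 : ℝ), (((x ^ γ / s) ^ μ * Real.exp (-(x ^ γ / s)) : ℝ) : ℂ) *
          (invStableDensity ν s t : ℂ)) := by
      rw [← mul_assoc, one_div_mul_cancel hpi, one_mul]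
    rw [e1, e2, h, mbInt, mul_assoc, mul_left_comm (Complex.Gamma μ)⁻¹, ← integral_const_mul]
    congr 2
    refine integral_congr_ae (Eventually.of_forall fun y => ?_)
    simp only
    rw [(hl _ (by simpa [add_comm] using hθ1)).2, mbKernel, ← cpow_mul_cpow_eq_div_cpow hz ht]
    have e3 : -((ν : ℂ) * (1 - (θ + y * Complex.I + 1))) = ν * (θ + y * Complex.I) := by ring
    have e4 : 1 - (ν : ℂ) * (1 - (θ + y * Complex.I + 1)) = 1 + ν * (θ + y * Complex.I) := by ring
    rw [e3, e4, add_comm _ (1 : ℂ)]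
    ring
  · have hzt : 0 < x ^ γ / t := div_pos hz ht
    have h := integral_cpow_neg_mul_Gamma hθμ hzt
    have hzt' : ((x ^ γ / t : ℝ) : ℂ) ≠ 0 := by exact_mod_cast hzt.ne'
    have e1 : ((uTilde γ μ 1 x t : ℝ) : ℂ) = ((|γ| / x : ℝ) : ℂ) * (Complex.Gamma μ)⁻¹ *
        (((x ^ γ / t : ℝ) : ℂ) ^ (μ : ℂ) * Complex.exp (-((x ^ γ / t : ℝ) : ℂ))) := by
      rw [uTilde, if_pos rfl, genGammaTilde_eq_of_pos hγ hx ht, ← Complex.ofReal_cpow hzt.le,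
        Complex.Gamma_ofReal]
      push_cast
      ring
    have e2 : Complex.exp (-((x ^ γ / t : ℝ) : ℂ)) = (1 / (2 * Real.pi) : ℂ) *
        (2 * Real.pi * Complex.exp (-((x ^ γ / t : ℝ) : ℂ))) := by
      rw [← mul_assoc, one_div_mul_cancel hpi, one_mul]
    rw [e1, e2, ← h, mbInt, Real.rpow_one, mul_assoc, mul_left_comm _ (1 / (2 * Real.pi) : ℂ),
      mul_left_comm _ (1 / (2 * Real.pi) : ℂ), ← integral_const_mul, ← integral_const_mul]
    congr 2
    refine integral_congr_ae (Eventually.of_forall fun y => ?_)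
    have hG : Complex.Gamma (1 + (θ + y * Complex.I)) ≠ 0 :=
      Complex.Gamma_ne_zero_of_re_pos (by simpa using hθ1)
    have e3 : ((x ^ γ / t : ℝ) : ℂ) ^ (-((θ : ℂ) + y * Complex.I)) =
        ((x ^ γ / t : ℝ) : ℂ) ^ (μ : ℂ) *
        ((x ^ γ / t : ℝ) : ℂ) ^ (-(((μ + θ : ℝ) : ℂ) + y * Complex.I)) := by
      rw [← Complex.cpow_add _ _ hzt']
      congr 1
      push_cast
      ring
    simp only [mbKernel, e3]
    rw [Complex.ofReal_one, one_mul, Complex.ofReal_add, add_assoc]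
    field_simp

/-- Continuous functions on a line that decay exponentially. -/
def VertDecay (K : ℝ → ℂ) : Prop :=
  Continuous K ∧ ∃ C c : ℝ, 0 ≤ C ∧ 0 < c ∧ ∀ y : ℝ, ‖K y‖ ≤ C * Real.exp (-(c * |y|))

/-- The quotient is the Mellin transform of `l_ν(·,1)` at `1 + η`, hence bounded on the line by the
integral of absolute values; no asymptotics of `Γ` are involved. -/
theorem exists_norm_Gamma_ratio_le {ν θ : ℝ} (h0 : 0 < ν) (h1 : ν ≤ 1) (hθ : 0 < 1 + θ) :
    ∃ C : ℝ, 0 ≤ C ∧ ∀ y : ℝ, ‖Complex.Gamma (1 + (θ + y * Complex.I)) *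
      (Complex.Gamma (1 + ν * (θ + y * Complex.I)))⁻¹‖ ≤ C := by
  rcases h1.lt_or_eq with h1 | rfl
  · refine ⟨∫ s in Ioi (0 : ℝ), s ^ θ * ‖(invStableDensity ν s 1 : ℂ)‖,
      setIntegral_nonneg measurableSet_Ioi fun s hs => ?_, fun y => ?_⟩
    · have : 0 < s := hs
      positivity
    · have h := (hasMellin_invStableDensity h0 h1 one_pos (p := 1 + (θ + y * Complex.I))
        (by simpa using hθ)).2
      have e : 1 - (ν : ℂ) * (1 - (1 + (θ + y * Complex.I))) = 1 + ν * (θ + y * Complex.I) := by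
        ring
      rw [e, Complex.ofReal_one, Complex.one_cpow, mul_one] at h
      rw [← h, mellin]
      refine (norm_integral_le_integral_norm _).trans (le_of_eq ?_)
      refine setIntegral_congr_fun measurableSet_Ioi fun s hs => ?_
      rw [norm_smul, Complex.norm_cpow_eq_rpow_re_of_pos hs]
      simp
  · refine ⟨1, zero_le_one, fun y => ?_⟩
    have hG : Complex.Gamma (1 + (θ + y * Complex.I)) ≠ 0 :=
      Complex.Gamma_ne_zero_of_re_pos (by simpa using hθ)
    rw [Complex.ofReal_one, one_mul, mul_inv_cancel₀ hG, norm_one]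

/-- The decay comes from `Γ(μ+η)` alone; the quotient of the other two Gamma factors is bounded. -/
theorem vertDecay_mbKernel {μ ν θ : ℝ} (h0 : 0 < ν) (h1 : ν ≤ 1) (hθ1 : 0 < 1 + θ)
    (hθμ : 0 < μ + θ) : VertDecay fun y => mbKernel μ ν (θ + y * Complex.I) := by
  obtain ⟨C, hC0, hC⟩ := exists_norm_Gamma_ratio_le h0 h1 hθ1
  obtain ⟨D, hD0, hD⟩ := exists_norm_Gamma_le hθμ
  have c1 := continuous_Gamma_vertical hθ1
  have c2 := continuous_Gamma_vertical hθμ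
  have c3 : Continuous fun y : ℝ => (Complex.Gamma (1 + ν * (θ + y * Complex.I)))⁻¹ :=
    Complex.differentiable_one_div_Gamma.continuous.comp (by fun_prop)
  push_cast [add_assoc] at c1 c2 hD
  refine ⟨((c1.mul c2).mul c3).mul continuous_const, C * D * ‖(Complex.Gamma μ)⁻¹‖, 1,
    by positivity, one_pos, fun y => ?_⟩
  simp only [mbKernel]
  rw [mul_right_comm (Complex.Gamma _), norm_mul, norm_mul, one_mul]
  calc _ ≤ C * (D * Real.exp (-|y|)) * ‖(Complex.Gamma μ)⁻¹‖ := by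
        gcongr
        · exact hC y
        · exact hD y
    _ = _ := by ring

theorem VertDecay.integrable {K : ℝ → ℂ} (hK : VertDecay K) : Integrable K := by
  obtain ⟨hc, C, c, -, hc0, hC⟩ := hK
  exact ((integrable_exp_neg_mul_abs hc0).const_mul C).mono' hc.aestronglyMeasurable
    (Eventually.of_forall hC)

theorem norm_ofReal_cpow_vertical {ρ : ℝ} (hρ : 0 < ρ) (θ y : ℝ) :
    ‖(ρ : ℂ) ^ (-((θ : ℂ) + y * Complex.I))‖ = ρ ^ (-θ) := by
  rw [Complex.norm_cpow_eq_rpow_re_of_pos hρ]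
  simp

theorem VertDecay.integrable_mul_cpow {K : ℝ → ℂ} (hK : VertDecay K) (θ : ℝ) {ρ : ℝ}
    (hρ : 0 < ρ) : Integrable fun y : ℝ => K y * (ρ : ℂ) ^ (-((θ : ℂ) + y * Complex.I)) := by
  refine (hK.integrable.norm.mul_const (ρ ^ (-θ))).mono' (hK.1.aestronglyMeasurable.mul
    (by fun_prop : Measurable fun y : ℝ =>
      (ρ : ℂ) ^ (-((θ : ℂ) + y * Complex.I))).aestronglyMeasurable)
    (Eventually.of_forall fun y => ?_)
  rw [norm_mul, norm_ofReal_cpow_vertical hρ]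

/-- The representation of `uTilde` by a Fox function. -/
theorem exists_isFoxH_uTilde {γ μ ν x t : ℝ} (hγ : γ ≠ 0) (hμ : 0 < μ) (h0 : 0 < ν) (h1 : ν ≤ 1)
    (hx : 0 < x) (ht : 0 < t) :
    ∃ w : ℂ, IsFoxH 2 0 ![((1 : ℝ), ν), (μ, (0 : ℝ))] ![((1 : ℝ), (1 : ℝ)), (μ, (1 : ℝ))]
        (x ^ γ / t ^ ν) w ∧ ((uTilde γ μ ν x t : ℝ) : ℂ) = ((|γ| / x : ℝ) : ℂ) * w := by
  have hc : ((|γ| / x : ℝ) : ℂ) ≠ 0 := by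
    exact_mod_cast (div_pos (abs_pos.2 hγ) hx).ne'
  have hρ : 0 < x ^ γ / t ^ ν := by positivity
  have hrep := fun θ hθ1 hθμ => uTilde_eq_mbInt (μ := μ) (θ := θ) hγ h0 h1 hx ht hθ1 hθμ
  refine ⟨mbInt 0 (fun y => mbKernel μ ν ((0 : ℝ) + y * Complex.I)) (x ^ γ / t ^ ν),
    ⟨⟨0, (inFoxStrip_iff _ _ _).2 (by simpa using hμ)⟩, fun θ hθ => ?_⟩,
    hrep 0 (by simp) (by simpa using hμ)⟩
  obtain ⟨hθ1, hθμ⟩ := (inFoxStrip_iff _ _ _).1 hθ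
  simp only [foxKernel_eq_mbKernel]
  refine ⟨(vertDecay_mbKernel h0 h1 hθ1 hθμ).integrable_mul_cpow θ hρ, ?_⟩
  have h := (hrep 0 (by simp) (by simpa using hμ)).symm.trans (hrep θ hθ1 hθμ)
  rw [mul_left_cancel₀ hc h, mbInt]
  push_cast
  rfl

/-! ### Differentiating Mellin-Barnes integrals. -/

/-- Halving the exponential rate absorbs the linear factor. -/
theorem VertDecay.affine_mul {K : ℝ → ℂ} (hK : VertDecay K) (a b : ℂ) :
    VertDecay fun y => (a + b * y) * K y := by
  obtain ⟨hc, C, c, hC0, hc0, hC⟩ := hK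
  refine ⟨by fun_prop, (‖a‖ + ‖b‖ * (2 / c)) * C, c / 2, by positivity, by positivity,
    fun y => ?_⟩
  have h1 : 1 ≤ Real.exp (c / 2 * |y|) := Real.one_le_exp (by positivity)
  have h2 : |y| ≤ 2 / c * Real.exp (c / 2 * |y|) := by
    have := Real.add_one_le_exp (c / 2 * |y|)
    calc |y| = 2 / c * (c / 2 * |y|) := by field_simp
      _ ≤ _ := by gcongr; linarith
  have h3 : Real.exp (c / 2 * |y|) * Real.exp (-(c * |y|)) = Real.exp (-(c / 2 * |y|)) := by
    rw [← Real.exp_add]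
    congr 1
    ring
  calc ‖(a + b * y) * K y‖ ≤ (‖a‖ + ‖b‖ * |y|) * ‖K y‖ := by
        rw [norm_mul]
        gcongr
        refine (norm_add_le _ _).trans_eq ?_
        rw [norm_mul, Complex.norm_real, Real.norm_eq_abs]
    _ ≤ (‖a‖ * Real.exp (c / 2 * |y|) + ‖b‖ * (2 / c * Real.exp (c / 2 * |y|))) *
        (C * Real.exp (-(c * |y|))) := by
        gcongr
        · exact le_mul_of_one_le_right (norm_nonneg _) h1
        · exact hC y
    _ = (‖a‖ + ‖b‖ * (2 / c)) * C * (Real.exp (c / 2 * |y|) * Real.exp (-(c * |y|))) := by ring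
    _ = _ := by rw [h3]

theorem one_add_mul_I_ne_zero (r : ℝ) : (1 + r * Complex.I : ℂ) ≠ 0 := by
  intro h
  simpa using congrArg Complex.re h

theorem one_le_norm_one_add_mul_I (r : ℝ) : 1 ≤ ‖(1 + r * Complex.I : ℂ)‖ := by
  simpa using Complex.re_le_norm (1 + r * Complex.I)

theorem VertDecay.div_affine {K : ℝ → ℂ} (hK : VertDecay K) (ν : ℝ) :
    VertDecay fun y => K y / (1 + (ν * y : ℝ) * Complex.I) := by
  obtain ⟨hc, C, c, hC0, hc0, hC⟩ := hK
  refine ⟨hc.div (by fun_prop) fun y => one_add_mul_I_ne_zero _, C, c, hC0, hc0, fun y => ?_⟩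
  rw [norm_div]
  exact (div_le_self (norm_nonneg _) (one_le_norm_one_add_mul_I _)).trans (hC y)

/-- On `Re η = 0` the operator `ρ d/dρ` multiplies the kernel by `-iy`, and the powers of `ρ` have
modulus `1`. The multiplier is written `0 + -I * y` to fit `VertDecay.affine_mul`. -/
theorem hasDerivAt_mbInt_zero {K : ℝ → ℂ} (hK : VertDecay K) {ρ : ℝ} (hρ : 0 < ρ) :
    HasDerivAt (mbInt 0 K) ((ρ : ℂ)⁻¹ * mbInt 0 (fun y => (0 + -Complex.I * y) * K y) ρ) ρ := by
  have hK' := hK.affine_mul 0 (-Complex.I)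
  have hs : Ioi (ρ / 2) ∈ 𝓝 ρ := Ioi_mem_nhds (by linarith)
  have hpos : ∀ r ∈ Ioi (ρ / 2), 0 < r := fun r hr => (half_pos hρ).trans hr
  have key := hasDerivAt_integral_of_dominated_loc_of_deriv_le (𝕜 := ℝ) (μ := volume)
    (F := fun (r : ℝ) (y : ℝ) => K y * (r : ℂ) ^ (-(((0 : ℝ) : ℂ) + y * Complex.I)))
    (F' := fun (r : ℝ) (y : ℝ) => (r : ℂ)⁻¹ *
      ((0 + -Complex.I * y) * K y * (r : ℂ) ^ (-(((0 : ℝ) : ℂ) + y * Complex.I))))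
    (bound := fun y => (ρ / 2)⁻¹ * ‖(0 + -Complex.I * y) * K y‖) hs
    (by
      filter_upwards [hs] with r hr
      exact (hK.integrable_mul_cpow 0 (hpos r hr)).aestronglyMeasurable)
    (hK.integrable_mul_cpow 0 hρ)
    ((hK'.integrable_mul_cpow 0 hρ).const_mul _).aestronglyMeasurable
    (Eventually.of_forall fun y r hr => by
      rw [norm_mul, norm_mul _ ((r : ℂ) ^ _), norm_ofReal_cpow_vertical (hpos r hr), neg_zero,
        Real.rpow_zero, mul_one, norm_inv, Complex.norm_real, Real.norm_of_nonneg (hpos r hr).le]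
      have : ρ / 2 ≤ r := le_of_lt hr
      gcongr)
    (hK'.integrable.norm.const_mul _)
    (Eventually.of_forall fun y r hr => by
      have hr0 : (r : ℂ) ≠ 0 := by exact_mod_cast (hpos r hr).ne'
      have h := (((hasDerivAt_id (r : ℂ)).cpow_const
        (c := -(((0 : ℝ) : ℂ) + y * Complex.I))
        (Or.inl (by simpa using hpos r hr))).comp_ofReal).const_mul (K y)
      refine h.congr_deriv ?_
      rw [id, Complex.cpow_sub _ _ hr0, Complex.cpow_one]
      push_cast
      ring)
  refine (key.2.const_mul (1 / (2 * Real.pi) : ℂ)).congr_deriv ?_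
  rw [integral_const_mul, mbInt]
  ring

theorem contDiffOn_mbInt_zero (n : ℕ) : ∀ {K : ℝ → ℂ}, VertDecay K →
    ContDiffOn ℝ n (mbInt 0 K) (Ioi 0) := by
  induction n with
  | zero =>
    intro K hK
    exact contDiffOn_zero.2 fun ρ hρ =>
      (hasDerivAt_mbInt_zero hK hρ).continuousAt.continuousWithinAt
  | succ n ih =>
    intro K hK
    rw [Nat.cast_add, Nat.cast_one, contDiffOn_succ_iff_deriv_of_isOpen isOpen_Ioi]
    refine ⟨fun ρ hρ => (hasDerivAt_mbInt_zero hK hρ).differentiableAt.differentiableWithinAt,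
      by simp, ?_⟩
    have h1 : ContDiffOn ℝ n (fun ρ : ℝ => ((ρ⁻¹ : ℝ) : ℂ)) (Ioi 0) :=
      Complex.ofRealCLM.contDiff.comp_contDiffOn
        (contDiffOn_id.inv fun ρ hρ => ne_of_gt hρ)
    refine (h1.mul (ih (hK.affine_mul 0 (-Complex.I)))).congr fun ρ hρ => ?_
    rw [(hasDerivAt_mbInt_zero hK hρ).deriv, Complex.ofReal_inv]

theorem hasDerivAt_re_mbInt_zero {K : ℝ → ℂ} (hK : VertDecay K) {ρ : ℝ} (hρ : 0 < ρ) :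
    HasDerivAt (fun r => (mbInt 0 K r).re)
      ((mbInt 0 (fun y => (0 + -Complex.I * y) * K y) ρ).re / ρ) ρ := by
  refine (Complex.reCLM.hasFDerivAt.comp_hasDerivAt ρ (hasDerivAt_mbInt_zero hK hρ)).congr_deriv ?_
  rw [Complex.reCLM_apply, ← Complex.ofReal_inv, Complex.re_ofReal_mul, div_eq_inv_mul]

theorem mbInt_add {K L : ℝ → ℂ} (hK : VertDecay K) (hL : VertDecay L) (θ : ℝ) {ρ : ℝ}
    (hρ : 0 < ρ) : mbInt θ (fun y => K y + L y) ρ = mbInt θ K ρ + mbInt θ L ρ := by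
  simp only [mbInt, add_mul]
  rw [integral_add (hK.integrable_mul_cpow θ hρ) (hL.integrable_mul_cpow θ hρ), mul_add]

theorem mbInt_const_mul (K : ℝ → ℂ) (a : ℂ) (θ ρ : ℝ) :
    mbInt θ (fun y => a * K y) ρ = a * mbInt θ K ρ := by
  simp only [mbInt, mul_assoc]
  rw [integral_const_mul]
  ring

/-- `K` is the same function of `y` on both sides: a factor `ρ⁻¹` is taken out, the contour is not
shifted. -/
theorem mbInt_one_eq (K : ℝ → ℂ) {ρ : ℝ} (hρ : 0 < ρ) :
    mbInt 1 K ρ = (ρ : ℂ)⁻¹ * mbInt 0 K ρ := by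
  have hρ0 : (ρ : ℂ) ≠ 0 := by exact_mod_cast hρ.ne'
  rw [mbInt, mbInt, mul_left_comm]
  congr 1
  rw [← integral_const_mul]
  refine integral_congr_ae (Eventually.of_forall fun y => ?_)
  simp only
  rw [Complex.ofReal_one, Complex.ofReal_zero, zero_add, neg_add, Complex.cpow_add _ _ hρ0,
    Complex.cpow_neg_one]
  ring

/-- The action of `genBesselOp` on functions of the form `y⁻¹ A(y^γ / τ)`, in terms of the
iterates of the operator `ρ d/dρ` on `A`. -/
theorem genBesselOp_eq {γ μ k τ x : ℝ} {f A B C : ℝ → ℝ} (hγ : γ ≠ 0) (hτ : 0 < τ) (hx : 0 < x)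
    (hf : ∀ y, 0 < y → f y = k * (y⁻¹ * A (y ^ γ / τ)))
    (hA : ∀ ρ, 0 < ρ → HasDerivAt A (B ρ / ρ) ρ) (hB : ∀ ρ, 0 < ρ → HasDerivAt B (C ρ / ρ) ρ) :
    genBesselOp γ μ f x = k * x ^ (-γ - 1) *
      (C (x ^ γ / τ) - (1 + μ) * B (x ^ γ / τ) + μ * A (x ^ γ / τ)) := by
  have comp : ∀ {D E : ℝ → ℝ}, (∀ ρ, 0 < ρ → HasDerivAt D (E ρ / ρ) ρ) → ∀ y, 0 < y →
      HasDerivAt (fun y => D (y ^ γ / τ)) (γ * E (y ^ γ / τ) / y) y := by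
    intro D E hD y hy
    have hyγ : 0 < y ^ γ := Real.rpow_pos_of_pos hy γ
    refine ((hD _ (div_pos hyγ hτ)).comp y
      ((Real.hasDerivAt_rpow_const (Or.inl hy.ne')).div_const τ)).congr_deriv ?_
    rw [Real.rpow_sub_one hy.ne']
    field_simp
  have hf' : ∀ y, 0 < y →
      deriv f y = k * (y ^ (-2 : ℝ) * (γ * B (y ^ γ / τ) - A (y ^ γ / τ))) := by
    intro y hy
    have h := ((hasDerivAt_inv hy.ne').mul (comp hA y hy)).const_mul k
    have h' : HasDerivAt f _ y := h.congr_of_eventuallyEq (by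
      filter_upwards [Ioi_mem_nhds hy] with r hr
      exact hf r hr)
    rw [h'.deriv, Real.rpow_neg hy.le, Real.rpow_two]
    field_simp
    ring
  have hpow : ∀ y : ℝ, 0 < y → HasDerivAt (fun y : ℝ => y ^ (-γ)) (-γ * y ^ (-γ - 1)) y :=
    fun y hy => Real.hasDerivAt_rpow_const (Or.inl hy.ne')
  have h1 : HasDerivAt (fun y : ℝ => y ^ (2 - γ) * deriv f y) (k * x ^ (-γ - 1) *
      (γ ^ 2 * C (x ^ γ / τ) - γ ^ 2 * B (x ^ γ / τ) - γ * B (x ^ γ / τ) + γ * A (x ^ γ / τ)))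
      x := by
    have h := ((hpow x hx).mul (((comp hB x hx).const_mul γ).sub (comp hA x hx))).const_mul k
    refine (h.congr_of_eventuallyEq ?_).congr_deriv ?_
    · filter_upwards [Ioi_mem_nhds hx] with y hy
      simp only [Pi.mul_apply, Pi.sub_apply]
      rw [hf' y hy, sub_eq_add_neg, Real.rpow_add hy, Real.rpow_neg hy.le 2]
      have : (y : ℝ) ^ (2 : ℝ) ≠ 0 := (Real.rpow_pos_of_pos hy 2).ne'
      field_simp
    · simp only [Real.rpow_sub_one hx.ne', Pi.sub_apply]
      field_simp
      ring
  have h2 : HasDerivAt (fun y : ℝ => y ^ (1 - γ) * f y) (k * x ^ (-γ - 1) *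
      (γ * B (x ^ γ / τ) - γ * A (x ^ γ / τ))) x := by
    have h := ((hpow x hx).mul (comp hA x hx)).const_mul k
    refine (h.congr_of_eventuallyEq ?_).congr_deriv ?_
    · filter_upwards [Ioi_mem_nhds hx] with y hy
      simp only [Pi.mul_apply]
      rw [hf y hy, sub_eq_add_neg, Real.rpow_add hy, Real.rpow_one]
      have : y ≠ 0 := ne_of_gt hy
      field_simp
    · simp only [Real.rpow_sub_one hx.ne']
      field_simp
      ring
  -- The terms linear in `γ` cancel and `γ^2` factors out, which leaves `(δ-1)(δ-μ) A` with `δ = ρ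
  -- d/dρ`.
  rw [genBesselOp, h1.deriv, h2.deriv]
  field_simp
  ring

/-- In `r` the integrand is a multiple of `r^(1+iνy)`, so the derivative brings down `1 + iνy`. This
cancels the denominator of `fracKernel`. -/
theorem hasDerivAt_mul_re_mbInt {L : ℝ → ℂ} (hL : VertDecay L) {ν z t : ℝ} (hz : 0 < z)
    (ht : 0 < t) : HasDerivAt (fun r => r * (mbInt 0 L (z / r ^ ν)).re)
      (mbInt 0 (fun y => (1 + ν * Complex.I * y) * L y) (z / t ^ ν)).re t := by
  have hρ : 0 < z / t ^ ν := by positivity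
  have h1 : HasDerivAt (fun r : ℝ => z / r ^ ν) (-ν * (z / t ^ ν) / t) t := by
    refine (((Real.hasDerivAt_rpow_const (p := -ν) (Or.inl ht.ne')).const_mul z).congr_of_eventuallyEq
      ?_).congr_deriv ?_
    · filter_upwards [Ioi_mem_nhds ht] with r hr
      rw [Real.rpow_neg (le_of_lt hr), div_eq_mul_inv]
    · rw [Real.rpow_sub_one ht.ne', Real.rpow_neg ht.le]
      ring
  have h2 := (hasDerivAt_id t).mul ((hasDerivAt_re_mbInt_zero hL hρ).comp t h1)
  refine h2.congr_deriv ?_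
  have e : (fun y : ℝ => (1 + ν * Complex.I * y) * L y) =
      fun y : ℝ => L y + (-ν : ℂ) * ((0 + -Complex.I * y) * L y) := by
    funext y
    ring
  have h3 : VertDecay fun y : ℝ => (-ν : ℂ) * ((0 + -Complex.I * y) * L y) := by
    have := (hL.affine_mul 0 (-Complex.I)).affine_mul (-ν) 0
    simpa using this
  rw [e, mbInt_add hL h3 0 hρ, mbInt_const_mul, ← Complex.ofReal_neg, Complex.add_re,
    Complex.re_ofReal_mul]
  simp only [id, Function.comp_apply]
  field_simp

/-! ### The fractional integral of `uTilde` and the equation. -/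

/-- The Mellin-Barnes kernel of the fractional integral of `uTilde`. -/
noncomputable def fracKernel (μ ν : ℝ) (y : ℝ) : ℂ :=
  (1 + Complex.I * y) * ((μ + Complex.I * y) * mbKernel μ ν ((0 : ℝ) + y * Complex.I)) /
    (1 + (ν * y : ℝ) * Complex.I)

theorem vertDecay_fracKernel {μ ν : ℝ} (hμ : 0 < μ) (h0 : 0 < ν) (h1 : ν ≤ 1) :
    VertDecay (fracKernel μ ν) :=
  (((vertDecay_mbKernel h0 h1 (by simp) (by simpa using hμ)).affine_mul _ _).affine_mul
    _ _).div_affine ν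

/-- The functional equation lowers the two numerator Gamma factors from `Re η = 1` to `Re η = 0`,
giving `(1+iy)(μ+iy)`. The Beta factor exchanges `Γ(1+ν+iνy)` for `Γ(2+iνy) = (1+iνy) Γ(1+iνy)` in
the denominator. -/
theorem mbKernel_one_mul {μ ν : ℝ} (hμ : 0 < μ) (h0 : 0 < ν) (y : ℝ) :
    mbKernel μ ν ((1 : ℝ) + y * Complex.I) * (Complex.Gamma (1 + ν + (ν * y : ℝ) * Complex.I) *
      (Complex.Gamma (2 + (ν * y : ℝ) * Complex.I))⁻¹) = fracKernel μ ν y := by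
  have g1 : Complex.Gamma (1 + ((1 : ℝ) + y * Complex.I)) =
      (1 + Complex.I * y) * Complex.Gamma (1 + ((0 : ℝ) + y * Complex.I)) := by
    rw [← mul_comm (y : ℂ), Complex.ofReal_zero, zero_add, ← Complex.Gamma_add_one _
      (one_add_mul_I_ne_zero y)]
    congr 1
    push_cast
    ring
  have g2 : Complex.Gamma (μ + ((1 : ℝ) + y * Complex.I)) =
      (μ + Complex.I * y) * Complex.Gamma (μ + ((0 : ℝ) + y * Complex.I)) := by
    have hne : (μ + y * Complex.I : ℂ) ≠ 0 := by
      intro h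
      have := congrArg Complex.re h
      simp at this
      exact hμ.ne' this
    rw [← mul_comm (y : ℂ), Complex.ofReal_zero, zero_add, ← Complex.Gamma_add_one _ hne]
    congr 1
    push_cast
    ring
  have g3 : Complex.Gamma (2 + (ν * y : ℝ) * Complex.I) = (1 + (ν * y : ℝ) * Complex.I) *
      Complex.Gamma (1 + (ν * y : ℝ) * Complex.I) := by
    rw [← Complex.Gamma_add_one _ (one_add_mul_I_ne_zero _)]
    congr 1
    ring
  have g4 : Complex.Gamma (1 + ν * ((1 : ℝ) + y * Complex.I)) =
      Complex.Gamma (1 + ν + (ν * y : ℝ) * Complex.I) := by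
    congr 1
    push_cast
    ring
  have g5 : Complex.Gamma (1 + ν * ((0 : ℝ) + y * Complex.I)) =
      Complex.Gamma (1 + (ν * y : ℝ) * Complex.I) := by
    congr 1
    push_cast
    ring
  have hne : Complex.Gamma (1 + ν + (ν * y : ℝ) * Complex.I) ≠ 0 :=
    Complex.Gamma_ne_zero_of_re_pos (by
      simp only [Complex.add_re, Complex.one_re, Complex.ofReal_re, Complex.re_ofReal_mul,
        Complex.I_re]
      linarith)
  rw [fracKernel, mbKernel, mbKernel, g1, g2, g3, g4, g5]
  generalize Complex.Gamma (1 + ν + (ν * y : ℝ) * Complex.I) = a at hne ⊢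
  field_simp

/-- The fractional integral of a power. -/
theorem integral_rpow_mul_cpow {ν r : ℝ} (h0 : 0 < ν) (h1 : ν < 1) (hr : 0 < r) (y : ℝ) :
    ∫ s in (0 : ℝ)..r, (((r - s) ^ (-ν) : ℝ) : ℂ) * (s : ℂ) ^ (ν * (1 + y * Complex.I)) =
      (r : ℂ) ^ (1 + ν * (y * Complex.I)) * (Complex.Gamma (1 - ν) *
        (Complex.Gamma (1 + ν + (ν * y : ℝ) * Complex.I) *
          (Complex.Gamma (2 + (ν * y : ℝ) * Complex.I))⁻¹)) := by
  have hb := Complex.betaIntegral_scaled (1 + ν + (ν * y : ℝ) * Complex.I) (1 - ν) hr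
  have hg := Complex.Gamma_mul_Gamma_eq_betaIntegral
    (s := 1 + ν + (ν * y : ℝ) * Complex.I) (t := 1 - ν)
    (by simp only [Complex.add_re, Complex.one_re, Complex.ofReal_re, Complex.re_ofReal_mul,
          Complex.I_re]
        linarith) (by simp [h1])
  have e1 : (1 + ν + (ν * y : ℝ) * Complex.I + (1 - ν) : ℂ) = 2 + (ν * y : ℝ) * Complex.I := by
    ring
  have e2 : (1 + ν + (ν * y : ℝ) * Complex.I + (1 - ν) - 1 : ℂ) = 1 + ν * (y * Complex.I) := by
    push_cast
    ring
  have hne : Complex.Gamma (2 + (ν * y : ℝ) * Complex.I) ≠ 0 :=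
    Complex.Gamma_ne_zero_of_re_pos (by simp [Complex.add_re])
  rw [e1] at hg
  have hg' : Complex.betaIntegral (1 + ν + (ν * y : ℝ) * Complex.I) (1 - ν) =
      Complex.Gamma (1 - ν) * (Complex.Gamma (1 + ν + (ν * y : ℝ) * Complex.I) *
          (Complex.Gamma (2 + (ν * y : ℝ) * Complex.I))⁻¹) := by
    field_simp
    linear_combination -hg
  rw [e2, hg'] at hb
  rw [← hb]
  refine intervalIntegral.integral_congr_ae (Eventually.of_forall fun s hs => ?_)
  rw [uIoc_of_le hr.le] at hs
  rw [Complex.ofReal_cpow (by linarith [hs.2]), mul_comm]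
  push_cast
  congr 2 <;> ring

/-- Fubini reduces the claim to fractional integrals of the powers `s^(νη)`. The line `Re η = 1` is
used so that the resulting unit shift lands on `Re η = 0`, where `𝒢` is computed. -/
theorem fractional_integral_uTilde {γ μ ν x r : ℝ} (hγ : γ ≠ 0) (hμ : 0 < μ) (h0 : 0 < ν)
    (h1 : ν < 1) (hx : 0 < x) (hr : 0 < r) :
    IntervalIntegrable (fun s : ℝ => (r - s) ^ (-ν) * uTilde γ μ ν x s) volume 0 r ∧
    1 / Real.Gamma (1 - ν) * ∫ s in (0 : ℝ)..r, (r - s) ^ (-ν) * uTilde γ μ ν x s =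
      |γ| / x * (x ^ γ)⁻¹ * (r * (mbInt 0 (fracKernel μ ν) (x ^ γ / r ^ ν)).re) := by
  have hz : 0 < x ^ γ := Real.rpow_pos_of_pos hx γ
  set z := x ^ γ
  set K : ℝ → ℂ := fun y => mbKernel μ ν ((1 : ℝ) + y * Complex.I)
  have hK : VertDecay K := vertDecay_mbKernel h0 h1.le (by norm_num) (by linarith)
  have hg : IntervalIntegrable (fun s : ℝ => (r - s) ^ (-ν) * s ^ ν) volume 0 r := by
    have h := (intervalIntegral.intervalIntegrable_rpow' (a := r) (b := 0) (r := -ν)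
      (by linarith)).comp_sub_left r
    simp only [sub_self, sub_zero] at h
    exact h.mul_continuousOn ((Real.continuous_rpow_const h0.le).continuousOn)
  rw [intervalIntegrable_iff_integrableOn_Ioc_of_le hr.le] at hg
  set F : ℝ → ℝ → ℂ := fun s y => (((r - s) ^ (-ν) : ℝ) : ℂ) *
    (K y * ((z / s ^ ν : ℝ) : ℂ) ^ (-(((1 : ℝ) : ℂ) + y * Complex.I))) with hF
  have hFint : Integrable (Function.uncurry F)
      ((volume.restrict (Ioc 0 r)).prod (volume : Measure ℝ)) := by
    have hm : Measurable (Function.uncurry F) := by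
      have := hK.1.measurable
      simp only [hF, Function.uncurry_def]
      fun_prop
    refine Integrable.mono' (Integrable.mul_prod (hg.const_mul z⁻¹) hK.integrable.norm)
      hm.aestronglyMeasurable ?_
    have hae : ∀ᵐ p ∂((volume.restrict (Ioc 0 r)).prod (volume : Measure ℝ)), p.1 ∈ Ioc 0 r :=
      Measure.quasiMeasurePreserving_fst.ae (ae_restrict_mem measurableSet_Ioc)
    filter_upwards [hae] with p hp
    have hp1 : 0 < p.1 := hp.1
    have hp2 : 0 ≤ r - p.1 := sub_nonneg.2 hp.2
    simp only [Function.uncurry_def, hF]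
    rw [norm_mul, norm_mul, norm_ofReal_cpow_vertical (by positivity), Complex.norm_real,
      Real.norm_of_nonneg (by positivity), Real.rpow_neg_one, inv_div]
    exact le_of_eq (by ring)
  have hu : ∀ s ∈ Ioc 0 r, (((r - s) ^ (-ν) * uTilde γ μ ν x s : ℝ) : ℂ) =
      ((|γ| / x / (2 * Real.pi) : ℝ) : ℂ) * ∫ y, F s y := by
    intro s hs
    have e := uTilde_eq_mbInt (μ := μ) (θ := 1) hγ h0 h1.le hx hs.1 (by norm_num) (by linarith)
    change _ = _ * (_ * ∫ y : ℝ, K y * ((z / s ^ ν : ℝ) : ℂ) ^ (-(((1 : ℝ) : ℂ) + y * Complex.I)))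
      at e
    simp only [hF]
    rw [Complex.ofReal_mul, e, integral_const_mul]
    generalize (∫ y : ℝ, K y * ((z / s ^ ν : ℝ) : ℂ) ^ (-(((1 : ℝ) : ℂ) + y * Complex.I))) = J
    push_cast
    ring
  have hint : IntegrableOn (fun s : ℝ => (((r - s) ^ (-ν) * uTilde γ μ ν x s : ℝ) : ℂ))
      (Ioc 0 r) :=
    (hFint.integral_prod_left.const_mul ((|γ| / x / (2 * Real.pi) : ℝ) : ℂ)).congr
      ((ae_restrict_mem measurableSet_Ioc).mono fun s hs => (hu s hs).symm)
  have hint' : IntervalIntegrable (fun s : ℝ => (r - s) ^ (-ν) * uTilde γ μ ν x s) volume 0 r := by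
    rw [intervalIntegrable_iff_integrableOn_Ioc_of_le hr.le]
    have h := hint.re
    simp only [RCLike.re_to_complex, Complex.ofReal_re] at h
    exact h
  refine ⟨hint', ?_⟩
  have hinner : ∀ y : ℝ, ∫ s in Ioc 0 r, F s y = Complex.Gamma (1 - ν) * ((r / z : ℝ) : ℂ) *
      (fracKernel μ ν y * ((z / r ^ ν : ℝ) : ℂ) ^ (-(((0 : ℝ) : ℂ) + y * Complex.I))) := by
    intro y
    have e1 : ∫ s in Ioc 0 r, F s y = K y * (z : ℂ) ^ (-(1 + y * Complex.I)) *
        ∫ s in (0 : ℝ)..r, (((r - s) ^ (-ν) : ℝ) : ℂ) * (s : ℂ) ^ (ν * (1 + y * Complex.I)) := by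
      rw [intervalIntegral.integral_of_le hr.le, ← integral_const_mul]
      refine setIntegral_congr_fun measurableSet_Ioc fun s hs => ?_
      simp only [hF]
      rw [← cpow_mul_cpow_eq_div_cpow hz hs.1, Complex.ofReal_one]
      ring
    have hz0 : (z : ℂ) ≠ 0 := by exact_mod_cast hz.ne'
    have hr0 : (r : ℂ) ≠ 0 := by exact_mod_cast hr.ne'
    rw [e1, integral_rpow_mul_cpow h0 h1 hr, ← mbKernel_one_mul hμ h0,
      ← cpow_mul_cpow_eq_div_cpow hz hr, Complex.ofReal_zero, zero_add, neg_add,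
      Complex.cpow_add _ _ hz0, Complex.cpow_neg_one, Complex.cpow_add _ _ hr0, Complex.cpow_one]
    change _ = _ * (K y * _ * _)
    push_cast
    ring
  have hcomplex : ((∫ s in (0 : ℝ)..r, (r - s) ^ (-ν) * uTilde γ μ ν x s : ℝ) : ℂ) =
      ((|γ| / x * z⁻¹ * r * Real.Gamma (1 - ν) : ℝ) : ℂ) *
        mbInt 0 (fracKernel μ ν) (z / r ^ ν) := by
    rw [intervalIntegral.integral_of_le hr.le, ← integral_complex_ofReal,
      setIntegral_congr_fun measurableSet_Ioc hu, integral_const_mul,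
      integral_integral_swap hFint]
    simp only [hinner]
    rw [integral_const_mul, mbInt]
    generalize (∫ y : ℝ, fracKernel μ ν y *
      ((z / r ^ ν : ℝ) : ℂ) ^ (-(((0 : ℝ) : ℂ) + y * Complex.I))) = J
    push_cast [← Complex.Gamma_ofReal]
    ring
  have hre := congrArg Complex.re hcomplex
  rw [Complex.ofReal_re, Complex.re_ofReal_mul] at hre
  rw [hre]
  have : Real.Gamma (1 - ν) ≠ 0 := (Real.Gamma_pos_of_pos (by linarith)).ne'
  field_simp

theorem uTilde_eq_re_mbInt {γ μ ν x t : ℝ} (hγ : γ ≠ 0) (hμ : 0 < μ) (h0 : 0 < ν) (h1 : ν ≤ 1)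
    (hx : 0 < x) (ht : 0 < t) : uTilde γ μ ν x t = |γ| * (x⁻¹ *
      (mbInt 0 (fun y => mbKernel μ ν ((0 : ℝ) + y * Complex.I)) (x ^ γ / t ^ ν)).re) := by
  have h := congrArg Complex.re
    (uTilde_eq_mbInt (μ := μ) (θ := 0) hγ h0 h1 hx ht (by simp) (by simpa using hμ))
  rw [Complex.ofReal_re, Complex.re_ofReal_mul] at h
  rw [h]
  ring

theorem contDiffOn_uTilde {γ μ ν t : ℝ} (hγ : γ ≠ 0) (hμ : 0 < μ) (h0 : 0 < ν) (h1 : ν ≤ 1)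
    (ht : 0 < t) : ContDiffOn ℝ 2 (fun x => uTilde γ μ ν x t) (Ioi 0) := by
  have hK : VertDecay fun y => mbKernel μ ν ((0 : ℝ) + y * Complex.I) :=
    vertDecay_mbKernel h0 h1 (by simp) (by simpa using hμ)
  have hpow : ContDiffOn ℝ 2 (fun x : ℝ => x ^ γ / t ^ ν) (Ioi 0) :=
    (contDiffOn_id.rpow_const_of_ne fun x hx => ne_of_gt hx).div_const _
  have h2 : ContDiffOn ℝ 2 (fun x : ℝ =>
      (mbInt 0 (fun y => mbKernel μ ν ((0 : ℝ) + y * Complex.I)) (x ^ γ / t ^ ν)).re) (Ioi 0) :=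
    Complex.reCLM.contDiff.comp_contDiffOn ((contDiffOn_mbInt_zero 2 hK).comp hpow
      fun x hx => div_pos (Real.rpow_pos_of_pos hx γ) (Real.rpow_pos_of_pos ht ν))
  refine (contDiffOn_const.mul ((contDiffOn_id.inv fun x hx => ne_of_gt hx).mul h2)).congr
    fun x hx => uTilde_eq_re_mbInt hγ hμ h0 h1 hx ht

/-- With `δ` acting as `-iy`, the operator `(δ-1)(δ-μ)` multiplies the kernel by `(1+iy)(μ+iy)`, and
the product is `1 + iνy` times `fracKernel`. -/
theorem genBesselOp_uTilde {γ μ ν x t : ℝ} (hγ : γ ≠ 0) (hμ : 0 < μ) (h0 : 0 < ν) (h1 : ν ≤ 1)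
    (hx : 0 < x) (ht : 0 < t) : genBesselOp γ μ (fun y => uTilde γ μ ν y t) x =
      |γ| / x * (x ^ γ)⁻¹ * (mbInt 0 (fun y => (1 + ν * Complex.I * y) * fracKernel μ ν y)
        (x ^ γ / t ^ ν)).re := by
  set K : ℝ → ℂ := fun y => mbKernel μ ν ((0 : ℝ) + y * Complex.I)
  have hK : VertDecay K := vertDecay_mbKernel h0 h1 (by simp) (by simpa using hμ)
  have hρ : 0 < x ^ γ / t ^ ν := by positivity
  have hK1 := hK.affine_mul 0 (-Complex.I)
  have hK2 := hK1.affine_mul 0 (-Complex.I)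
  rw [genBesselOp_eq hγ (Real.rpow_pos_of_pos ht ν) hx
    (fun y hy => uTilde_eq_re_mbInt hγ hμ h0 h1 hy ht)
    (fun ρ hρ => hasDerivAt_re_mbInt_zero hK hρ) (fun ρ hρ => hasDerivAt_re_mbInt_zero hK1 hρ),
    Real.rpow_sub_one hx.ne', Real.rpow_neg hx.le]
  have e : (fun y : ℝ => (1 + ν * Complex.I * y) * fracKernel μ ν y) = fun y : ℝ =>
      (0 + -Complex.I * y) * ((0 + -Complex.I * y) * K y) +
        ((-(1 + μ) : ℝ) * ((0 + -Complex.I * y) * K y) + (μ : ℝ) * K y) := by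
    funext y
    have hne := one_add_mul_I_ne_zero (ν * y)
    have e1 : 1 + ν * Complex.I * y = 1 + (ν * y : ℝ) * Complex.I := by
      push_cast
      ring
    rw [e1, fracKernel, mul_div_cancel₀ _ hne]
    change (1 + Complex.I * y) * ((μ + Complex.I * y) * K y) = _
    push_cast
    ring
  have hc : ∀ {L : ℝ → ℂ}, VertDecay L → ∀ a : ℝ, VertDecay fun y => (a : ℂ) * L y := by
    intro L hL a
    simpa using hL.affine_mul a 0
  have hsum : VertDecay fun y : ℝ =>
      (-(1 + μ) : ℝ) * ((0 + -Complex.I * y) * K y) + (μ : ℝ) * K y := by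
    convert hK.affine_mul (μ : ℂ) ((1 + μ) * Complex.I) using 2
    push_cast
    ring
  rw [e, mbInt_add hK2 hsum 0 hρ,
    mbInt_add (hc hK1 _) (hc hK _) 0 hρ, mbInt_const_mul, mbInt_const_mul]
  simp only [Complex.add_re, Complex.re_ofReal_mul]
  field_simp
  ring

theorem hasRLDerivAt_uTilde {γ μ ν x t : ℝ} (hγ : γ ≠ 0) (hμ : 0 < μ) (h0 : 0 < ν) (h1 : ν ≤ 1)
    (hx : 0 < x) (ht : 0 < t) : HasRLDerivAt ν (fun r => uTilde γ μ ν x r)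
      (genBesselOp γ μ (fun y => uTilde γ μ ν y t) x) t := by
  have hz : 0 < x ^ γ := Real.rpow_pos_of_pos hx γ
  rw [genBesselOp_uTilde hγ hμ h0 h1 hx ht]
  have h := (hasDerivAt_mul_re_mbInt (vertDecay_fracKernel hμ h0 h1) (ν := ν) hz ht).const_mul
    (|γ| / x * (x ^ γ)⁻¹)
  rcases h1.lt_or_eq with h1 | rfl
  · rw [HasRLDerivAt, if_neg h1.ne]
    refine ⟨?_, h.congr_of_eventuallyEq ?_⟩
    · filter_upwards [Ioi_mem_nhds ht] with r hr
      exact (fractional_integral_uTilde hγ hμ h0 h1 hx hr).1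
    · filter_upwards [Ioi_mem_nhds ht] with r hr
      exact (fractional_integral_uTilde hγ hμ h0 h1 hx hr).2
  · rw [HasRLDerivAt, if_pos rfl]
    refine h.congr_of_eventuallyEq ?_
    filter_upwards [Ioi_mem_nhds ht] with r (hr : 0 < r)
    have hu := uTilde_eq_mbInt (μ := μ) (θ := 1) hγ h0 le_rfl hx hr (by norm_num) (by linarith)
    -- For `ν = 1` the Beta factor equals `1`, so `uTilde` itself, written on `Re η = 1`, already
    -- has the kernel `fracKernel`.
    have e : (fun y : ℝ => mbKernel μ 1 ((1 : ℝ) + y * Complex.I)) = fracKernel μ 1 := by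
      funext y
      have hne : Complex.Gamma (2 + (1 * y : ℝ) * Complex.I) ≠ 0 :=
        Complex.Gamma_ne_zero_of_re_pos (by simp [Complex.add_re])
      rw [← mbKernel_one_mul hμ one_pos, Complex.ofReal_one, one_add_one_eq_two,
        mul_inv_cancel₀ hne, mul_one]
    rw [e, Real.rpow_one, mbInt_one_eq _ (div_pos hz hr), ← Complex.ofReal_inv] at hu
    have hre := congrArg Complex.re hu
    rw [Complex.ofReal_re, Complex.re_ofReal_mul, Complex.re_ofReal_mul] at hre
    rw [hre, Real.rpow_one]
    field_simp

/-! ### The representation by Bessel functions. -/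

/-- Since `ν(2n+1) = 1`, the offset `(1-ν)/4` equals `νn/2`. After the shift by `n/2` the Gamma
arguments are `ν(q+k)` and `ν(q+n+k)`, which for `k < n` run through `ν(q+j)`, `j < 2n`. Gauss'
formula at `νq` has one more factor, `j = 2n`, and this is `Γ(1-ν(1-q))`; it moves to the
denominator. -/
theorem prod_besselMellin {n : ℕ} {ν : ℝ} (hν : ν = 1 / (2 * (n : ℝ) + 1)) {q : ℂ}
    (hq : 0 < q.re) :
    ∏ k ∈ Finset.range n, besselMellin ν (q + (n / 2 : ℝ) + k) =
      (((ν * Real.pi) ^ n * Real.sqrt (2 * n + 1) : ℝ) : ℂ) *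
        ((2 * n + 1 : ℝ) : ℂ) ^ (-q) * (Complex.Gamma q * (Complex.Gamma (1 - ν * (1 - q)))⁻¹) := by
  have hN : (2 * (n : ℝ) + 1) ≠ 0 := by positivity
  have hNc : (2 * (n : ℂ) + 1) ≠ 0 := by exact_mod_cast hN
  have hνN : (ν : ℂ) * (2 * n + 1) = 1 := by
    rw [hν]
    push_cast
    field_simp
  have h0 : 0 < ν := by rw [hν]; positivity
  have hG := prod_Gamma_add_div_odd n (ν * q)
  have e0 : ((2 * (n : ℝ) + 1 : ℝ) : ℂ) * (ν * q) = q := by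
    push_cast
    linear_combination q * hνN
  have hj : ∀ j : ℕ, (ν * q + j / (2 * (n : ℝ) + 1 : ℝ) : ℂ) = ν * (q + j) := by
    intro j
    rw [hν]
    push_cast
    field_simp
  have hne : Complex.Gamma (1 - ν * (1 - q)) ≠ 0 := by
    refine Complex.Gamma_ne_zero_of_re_pos ?_
    have h1 : ν ≤ 1 := by
      rw [hν]
      exact div_le_one_of_le₀ (by linarith [n.cast_nonneg (α := ℝ)]) (by positivity)
    simp only [Complex.sub_re, Complex.one_re, Complex.re_ofReal_mul]
    nlinarith [mul_pos h0 hq]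
  have hterm : ∀ k : ℕ, besselMellin ν (q + (n / 2 : ℝ) + k) = (ν / 2 : ℝ) *
      (Complex.Gamma (ν * (q + k)) * Complex.Gamma (ν * (q + (n + k : ℕ)))) := by
    intro k
    have e1 : ν * (q + (n / 2 : ℝ) + k) - (1 - ν) / 4 = ν * (q + k) := by
      push_cast
      linear_combination (1 / 4 : ℂ) * hνN
    have e2 : ν * (q + (n / 2 : ℝ) + k) + (1 - ν) / 4 = ν * (q + (n + k : ℕ)) := by
      push_cast
      linear_combination (-1 / 4 : ℂ) * hνN
    rw [besselMellin, e1, e2]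
  have hlast : (ν : ℂ) * (q + (n + n : ℕ)) = 1 - ν * (1 - q) := by
    push_cast
    linear_combination hνN
  simp only [hj] at hG
  rw [Finset.prod_range_succ, two_mul, Finset.prod_range_add, hlast, e0] at hG
  simp only [hterm]
  rw [Finset.prod_mul_distrib, Finset.prod_mul_distrib, Finset.prod_const, Finset.card_range,
    ← div_eq_mul_inv, mul_div_assoc', eq_div_iff hne, mul_assoc, hG]
  push_cast
  rw [mul_pow, mul_pow, div_pow]
  field_simp

/-- Balances the constant of Gauss' formula and the power of `T = t^ν/ν` from the composition
against the stated prefactor. The exponents `(1-3ν)/(4ν)` and `(1-ν)/(4ν)` are `(n-1)/2` and `n/2`.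
-/
theorem besselConstant_eq {n : ℕ} {ν t : ℝ} (hν : ν = 1 / (2 * (n : ℝ) + 1)) (ht : 0 < t) :
    (ν * Real.pi) ^ n * Real.sqrt (2 * n + 1) * (2 * n + 1 : ℝ)⁻¹ * (t ^ ν / ν) ^ (3 * n / 2 : ℝ) *
      (ν ^ ((1 - 3 * ν) / (4 * ν)) / (Real.pi ^ 2 * t ^ (3 * ν)) ^ ((1 - ν) / (4 * ν))) = 1 := by
  have hN : 0 < 2 * (n : ℝ) + 1 := by positivity
  have h0 : 0 < ν := by rw [hν]; positivity
  have hNν : 2 * (n : ℝ) + 1 = ν⁻¹ := by rw [hν, one_div, inv_inv]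
  have hn : (n : ℝ) = (1 - ν) / (2 * ν) := by
    field_simp at hNν ⊢
    linarith
  have e1 : (1 - 3 * ν) / (4 * ν) = ((n : ℝ) - 1) / 2 := by
    rw [hn]
    field_simp
    ring
  have e2 : (1 - ν) / (4 * ν) = (n : ℝ) / 2 := by
    rw [hn]
    field_simp
    ring
  have hpi := Real.pi_pos
  rw [e1, e2, hNν, Real.sqrt_eq_rpow, div_eq_mul_inv (t ^ ν), Real.mul_rpow (by positivity)
    (by positivity), Real.mul_rpow (by positivity) (by positivity), mul_pow,
    ← Real.rpow_mul ht.le, ← Real.rpow_mul ht.le, ← Real.rpow_natCast Real.pi 2,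
    ← Real.rpow_mul hpi.le, Real.inv_rpow h0.le, Real.inv_rpow h0.le, inv_inv]
  have e3 : Real.pi ^ (((2 : ℕ) : ℝ) * (n / 2)) = Real.pi ^ n := by
    rw [← Real.rpow_natCast]
    congr 1
    push_cast
    ring
  have e4 : t ^ (3 * ν * (n / 2)) = t ^ (ν * (3 * n / 2)) := by
    congr 1
    ring
  have e5 : ν ^ ((n - 1) / 2 : ℝ) * ν * ν ^ n = ν ^ (1 / 2 : ℝ) * ν ^ (3 * n / 2 : ℝ) := by
    rw [← Real.rpow_add_one h0.ne', ← Real.rpow_natCast, ← Real.rpow_add h0, ← Real.rpow_add h0]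
    congr 1
    ring
  rw [e3, e4]
  have p1 := (Real.rpow_pos_of_pos h0 (1 / 2)).ne'
  have p2 := (Real.rpow_pos_of_pos h0 (3 * n / 2)).ne'
  have p3 := (Real.rpow_pos_of_pos ht (ν * (3 * n / 2))).ne'
  have p4 := (pow_pos hpi n).ne'
  field_simp
  linear_combination e5

/-- The Mellin transform of the weighted composition of Bessel kernels agrees with that of
`invStableDensity`. -/
theorem hasMellin_weighted_besselQIter {m : ℕ} {ν t : ℝ}
    (hν : ν = 1 / (2 * ((m + 1 : ℕ) : ℝ) + 1)) (ht : 0 < t) {q : ℂ} (hq : 0 < q.re) :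
    HasMellin (fun s => ((ν ^ ((1 - 3 * ν) / (4 * ν)) /
        (Real.pi ^ 2 * t ^ (3 * ν)) ^ ((1 - ν) / (4 * ν)) : ℝ) : ℂ) *
      ((s : ℂ) ^ (((m + 1 : ℕ) / 2 : ℝ) : ℂ) * (besselQIter ν (m + 1) s (t ^ ν / ν) : ℂ))) q
      (Complex.Gamma q * (Complex.Gamma (1 - ν * (1 - q)))⁻¹ * (t : ℂ) ^ (-(ν * (1 - q)))) := by
  have hC := besselConstant_eq hν ht
  generalize ν ^ ((1 - 3 * ν) / (4 * ν)) /
        (Real.pi ^ 2 * t ^ (3 * ν)) ^ ((1 - ν) / (4 * ν)) = C at hC ⊢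
  have h0 : 0 < ν := by rw [hν]; positivity
  have hνN : ν * (2 * ((m + 1 : ℕ) : ℝ) + 1) = 1 := by
    rw [hν]
    field_simp
  have h1 : ν < 1 := by
    rw [hν, div_lt_one (by positivity)]
    push_cast
    linarith [m.cast_nonneg (α := ℝ)]
  have hT : 0 < t ^ ν / ν := by positivity
  have h := HasMellin.const_mul (HasMellin.cpow_mul (s := q) (a := (((m + 1 : ℕ) / 2 : ℝ) : ℂ))
    (hasMellin_besselQIter h0 h1 hT m (by
      rw [Complex.add_re, Complex.ofReal_re]
      nlinarith [mul_pos h0 hq]))) (C : ℂ)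
  convert h using 1
  have hN : (0 : ℝ) < 2 * ((m + 1 : ℕ) : ℝ) + 1 := by positivity
  have hN0 : ((2 * ((m + 1 : ℕ) : ℝ) + 1 : ℝ) : ℂ) ≠ 0 := by exact_mod_cast hN.ne'
  have hTN : t ^ ν / ν = t ^ ν * (2 * ((m + 1 : ℕ) : ℝ) + 1) := by
    rw [div_eq_iff h0.ne']
    linear_combination -t ^ ν * hνN
  have hT0 : ((t ^ ν / ν : ℝ) : ℂ) ≠ 0 := by exact_mod_cast hT.ne'
  have hpow : ((t ^ ν / ν : ℝ) : ℂ) ^ (q + (((m + 1 : ℕ) / 2 : ℝ) : ℂ) + m) =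
      (t : ℂ) ^ (-(ν * (1 - q))) * ((2 * ((m + 1 : ℕ) : ℝ) + 1 : ℝ) : ℂ) ^ (q - 1) *
        (((t ^ ν / ν) ^ (3 * ((m + 1 : ℕ) : ℝ) / 2) : ℝ) : ℂ) := by
    have e : q + (((m + 1 : ℕ) / 2 : ℝ) : ℂ) + m = (q - 1) + (3 * ((m + 1 : ℕ) : ℝ) / 2 : ℝ) := by
      push_cast
      ring
    rw [e, Complex.cpow_add _ _ hT0, Complex.ofReal_cpow hT.le, hTN, Complex.ofReal_mul,
      Complex.mul_cpow_ofReal_nonneg (by positivity) hN.le,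
      ← Complex.cpow_mul_ofReal_nonneg ht.le]
    congr 3
    ring
  have hNN : ((2 * ((m + 1 : ℕ) : ℝ) + 1 : ℝ) : ℂ) ^ (-q) *
      ((2 * ((m + 1 : ℕ) : ℝ) + 1 : ℝ) : ℂ) ^ (q - 1) =
      (((2 * ((m + 1 : ℕ) : ℝ) + 1)⁻¹ : ℝ) : ℂ) := by
    rw [← Complex.cpow_add _ _ hN0, neg_add_eq_sub, sub_sub_cancel_left, Complex.cpow_neg_one,
      Complex.ofReal_inv]
  have hCc := Complex.ofReal_inj.2 hC
  rw [Complex.ofReal_mul _ C, Complex.ofReal_mul _ ((t ^ ν / ν) ^ (3 * ((m + 1 : ℕ) : ℝ) / 2)),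
    Complex.ofReal_mul _ (2 * ((m + 1 : ℕ) : ℝ) + 1)⁻¹, Complex.ofReal_one] at hCc
  rw [prod_besselMellin hν hq, hpow]
  rw [← hNN] at hCc
  linear_combination -(Complex.Gamma q * (Complex.Gamma (1 - ν * (1 - q)))⁻¹ *
    (t : ℂ) ^ (-(ν * (1 - q)))) * hCc

/-- Injectivity of the Mellin transform is not needed: for `z > 0` both integrals equal the same
Mellin-Barnes integral on `Re η = 0`. For `z = 0` the kernel is `s^(-μ)` and both are the transform
at `1 - μ`, whence `μ < 1`. -/
theorem integral_gamma_kernel_congr {k l : ℝ → ℂ} {M : ℂ → ℂ} {μ z : ℝ}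
    (hk : ∀ p : ℂ, 0 < p.re → HasMellin k p (M p)) (hl : ∀ p : ℂ, 0 < p.re → HasMellin l p (M p))
    (hμ : 0 < μ) (hz : 0 < z ∨ z = 0 ∧ μ < 1) :
    IntegrableOn (fun s : ℝ => ((s ^ (-μ) * Real.exp (-(z / s)) : ℝ) : ℂ) * k s) (Ioi 0) ∧
    ∫ s in Ioi (0 : ℝ), ((s ^ (-μ) * Real.exp (-(z / s)) : ℝ) : ℂ) * k s =
      ∫ s in Ioi (0 : ℝ), ((s ^ (-μ) * Real.exp (-(z / s)) : ℝ) : ℂ) * l s := by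
  rcases hz with hz | ⟨rfl, h1⟩
  · have e : ∀ f : ℝ → ℂ, EqOn (fun s : ℝ => ((s ^ (-μ) * Real.exp (-(z / s)) : ℝ) : ℂ) * f s)
        (fun s : ℝ => ((z ^ (-μ) : ℝ) : ℂ) *
          ((((z / s) ^ μ * Real.exp (-(z / s)) : ℝ) : ℂ) * f s)) (Ioi 0) := by
      intro f s (hs : 0 < s)
      have := (Real.rpow_pos_of_pos hz μ).ne'
      simp only
      rw [← mul_assoc, ← Complex.ofReal_mul, Real.div_rpow hz.le hs.le, Real.rpow_neg hz.le,
        Real.rpow_neg hs.le]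
      congr 2
      field_simp
    have hk' := hk ((0 : ℝ) + 1 : ℝ) (by simp)
    have hl' := hl ((0 : ℝ) + 1 : ℝ) (by simp)
    obtain ⟨i1, i2⟩ := integral_gamma_kernel_eq (μ := μ) hk'.1 (by simpa using hμ) hz
    obtain ⟨-, i3⟩ := integral_gamma_kernel_eq (μ := μ) hl'.1 (by simpa using hμ) hz
    refine ⟨IntegrableOn.congr_fun (i1.const_mul _) (e k).symm measurableSet_Ioi, ?_⟩
    rw [setIntegral_congr_fun measurableSet_Ioi (e k),
      setIntegral_congr_fun measurableSet_Ioi (e l), integral_const_mul, integral_const_mul]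
    congr 1
    have hpi : (2 * (Real.pi : ℂ)) ≠ 0 := by exact_mod_cast Real.two_pi_pos.ne'
    refine mul_left_cancel₀ hpi (i2.trans (Eq.trans ?_ i3.symm))
    refine integral_congr_ae (Eventually.of_forall fun y => ?_)
    have hre : 0 < (((0 : ℝ) : ℂ) + y * Complex.I + 1).re := by simp
    simp only
    rw [(hk _ hre).2, (hl _ hre).2]
  · have e : ∀ f : ℝ → ℂ, EqOn
        (fun s : ℝ => ((s ^ (-μ) * Real.exp (-(0 / s)) : ℝ) : ℂ) * f s)
        (fun s : ℝ => (s : ℂ) ^ (((1 - μ : ℝ) : ℂ) - 1) • f s) (Ioi 0) := by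
      intro f s (hs : 0 < s)
      simp only
      rw [zero_div, neg_zero, Real.exp_zero, mul_one, Complex.ofReal_cpow hs.le, smul_eq_mul]
      congr 2
      push_cast
      ring
    have hre : 0 < (((1 - μ : ℝ) : ℂ)).re := by simpa using h1
    refine ⟨IntegrableOn.congr_fun (hk _ hre).1 (e k).symm measurableSet_Ioi, ?_⟩
    rw [setIntegral_congr_fun measurableSet_Ioi (e k),
      setIntegral_congr_fun measurableSet_Ioi (e l)]
    exact (hk _ hre).2.trans (hl _ hre).2.symm

/-- The representation of `uTilde` by compositions of Bessel kernels. -/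
theorem uTilde_eq_besselQIntegral {γ μ x t ν : ℝ} {m : ℕ} (hγ : γ ≠ 0) (hμ : 0 < μ)
    (hν : ν = 1 / (2 * ((m + 1 : ℕ) : ℝ) + 1)) (ht : 0 < t)
    (hz : 0 < x ^ γ ∨ x ^ γ = 0 ∧ μ < 1) :
    IntegrableOn (fun s : ℝ => s ^ (1 / (4 * ν) - 1 / 4 - μ) * Real.exp (-(x ^ γ / s)) *
      besselQIter ν (m + 1) s (t ^ ν / ν)) (Ioi (0 : ℝ)) ∧
    uTilde γ μ ν x t = |γ| * (x ^ (γ * μ - 1) / Real.Gamma μ) *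
      (ν ^ ((1 - 3 * ν) / (4 * ν)) / (Real.pi ^ 2 * t ^ (3 * ν)) ^ ((1 - ν) / (4 * ν))) *
      ∫ s in Ioi (0 : ℝ), s ^ (1 / (4 * ν) - 1 / 4 - μ) * Real.exp (-(x ^ γ / s)) *
        besselQIter ν (m + 1) s (t ^ ν / ν) := by
  have h0 : 0 < ν := by rw [hν]; positivity
  have h1 : ν < 1 := by
    rw [hν, div_lt_one (by positivity)]
    push_cast
    linarith [m.cast_nonneg (α := ℝ)]
  -- The exponent of `s` in the statement is `n/2` with `n = m + 1`, the shift that centres the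
  -- Gamma factors in `prod_besselMellin`.
  have ha : 1 / (4 * ν) - 1 / 4 = ((m + 1 : ℕ) / 2 : ℝ) := by
    rw [hν]
    field_simp
    ring
  obtain ⟨i1, i2⟩ := integral_gamma_kernel_congr
    (fun p hp => hasMellin_weighted_besselQIter hν ht hp)
    (fun p hp => hasMellin_invStableDensity h0 h1 ht hp) hμ hz
  have hC : 0 < ν ^ ((1 - 3 * ν) / (4 * ν)) /
      (Real.pi ^ 2 * t ^ (3 * ν)) ^ ((1 - ν) / (4 * ν)) := by positivity
  generalize ν ^ ((1 - 3 * ν) / (4 * ν)) /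
      (Real.pi ^ 2 * t ^ (3 * ν)) ^ ((1 - ν) / (4 * ν)) = C at hC i1 i2 ⊢
  have e : EqOn (fun s : ℝ => ((s ^ (-μ) * Real.exp (-(x ^ γ / s)) : ℝ) : ℂ) *
      ((C : ℂ) * ((s : ℂ) ^ (((m + 1 : ℕ) / 2 : ℝ) : ℂ) *
        (besselQIter ν (m + 1) s (t ^ ν / ν) : ℂ))))
      (fun s : ℝ => ((C * (s ^ (1 / (4 * ν) - 1 / 4 - μ) * Real.exp (-(x ^ γ / s)) *
        besselQIter ν (m + 1) s (t ^ ν / ν)) : ℝ) : ℂ)) (Ioi 0) := by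
    intro s (hs : 0 < s)
    simp only
    rw [ha, sub_eq_add_neg, Real.rpow_add hs, ← Complex.ofReal_cpow hs.le]
    push_cast
    ring
  refine ⟨?_, ?_⟩
  · have h := ((IntegrableOn.congr_fun i1 e measurableSet_Ioi).re).const_mul C⁻¹
    refine IntegrableOn.congr_fun h (fun s _ => ?_) measurableSet_Ioi
    simp only [RCLike.re_to_complex, Complex.ofReal_re]
    rw [inv_mul_cancel_left₀ hC.ne']
  · rw [setIntegral_congr_fun measurableSet_Ioi e, integral_complex_ofReal, integral_const_mul] at i2
    simp only [← Complex.ofReal_mul] at i2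
    rw [integral_complex_ofReal, Complex.ofReal_inj] at i2
    rw [uTilde, if_neg h1.ne, mul_assoc, i2, ← integral_const_mul]
    refine setIntegral_congr_fun measurableSet_Ioi fun s hs => ?_
    rw [genGammaTilde_eq hγ x hs]
    ring

/-! ### The main theorem. -/

theorem mainTheorem1 (γ μ : ℝ) (hγ : γ ≠ 0) (hμ : 0 < μ) :
    -- the function is well defined and solves the fractional equation
    (∀ ν : ℝ, 0 < ν → ν ≤ 1 →
      (∀ x t : ℝ, 0 < x → 0 < t → ν < 1 →
        IntegrableOn (fun s : ℝ => genGammaTilde γ μ x s * invStableDensity ν s t)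
          (Ioi (0 : ℝ))) ∧
      (∀ t : ℝ, 0 < t → ContDiffOn ℝ 2 (fun x : ℝ => uTilde γ μ ν x t) (Ioi (0 : ℝ))) ∧
      (∀ x t : ℝ, 0 < x → 0 < t →
        HasRLDerivAt ν (fun r : ℝ => uTilde γ μ ν x r)
          (genBesselOp γ μ (fun y : ℝ => uTilde γ μ ν y t) x) t)) ∧
    -- the representation by integrals of modified Bessel functions, for `ν = 1/(2n+1)`
    (∀ (n : ℕ) (ν : ℝ), ν = 1 / (2 * (n : ℝ) + 1) →
      ∀ x t : ℝ, 0 < t →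
        (0 < x ∨ (x = 0 ∧ 0 < γ ∧ 1 ≤ γ * μ ∧ (n = 0 ∨ μ < 1))) →
        (∀ k : ℕ, 1 ≤ k → k < n → ∀ s : ℝ, 0 < s →
          IntegrableOn (fun r : ℝ => besselQ ν s r * besselQIter ν k r (t ^ ν / ν))
            (Ioi (0 : ℝ))) ∧
        (1 ≤ n →
          IntegrableOn (fun s : ℝ =>
            s ^ (1 / (4 * ν) - 1 / 4 - μ) * Real.exp (-(x ^ γ / s)) *
              besselQIter ν n s (t ^ ν / ν)) (Ioi (0 : ℝ))) ∧
        uTilde γ μ ν x t =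
          |γ| * (x ^ (γ * μ - 1) / Real.Gamma μ) *
            (ν ^ ((1 - 3 * ν) / (4 * ν)) /
              (Real.pi ^ 2 * t ^ (3 * ν)) ^ ((1 - ν) / (4 * ν))) *
            besselQIntegral ν n (t ^ ν / ν)
              (fun s : ℝ => s ^ (1 / (4 * ν) - 1 / 4 - μ) * Real.exp (-(x ^ γ / s)))) ∧
    -- the representation by the Fox function `H^{2,0}_{2,2}`, for every `ν ∈ (0,1]`
    (∀ ν : ℝ, 0 < ν → ν ≤ 1 → ∀ x t : ℝ, 0 < x → 0 < t →
      ∃ w : ℂ,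
        IsFoxH 2 0 ![((1 : ℝ), ν), (μ, (0 : ℝ))] ![((1 : ℝ), (1 : ℝ)), (μ, (1 : ℝ))]
          (x ^ γ / t ^ ν) w ∧
        ((uTilde γ μ ν x t : ℝ) : ℂ) = ((|γ| / x : ℝ) : ℂ) * w) := by
  refine ⟨fun ν h0 h1 => ⟨fun x t hx ht h1' =>
    integrableOn_genGammaTilde_mul_invStableDensity hγ hμ h0 h1' hx ht,
    fun t ht => contDiffOn_uTilde hγ hμ h0 h1 ht,
    fun x t hx ht => hasRLDerivAt_uTilde hγ hμ h0 h1 hx ht⟩, ?_,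
    fun ν h0 h1 x t hx ht => exists_isFoxH_uTilde hγ hμ h0 h1 hx ht⟩
  intro n ν hν x t ht hx
  rcases n with _ | m
  · have h1 : ν = 1 := by simpa using hν
    subst h1
    refine ⟨fun k _ hk => absurd hk (Nat.not_lt_zero k), fun h => absurd h (by simp), ?_⟩
    rw [uTilde, if_pos rfl, genGammaTilde_eq hγ x ht, besselQIntegral, if_pos rfl, integral_dirac]
    -- At `ν = 1` the prefactor is `1`, the point mass sits at `t`, and the exponent of `s` is `-μ`.
    norm_num
  · have h0 : 0 < ν := by rw [hν]; positivity
    have h1 : ν < 1 := by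
      rw [hν, div_lt_one (by positivity)]
      push_cast
      linarith [m.cast_nonneg (α := ℝ)]
    -- At `x = 0`, `γ > 0` gives `x^γ = 0`; here `n ≥ 1`, so the alternative `n = 0` is excluded and
    -- `μ < 1`.
    have hz : 0 < x ^ γ ∨ x ^ γ = 0 ∧ μ < 1 := by
      rcases hx with hx | ⟨rfl, hγ0, -, hn⟩
      · exact Or.inl (Real.rpow_pos_of_pos hx γ)
      · exact Or.inr ⟨Real.zero_rpow hγ0.ne', hn.resolve_left (Nat.succ_ne_zero m)⟩
    obtain ⟨i1, i2⟩ := uTilde_eq_besselQIntegral hγ hμ hν ht hz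
    refine ⟨fun k hk _ s hs => ?_, fun _ => i1, ?_⟩
    · obtain ⟨j, rfl⟩ := Nat.exists_eq_add_of_le' hk
      exact integrableOn_besselQ_mul_besselQIter h0 h1 (by positivity) hs j
    · rw [i2, besselQIntegral, if_neg (Nat.succ_ne_zero m)]
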